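/- Proposition (Checking of Wightman axioms). Fix real numbers $\varepsilon,m>0$. Setup. Put $L_2:=L_2[-\frac{\pi}{\varepsilon};\frac{\pi}{\varepsilon}]$ (complex-valued functions of $p$, Lebesgue measure, inner product $\langle f|g\rangle=\int f^*g\,dp$ antilinear in the first argument, $^*$ is complex conjugation) and $$\omega_p:=\frac1\varepsilon\arccos\frac{\cos p\varepsilon}{\sqrt{1+m^2\varepsilon^2}},\qquad \alpha_p\in[0,\pi],\quad \cot\alpha_p=\frac{\sin p\varepsilon}{m\varepsilon}.$$ Let $\bigwedge^nL_2$ be the Hilbert exterior power, that is, the space of antisymmetric elements of the Hilbert tensor power $L_2^{\otimes n}$, where $u_1\wedge\dots\wedge u_n:=\frac1{n!}\sum_{\sigma}\mathrm{sgn}(\sigma)\,u_{\sigma(1)}\otimes\dots\otimes u_{\sigma(n)}$. Let $\mathcal H:=\left(\bigoplus_{n\ge0}\bigwedge^nL_2\right)^{\otimes2}$ (Hilbert sum and Hilbert tensor product), let $|0\rangle=1\otimes1$ with $1\in\mathbb C=\bigwedge^0L_2$, and let $\mathcal H^0\subset\mathcal H$ be the (incomplete) linear span of the Hilbert tensor products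 $\bigwedge^nL_2\otimes\bigwedge^lL_2$ for $n,l\ge0$. For a real bounded function $h$ on $[-\frac\pi\varepsilon;\frac\pi\varepsilon]$ consider the operator on $\mathcal H^0$, continuous on each summand $\bigwedge^nL_2\otimes\bigwedge^lL_2$, given by $$u_1\wedge\dots\wedge u_n\otimes v_1\wedge\dots\wedge v_l\mapsto (hu_1)\wedge\dots\wedge u_n\otimes v_1\wedge\dots\wedge v_l+\dots+u_1\wedge\dots\wedge u_n\otimes v_1\wedge\dots\wedge(hv_l).$$ The Hamiltonian $H$ and the momentum operator $P$ are these operators for $h(p)=\omega_p$ and $h(p)=p$ respectively. The operator $e^{-iHt}$ on $\mathcal H$ is the bounded operator taking $u_1\wedge\dots\wedge u_n\otimes v_1\wedge\dots\wedge v_l$ to the product of the functions $e^{-i\omega_pt}u_j$ and $e^{-i\omega_pt}v_j$; the operator $e^{-iPx}$ is defined analogously with $e^{-ipx}$, and $e^{biH-aiP}:=e^{biH}e^{-aiP}$, $e^{aiP-biH}:=e^{aiP}e^{-biH}$ (these operators commute). For $f\in L_2$ the creation operators are the bounded operators on $\mathcal H$ given by $$a(f)^\dagger(u\otimes v)=\sqrt{n+1}\,(f\wedge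 u)\otimes v,\qquad b(f)^\dagger(u\otimes v)=(-1)^n\sqrt{l+1}\,u\otimes(f^*\wedge v)\qquad(u\in\textstyle\bigwedge^nL_2,\ v\in\bigwedge^lL_2),$$ and $a(f)$, $b(f)$ are their adjoints. For $x,t\in\varepsilon\mathbb Z$ and $k\in\{1,2\}$ put $$\psi_k(x,t):=a(f_{k,x,t})+b(f_{k,x,t}^*)^\dagger,\quad f_{1,x,t}(p)=\sqrt{\tfrac\varepsilon\pi}\,i\cos\tfrac{\alpha_p}2\,e^{i\omega_pt-ipx},\quad f_{2,x,t}(p)=\sqrt{\tfrac\varepsilon\pi}\,\sin\tfrac{\alpha_p}2\,e^{i\omega_pt-ipx},$$ and let $\psi_k^\dagger(x,t)$ be the adjoint of $\psi_k(x,t)$. Claim. The following conditions hold. Axiom 1: $\psi_k(x,t)$ is a bounded linear operator on $\mathcal H$ for each $(x,t)\in\varepsilon\mathbb Z^2$ and $k\in\{1,2\}$. Axiom 2: $|0\rangle\ne0$ is the unique up to proportionality vector in $\mathcal H$ such that $e^{iH\varepsilon}|0\rangle=e^{iP\varepsilon}|0\rangle=|0\rangle$. Axiom 3: the vectors $\psi_{k_1}(x_1,t_1)\dots\psi_{k_l}(x_l,t_l)\psi^\dagger_{k_{l+1}}(x_{l+1},t_{l+1})\dots\psi^\dagger_{k_{l+n}}(x_{l+n},t_{l+n})|0\rangle$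 for all integers $n,l\ge0$, $k_j\in\{1,2\}$, $(x_j,t_j)\in\varepsilon\mathbb Z^2$ span a dense linear subspace of $\mathcal H$. Axiom 4 (weakened): $e^{biH-aiP}\,\psi_k(x,t)\,e^{aiP-biH}=\psi_k(x+a,t+b)$ for all $k\in\{1,2\}$ and $(x,t),(a,b)\in\varepsilon\mathbb Z^2$. Axiom 5 (weakened): the operators $H$ and $H^2-(1-\omega_0\varepsilon/\pi)^2P^2$ on $\mathcal H^0$ are nonnegative, that is, symmetric with $\langle\Psi|H\Psi\rangle\ge0$ and $\langle\Psi|(H^2-(1-\omega_0\varepsilon/\pi)^2P^2)\Psi\rangle\ge0$ for each $\Psi\in\mathcal H^0$. Axiom 6: $[\psi_k(x,t),\psi_{k'}(x',t')]_+=[\psi_k(x,t),\psi^\dagger_{k'}(x',t')]_+=[\psi^\dagger_k(x,t),\psi^\dagger_{k'}(x',t')]_+=0$ for all $k,k'\in\{1,2\}$ and $(x,t),(x',t')\in\varepsilon\mathbb Z^2$ such that $|x-x'|>|t-t'|$, where $[a,b]_+:=ab+ba$. -/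

import Mathlib

open MeasureTheory
open scoped ENNReal TensorProduct

noncomputable section
namespace FeynmanAnticheckers

section HilbertTensor

/-- The tensor product of Hilbert spaces: the completion of the algebraic tensor product. -/
def HilbertTensor (E F : Type) [NormedAddCommGroup E] [InnerProductSpace ℂ E]
    [NormedAddCommGroup F] [InnerProductSpace ℂ F] : Type :=
  UniformSpace.Completion (E ⊗[ℂ] F)

namespace HilbertTensor

variable {E F E' F' : Type} [NormedAddCommGroup E] [InnerProductSpace ℂ E]
  [NormedAddCommGroup F] [InnerProductSpace ℂ F] [NormedAddCommGroup E'] [InnerProductSpace ℂ E']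
  [NormedAddCommGroup F'] [InnerProductSpace ℂ F']

instance : NormedAddCommGroup (HilbertTensor E F) :=
  inferInstanceAs (NormedAddCommGroup (UniformSpace.Completion (E ⊗[ℂ] F)))

instance : InnerProductSpace ℂ (HilbertTensor E F) :=
  inferInstanceAs (InnerProductSpace ℂ (UniformSpace.Completion (E ⊗[ℂ] F)))

instance : CompleteSpace (HilbertTensor E F) :=
  inferInstanceAs (CompleteSpace (UniformSpace.Completion (E ⊗[ℂ] F)))

variable (E F) in
/-- The embedding of the algebraic tensor product into its completion. -/
def incl : E ⊗[ℂ] F →ₗᵢ[ℂ] HilbertTensor E F :=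
  (UniformSpace.Completion.toComplₗᵢ : E ⊗[ℂ] F →ₗᵢ[ℂ] UniformSpace.Completion (E ⊗[ℂ] F))

theorem denseRange_incl : DenseRange (incl E F) :=
  UniformSpace.Completion.denseRange_coe (α := E ⊗[ℂ] F)

/-- The elementary tensor `u ⊗ v`. -/
def tmul (u : E) (v : F) : HilbertTensor E F := incl E F (u ⊗ₜ[ℂ] v)

/-- The bounded operator `S ⊗ T`. -/
def map (S : E →L[ℂ] E') (T : F →L[ℂ] F') : HilbertTensor E F →L[ℂ] HilbertTensor E' F' :=
  (TensorProduct.mapL S T).completion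

theorem map_incl (S : E →L[ℂ] E') (T : F →L[ℂ] F') (x : E ⊗[ℂ] F) :
    map S T (incl E F x) = incl E' F' (TensorProduct.mapL S T x) :=
  ContinuousLinearMap.completion_apply_coe (TensorProduct.mapL S T) x

theorem map_tmul (S : E →L[ℂ] E') (T : F →L[ℂ] F') (u : E) (v : F) :
    map S T (tmul u v) = tmul (S u) (T v) := by
  rw [tmul, map_incl, TensorProduct.mapL_tmul, tmul]

theorem map_map {E'' F'' : Type} [NormedAddCommGroup E''] [InnerProductSpace ℂ E'']
    [NormedAddCommGroup F''] [InnerProductSpace ℂ F''] (S : E' →L[ℂ] E'') (T : F' →L[ℂ] F'')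
    (S' : E →L[ℂ] E') (T' : F →L[ℂ] F') (Ψ : HilbertTensor E F) :
    map S T (map S' T' Ψ) = map (S.comp S') (T.comp T') Ψ := by
  revert Ψ
  refine congr_fun (denseRange_incl.equalizer (by fun_prop) (by fun_prop) (funext fun x => ?_))
  simp only [Function.comp_apply, map_incl, TensorProduct.mapL_comp,
    ContinuousLinearMap.comp_apply]

end HilbertTensor

end HilbertTensor

/-- The interval `[-π/ε; π/ε]` of momenta, with Lebesgue measure. -/
abbrev Zone (ε : ℝ) : Type := Set.Icc (-(Real.pi / ε)) (Real.pi / ε)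

instance (ε : ℝ) : MeasureSpace (Zone ε) := Measure.Subtype.measureSpace

instance (ε : ℝ) : IsFiniteMeasure (volume : Measure (Zone ε)) := by
  refine ⟨?_⟩
  rw [Measure.Subtype.volume_univ measurableSet_Icc.nullMeasurableSet]
  simp

variable (ε : ℝ)

/-- The one-particle space `L₂[-π/ε; π/ε]`. -/
abbrev OneParticle : Type := Lp ℂ 2 (volume : Measure (Zone ε))

/-- The `n`-th Hilbert tensor power of `L₂[-π/ε; π/ε]`, that is, `L₂([-π/ε; π/ε]ⁿ)`.
`u₁ ⊗ ⋯ ⊗ uₙ` is the function `p ↦ u₁(p₁) ⋯ uₙ(pₙ)`. -/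
abbrev TensorPower (n : ℕ) : Type := Lp ℂ 2 (volume : Measure (Fin n → Zone ε))


variable {ε}

theorem measurePreserving_perm {n : ℕ} (σ : Equiv.Perm (Fin n)) :
    MeasurePreserving (fun p : Fin n → Zone ε => p ∘ σ) volume volume := by
  have := volume_measurePreserving_piCongrLeft (fun _ : Fin n => Zone ε) σ.symm
  convert this using 1
  ext p i
  simp [MeasurableEquiv.coe_piCongrLeft, Equiv.piCongrLeft_apply]
  

/-- The action of a permutation on the tensor power: `g ↦ g(p_{σ 1}, …, p_{σ n})`. -/
def permOp {n : ℕ} (σ : Equiv.Perm (Fin n)) : TensorPower ε n →ₗᵢ[ℂ] TensorPower ε n :=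
  Lp.compMeasurePreservingₗᵢ ℂ (fun p => p ∘ σ) (measurePreserving_perm σ)

/-- The sign of a permutation as a complex number. -/
def signC {n : ℕ} (σ : Equiv.Perm (Fin n)) : ℂ := ((Equiv.Perm.sign σ : ℤ) : ℂ)

variable (ε) in
/-- The `n`-th Hilbert exterior power of `L₂[-π/ε; π/ε]`: antisymmetric tensors, with the norm of
the tensor power (so that `√n! u₁ ∧ ⋯ ∧ uₙ` is a unit vector for orthonormal `u₁, …, uₙ`). -/
def ExteriorPower (n : ℕ) : Submodule ℂ (TensorPower ε n) where
  carrier := {g | ∀ σ : Equiv.Perm (Fin n), permOp σ g = signC σ • g}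
  add_mem' hf hg σ := by rw [map_add, hf σ, hg σ, smul_add]
  zero_mem' σ := by simp
  smul_mem' c g hg σ := by rw [map_smul, hg σ, smul_comm]

theorem mem_exteriorPower {n : ℕ} {g : TensorPower ε n} :
    g ∈ ExteriorPower ε n ↔ ∀ σ : Equiv.Perm (Fin n), permOp σ g = signC σ • g := Iff.rfl

instance (n : ℕ) : CompleteSpace (ExteriorPower ε n) := by
  refine IsClosed.completeSpace_coe (hs := ?_)
  have : ((ExteriorPower ε n : Submodule ℂ (TensorPower ε n)) : Set (TensorPower ε n))
      = ⋂ σ : Equiv.Perm (Fin n), {g | permOp σ g = signC σ • g} := by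
    ext g; simp [ExteriorPower]
  rw [this]
  exact isClosed_iInter fun σ => isClosed_eq (permOp σ).continuous (continuous_const_smul _)

theorem permOp_mul {n : ℕ} (σ τ : Equiv.Perm (Fin n)) (g : TensorPower ε n) :
    permOp (σ * τ) g = permOp σ (permOp τ g) := by
  exact Lp.compMeasurePreserving_comp_apply g (measurePreserving_perm τ) (measurePreserving_perm σ)

theorem permOp_one {n : ℕ} (g : TensorPower ε n) : permOp 1 g = g :=
  Lp.compMeasurePreserving_id_apply g

theorem signC_mul {n : ℕ} (σ τ : Equiv.Perm (Fin n)) : signC (σ * τ) = signC σ * signC τ := by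
  simp [signC]

theorem signC_mul_self {n : ℕ} (σ : Equiv.Perm (Fin n)) : signC σ * signC σ = 1 := by
  rw [signC, ← Int.cast_mul, Int.units_coe_mul_self, Int.cast_one]

/-- The projection `Alt g = (1/n!) ∑ sign(σ) σ·g` onto antisymmetric tensors. -/
def antisymmetrize (n : ℕ) : TensorPower ε n →L[ℂ] ExteriorPower ε n :=
  ContinuousLinearMap.codRestrict
    ((n.factorial : ℂ)⁻¹ • ∑ σ : Equiv.Perm (Fin n), signC σ • (permOp σ).toContinuousLinearMap)
    (ExteriorPower ε n) (by
      intro g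
      refine mem_exteriorPower.2 fun τ => ?_
      have key : ∑ σ : Equiv.Perm (Fin n), signC σ • permOp (τ * σ) g
          = signC τ • ∑ σ : Equiv.Perm (Fin n), signC σ • permOp σ g := by
        rw [Finset.smul_sum]
        refine Fintype.sum_equiv (Equiv.mulLeft τ) _ _ fun σ => ?_
        rw [Equiv.coe_mulLeft, signC_mul, smul_smul, ← mul_assoc, signC_mul_self, one_mul]
      simp only [smul_apply, sum_apply,
        LinearIsometry.coe_toContinuousLinearMap, map_smul, map_sum, ← permOp_mul, key]
      rw [smul_comm])

theorem memLp_tensorCons {n : ℕ} (f : OneParticle ε) (u : TensorPower ε n) :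
    MemLp (fun p : Fin (n + 1) → Zone ε => f (p 0) * u (Fin.tail p)) 2 volume := by
  have hmp := volume_preserving_piFinSuccAbove (fun _ : Fin (n + 1) => Zone ε) 0
  have hprod : MemLp (fun z : Zone ε × (Fin n → Zone ε) => f z.1 * u z.2) 2 volume := by
    have hm : AEStronglyMeasurable (fun z : Zone ε × (Fin n → Zone ε) => f z.1 * u z.2) volume :=
      (Lp.aestronglyMeasurable f).comp_fst.mul (Lp.aestronglyMeasurable u).comp_snd
    refine (memLp_two_iff_integrable_sq_norm hm).2 ?_
    have := ((memLp_two_iff_integrable_sq_norm (Lp.aestronglyMeasurable f)).1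
      (Lp.memLp f)).mul_prod
      ((memLp_two_iff_integrable_sq_norm (Lp.aestronglyMeasurable u)).1 (Lp.memLp u))
    simp only [norm_mul, mul_pow]
    exact this
  exact hprod.comp_measurePreserving hmp


theorem norm_toLp_tensorCons {n : ℕ} (f : OneParticle ε) (u : TensorPower ε n) :
    ‖(memLp_tensorCons f u).toLp‖ = ‖f‖ * ‖u‖ := by
  have sq : ∀ {X : Type} [MeasureSpace X] (g : Lp ℂ 2 (volume : Measure X)),
      ((‖g‖ ^ 2 : ℝ) : ℂ) = ((∫ x, ‖g x‖ ^ 2 : ℝ) : ℂ) := by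
    intro X _ g
    have h := L2.inner_def (𝕜 := ℂ) g g
    rw [inner_self_eq_norm_sq_to_K] at h
    push_cast
    rw [← integral_complex_ofReal]
    refine h.trans (integral_congr_ae (.of_forall fun x => ?_))
    simp only [inner_self_eq_norm_sq_to_K]
    push_cast
    rfl
  have sq' : ∀ {X : Type} [MeasureSpace X] (g : Lp ℂ 2 (volume : Measure X)),
      ‖g‖ ^ 2 = ∫ x, ‖g x‖ ^ 2 := fun g => by exact_mod_cast sq g
  have hmp := volume_preserving_piFinSuccAbove (fun _ : Fin (n + 1) => Zone ε) 0
  have h1 : ‖(memLp_tensorCons f u).toLp‖ ^ 2 = (‖f‖ * ‖u‖) ^ 2 := by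
    rw [mul_pow, sq', sq', sq', ← integral_prod_mul]
    rw [integral_congr_ae (g := fun p : Fin (n + 1) → Zone ε => ‖f (p 0)‖ ^ 2 * ‖u (Fin.tail p)‖ ^ 2)]
    · exact hmp.integral_comp' (fun z : Zone ε × (Fin n → Zone ε) => ‖f z.1‖ ^ 2 * ‖u z.2‖ ^ 2)
    · filter_upwards [(memLp_tensorCons f u).coeFn_toLp] with p hp
      rw [hp, norm_mul, mul_pow]
  exact (pow_left_inj₀ (norm_nonneg _) (by positivity) two_ne_zero).1 h1

theorem quasiMeasurePreserving_tail (n : ℕ) :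
    Measure.QuasiMeasurePreserving (Fin.tail : (Fin (n + 1) → Zone ε) → (Fin n → Zone ε))
      volume volume :=
  Measure.quasiMeasurePreserving_snd.comp
    (volume_preserving_piFinSuccAbove (fun _ : Fin (n + 1) => Zone ε) 0).quasiMeasurePreserving

/-- The operator `u ↦ f ⊗ u`. -/
def tensorCons {n : ℕ} (f : OneParticle ε) : TensorPower ε n →L[ℂ] TensorPower ε (n + 1) :=
  LinearMap.mkContinuous
    { toFun := fun u => (memLp_tensorCons f u).toLp
      map_add' := fun u v => by
        ext1
        filter_upwards [(memLp_tensorCons f (u + v)).coeFn_toLp, (memLp_tensorCons f u).coeFn_toLp,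
          (memLp_tensorCons f v).coeFn_toLp, Lp.coeFn_add (memLp_tensorCons f u).toLp
          (memLp_tensorCons f v).toLp, (quasiMeasurePreserving_tail n).ae (Lp.coeFn_add u v)]
          with p h1 h2 h3 h4 h5
        rw [h1, h4, Pi.add_apply, h2, h3, h5, Pi.add_apply, mul_add]
      map_smul' := fun c u => by
        ext1
        filter_upwards [(memLp_tensorCons f (c • u)).coeFn_toLp, (memLp_tensorCons f u).coeFn_toLp,
          Lp.coeFn_smul c (memLp_tensorCons f u).toLp,
          (quasiMeasurePreserving_tail n).ae (Lp.coeFn_smul c u)]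
          with p h1 h2 h3 h4
        rw [h1, RingHom.id_apply, h3, Pi.smul_apply, h2, h4, Pi.smul_apply, smul_eq_mul,
          smul_eq_mul, mul_left_comm] }
    ‖f‖ (fun u => (norm_toLp_tensorCons f u).le)

theorem coeFn_tensorCons {n : ℕ} (f : OneParticle ε) (u : TensorPower ε n) :
    tensorCons f u =ᵐ[volume] fun p => f (p 0) * u (Fin.tail p) :=
  (memLp_tensorCons f u).coeFn_toLp

theorem norm_tensorCons {n : ℕ} (f : OneParticle ε) (u : TensorPower ε n) :
    ‖tensorCons f u‖ = ‖f‖ * ‖u‖ := norm_toLp_tensorCons f u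

theorem coeFn_permOp {n : ℕ} (σ : Equiv.Perm (Fin n)) (g : TensorPower ε n) :
    permOp σ g =ᵐ[volume] fun p => g (p ∘ σ) :=
  Lp.coeFn_compMeasurePreserving g (measurePreserving_perm σ)

theorem integral_exchange_nonneg {X R : Type} [MeasureSpace X] [MeasureSpace R]
    [SFinite (volume : Measure X)] [SFinite (volume : Measure R)] (f : X → ℂ) (u : X × R → ℂ)
    (hint : Integrable (fun z : X × (X × R) =>
      (f z.2.1 * u (z.1, z.2.2)) * star (f z.1 * u z.2)) volume) :
    0 ≤ (∫ z : X × (X × R), (f z.2.1 * u (z.1, z.2.2)) * star (f z.1 * u z.2)).re := by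
  have hmp : MeasurePreserving (MeasurableEquiv.prodAssoc : (X × X) × R ≃ᵐ X × (X × R))
      volume volume := measurePreserving_prodAssoc _ _ _
  rw [← hmp.integral_comp', Measure.volume_eq_prod, integral_prod_symm]
  · have : ∀ r : R, (∫ z : X × X, (f z.2 * u (z.1, r)) * star (f z.1 * u (z.2, r)))
        = ((Complex.normSq (∫ x : X, star (f x) * u (x, r)) : ℝ) : ℂ) := by
      intro r
      rw [← Complex.mul_conj, ← integral_conj, Measure.volume_eq_prod, ← integral_prod_mul]
      refine integral_congr_ae (.of_forall fun z => ?_)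
      simp only [star_mul', RingHomCompTriple.comp_apply, map_mul, Complex.star_def,
        RingHom.id_apply]
      ring
    simp only [MeasurableEquiv.prodAssoc, MeasurableEquiv.coe_mk, Equiv.prodAssoc_apply]
    simp only [this]
    rw [integral_complex_ofReal, Complex.ofReal_re]
    exact integral_nonneg fun r => Complex.normSq_nonneg _
  · exact hmp.integrable_comp_emb (MeasurableEquiv.measurableEmbedding _) |>.2 hint

theorem re_inner_swap_nonneg {n : ℕ} (f : OneParticle ε) (u : TensorPower ε n) (i : Fin n) :
    0 ≤ (inner ℂ (tensorCons f u) (permOp (Equiv.swap 0 i.succ) (tensorCons f u))).re := by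
  obtain _ | k := n
  · exact i.elim0
  set w := tensorCons f u with hw
  set s : Equiv.Perm (Fin (k + 2)) := Equiv.swap 0 i.succ with hs
  let e : (Fin (k + 2) → Zone ε) ≃ᵐ Zone ε × (Zone ε × (Fin k → Zone ε)) :=
    (MeasurableEquiv.piFinSuccAbove (fun _ => Zone ε) 0).trans
      ((MeasurableEquiv.refl _).prodCongr (MeasurableEquiv.piFinSuccAbove (fun _ => Zone ε) i))
  have he : MeasurePreserving e volume volume :=
    ((MeasurePreserving.id _).prod
      (volume_preserving_piFinSuccAbove (fun _ : Fin (k + 1) => Zone ε) i)).comp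
      (volume_preserving_piFinSuccAbove (fun _ : Fin (k + 2) => Zone ε) 0)
  let u' : Zone ε × (Fin k → Zone ε) → ℂ := fun z => u (i.insertNth z.1 z.2)
  let F : Zone ε × (Zone ε × (Fin k → Zone ε)) → ℂ := fun z =>
    (f z.2.1 * u' (z.1, z.2.2)) * star (f z.1 * u' z.2)
  have hF : (fun p => inner ℂ (w p) (permOp s w p)) =ᵐ[volume] fun p => F (e p) := by
    have hw1 : w =ᵐ[volume] fun p => f (p 0) * u (Fin.tail p) := coeFn_tensorCons f u
    filter_upwards [coeFn_permOp s w, hw1,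
      (measurePreserving_perm s).quasiMeasurePreserving.ae hw1] with p h1 h2 h3
    have e1 : e p = (p 0, (p i.succ, i.removeNth (Fin.tail p))) := by
      rfl
    have e2 : i.insertNth (p i.succ) (i.removeNth (Fin.tail p)) = Fin.tail p :=
      Fin.insertNth_self_removeNth i (Fin.tail p)
    have e3 : i.insertNth (p 0) (i.removeNth (Fin.tail p)) = Fin.tail (p ∘ s) := by
      refine Fin.insertNth_eq_iff.2 ⟨?_, ?_⟩
      · simp [Fin.tail, hs]
      · ext1 j
        simp only [Fin.removeNth, Fin.tail, Function.comp_apply, hs]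
        rw [Equiv.swap_apply_of_ne_of_ne (Fin.succ_ne_zero _)]
        exact fun h => Fin.succAbove_ne i j (Fin.succ_injective _ h)
    rw [h1, h2, h3]
    simp only [F, u', e1, e2, e3, Function.comp_apply]
    rw [show s 0 = i.succ from Equiv.swap_apply_left _ _]
    rfl
  have hint := (L2.integrable_inner (𝕜 := ℂ) w (permOp s w)).congr hF
  rw [L2.inner_def, integral_congr_ae hF, he.integral_comp']
  exact integral_exchange_nonneg f u' ((he.integrable_comp_emb e.measurableEmbedding).1 hint)

theorem conj_signC {n : ℕ} (σ : Equiv.Perm (Fin n)) : star (signC σ) = signC σ := by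
  simp [signC]

theorem coe_antisymmetrize {n : ℕ} (w : TensorPower ε n) :
    (antisymmetrize n w : TensorPower ε n)
      = (n.factorial : ℂ)⁻¹ • ∑ σ : Equiv.Perm (Fin n), signC σ • permOp σ w := by
  rw [antisymmetrize, ContinuousLinearMap.coe_codRestrict_apply]
  simp only [smul_apply, sum_apply, LinearIsometry.coe_toContinuousLinearMap]

theorem antisymmetrize_inner {n : ℕ} (w : TensorPower ε n) (s : ExteriorPower ε n) :
    inner ℂ ((antisymmetrize n w : TensorPower ε n)) (s : TensorPower ε n)
      = inner ℂ w (s : TensorPower ε n) := by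
  have h : ∀ σ : Equiv.Perm (Fin n), inner ℂ (signC σ • permOp σ w) (s : TensorPower ε n)
      = inner ℂ w (s : TensorPower ε n) := by
    intro σ
    have hs : (s : TensorPower ε n) = signC σ • permOp σ (s : TensorPower ε n) := by
      rw [s.2 σ, smul_smul, signC_mul_self, one_smul]
    conv_lhs => rw [hs]
    rw [inner_smul_left, inner_smul_right, LinearIsometry.inner_map_map, ← mul_assoc,
      ← Complex.star_def, conj_signC, signC_mul_self, one_mul]
  rw [coe_antisymmetrize, inner_smul_left, sum_inner, Finset.sum_congr rfl fun σ _ => h σ,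
    Finset.sum_const, Finset.card_univ, Fintype.card_perm, Fintype.card_fin, nsmul_eq_mul,
    ← mul_assoc]
  rw [map_inv₀, map_natCast, inv_mul_cancel₀ (by exact_mod_cast n.factorial_ne_zero), one_mul]

theorem permOp_decomposeFin {n : ℕ} (f : OneParticle ε) (u : ExteriorPower ε n)
    (j : Fin (n + 1)) (e : Equiv.Perm (Fin n)) :
    permOp (Equiv.Perm.decomposeFin.symm (j, e)) (tensorCons f (u : TensorPower ε n))
      = signC e • permOp (Equiv.swap 0 j) (tensorCons f (u : TensorPower ε n)) := by
  have hdec : Equiv.Perm.decomposeFin.symm (j, e)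
      = Equiv.swap 0 j * Equiv.Perm.decomposeFin.symm (0, e) := by
    ext x
    refine Fin.cases ?_ (fun y => ?_) x <;> simp
  have hlift : permOp (Equiv.Perm.decomposeFin.symm (0, e)) (tensorCons f (u : TensorPower ε n))
      = signC e • tensorCons f (u : TensorPower ε n) := by
    rw [← map_smul, ← u.2 e]
    ext1
    have hw := coeFn_tensorCons f (u : TensorPower ε n)
    filter_upwards [coeFn_permOp (Equiv.Perm.decomposeFin.symm (0, e))
      (tensorCons f (u : TensorPower ε n)),
      (measurePreserving_perm (Equiv.Perm.decomposeFin.symm (0, e))).quasiMeasurePreserving.ae hw,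
      coeFn_tensorCons f (permOp e (u : TensorPower ε n)),
      (quasiMeasurePreserving_tail n).ae (coeFn_permOp e (u : TensorPower ε n))] with p h1 h2 h3 h4
    rw [h1, h2, h3, h4]
    congr 2
  rw [hdec, permOp_mul, hlift, map_smul]

/-- The bound that makes the creation operators bounded. -/
theorem norm_wedge_le {n : ℕ} (f : OneParticle ε) (u : ExteriorPower ε n) :
    Real.sqrt (n + 1) * ‖antisymmetrize (n + 1) (tensorCons f (u : TensorPower ε n))‖
      ≤ ‖f‖ * ‖u‖ := by
  set w := tensorCons f (u : TensorPower ε n) with hw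
  set a := antisymmetrize (n + 1) w with ha
  have h1 : ‖a‖ ^ 2 = (inner ℂ w (a : TensorPower ε (n + 1))).re := by
    rw [← antisymmetrize_inner, ← ha]
    exact (inner_self_eq_norm_sq (𝕜 := ℂ) (a : TensorPower ε (n + 1))).symm
  have hterm : ∀ (j : Fin (n + 1)) (e : Equiv.Perm (Fin n)),
      (inner ℂ w (signC (Equiv.Perm.decomposeFin.symm (j, e))
        • permOp (Equiv.Perm.decomposeFin.symm (j, e)) w)).re ≤ if j = 0 then ‖w‖ ^ 2 else 0 := by
    intro j e
    have hsign : signC (Equiv.Perm.decomposeFin.symm (j, e)) = (if j = 0 then 1 else -1) * signC e := by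
      simp only [signC, Equiv.Perm.decomposeFin.symm_sign]
      split_ifs <;> simp
    rw [hw, permOp_decomposeFin, ← hw, smul_smul, hsign, mul_assoc, signC_mul_self, mul_one,
      inner_smul_right]
    by_cases hj : j = 0
    · subst hj
      rw [if_pos rfl, if_pos rfl, one_mul, Equiv.swap_self]
      change (inner ℂ w (permOp 1 w)).re ≤ _
      rw [permOp_one]
      exact (inner_self_eq_norm_sq (𝕜 := ℂ) w).le
    · obtain ⟨i, rfl⟩ := Fin.exists_succ_eq.2 hj
      rw [if_neg hj, if_neg hj, neg_one_mul, Complex.neg_re]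
      have := re_inner_swap_nonneg f (u : TensorPower ε n) i
      rw [← hw] at this
      linarith
  have h2 : ((n + 1).factorial : ℝ) * ‖a‖ ^ 2 ≤ n.factorial * ‖w‖ ^ 2 := by
    have hsum : ((n + 1).factorial : ℝ) * ‖a‖ ^ 2
        = ∑ σ : Equiv.Perm (Fin (n + 1)), (inner ℂ w (signC σ • permOp σ w)).re := by
      rw [h1, ha, coe_antisymmetrize, inner_smul_right, inner_sum, ← Complex.re_sum]
      have hc : (((n + 1).factorial : ℂ))⁻¹ = (((((n + 1).factorial : ℝ))⁻¹ : ℝ) : ℂ) := by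
        push_cast; rfl
      rw [hc, Complex.re_ofReal_mul, ← mul_assoc,
        mul_inv_cancel₀ (by exact_mod_cast (n + 1).factorial_ne_zero), one_mul]
    rw [hsum, ← Equiv.sum_comp Equiv.Perm.decomposeFin.symm, Fintype.sum_prod_type]
    calc _ ≤ ∑ j : Fin (n + 1), ∑ _e : Equiv.Perm (Fin n), (if j = 0 then ‖w‖ ^ 2 else 0) :=
          Finset.sum_le_sum fun j _ => Finset.sum_le_sum fun e _ => hterm j e
      _ = _ := by simp [Finset.card_univ, Fintype.card_perm]
  have h3 : ((n : ℝ) + 1) * ‖a‖ ^ 2 ≤ ‖w‖ ^ 2 := by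
    have hpos : (0 : ℝ) < n.factorial := by exact_mod_cast n.factorial_pos
    rw [Nat.factorial_succ] at h2
    push_cast at h2
    refine le_of_mul_le_mul_left ?_ hpos
    linarith
  rw [hw, norm_tensorCons, ← Submodule.coe_norm] at h3
  refine le_of_sq_le_sq ?_ (by positivity)
  rw [mul_pow, Real.sq_sqrt (by positivity)]
  exact h3


section multiplication

variable {X : Type} [TopologicalSpace X] [CompactSpace X] [MeasureSpace X]
  [OpensMeasurableSpace X]

theorem memLp_mul (h : C(X, ℂ)) (g : Lp ℂ 2 (volume : Measure X)) :
    MemLp (fun x => h x * g x) 2 volume :=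
  (Lp.memLp g).of_le_mul (c := ‖h‖)
    (h.continuous.measurable.aestronglyMeasurable.mul (Lp.aestronglyMeasurable g))
    (.of_forall fun x => by rw [norm_mul]; gcongr; exact h.norm_coe_le_norm x)

/-- Multiplication by a continuous function on `L₂`. -/
def mulOp (h : C(X, ℂ)) : Lp ℂ 2 (volume : Measure X) →L[ℂ] Lp ℂ 2 (volume : Measure X) :=
  LinearMap.mkContinuous
    { toFun := fun g => (memLp_mul h g).toLp
      map_add' := fun u v => by
        ext1
        filter_upwards [(memLp_mul h (u + v)).coeFn_toLp, (memLp_mul h u).coeFn_toLp,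
          (memLp_mul h v).coeFn_toLp, Lp.coeFn_add (memLp_mul h u).toLp
          (memLp_mul h v).toLp, Lp.coeFn_add u v]
          with p h1 h2 h3 h4 h5
        rw [h1, h4, Pi.add_apply, h2, h3, h5, Pi.add_apply, mul_add]
      map_smul' := fun c u => by
        ext1
        filter_upwards [(memLp_mul h (c • u)).coeFn_toLp, (memLp_mul h u).coeFn_toLp,
          Lp.coeFn_smul c (memLp_mul h u).toLp, Lp.coeFn_smul c u]
          with p h1 h2 h3 h4
        rw [h1, RingHom.id_apply, h3, Pi.smul_apply, h2, h4, Pi.smul_apply, smul_eq_mul,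
          smul_eq_mul, mul_left_comm] }
    ‖h‖ (fun g => by
      refine Lp.norm_le_mul_norm_of_ae_le_mul ?_
      filter_upwards [(memLp_mul h g).coeFn_toLp] with x hx
      simp only [LinearMap.coe_mk, AddHom.coe_mk, hx, norm_mul]
      gcongr
      exact h.norm_coe_le_norm x)

theorem coeFn_mulOp (h : C(X, ℂ)) (g : Lp ℂ 2 (volume : Measure X)) :
    mulOp h g =ᵐ[volume] fun x => h x * g x :=
  (memLp_mul h g).coeFn_toLp

theorem norm_mulOp_le (h : C(X, ℂ)) : ‖mulOp h‖ ≤ ‖h‖ :=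
  LinearMap.mkContinuous_norm_le _ (norm_nonneg _) _

end multiplication

theorem permOp_mulOp {n : ℕ} {h : C(Fin n → Zone ε, ℂ)} (σ : Equiv.Perm (Fin n))
    (hh : ∀ p, h (p ∘ σ) = h p) (g : TensorPower ε n) :
    permOp σ (mulOp h g) = mulOp h (permOp σ g) := by
  ext1
  filter_upwards [coeFn_permOp σ (mulOp h g), coeFn_permOp σ g, coeFn_mulOp h (permOp σ g),
    (measurePreserving_perm σ).quasiMeasurePreserving.ae (coeFn_mulOp h g)] with p h1 h2 h3 h4
  rw [h1, h3, h2, h4, hh]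

/-- Multiplication by a symmetric function, as an operator on the exterior power. -/
def extMul {n : ℕ} (h : C(Fin n → Zone ε, ℂ))
    (hh : ∀ (σ : Equiv.Perm (Fin n)) p, h (p ∘ σ) = h p) :
    ExteriorPower ε n →L[ℂ] ExteriorPower ε n :=
  ((mulOp h).comp (ExteriorPower ε n).subtypeL).codRestrict (ExteriorPower ε n) (by
    intro g
    refine mem_exteriorPower.2 fun σ => ?_
    rw [ContinuousLinearMap.comp_apply, permOp_mulOp σ (hh σ), Submodule.subtypeL_apply,
      mem_exteriorPower.1 g.2 σ, map_smul])

theorem norm_extMul_le {n : ℕ} (h : C(Fin n → Zone ε, ℂ))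
    (hh : ∀ (σ : Equiv.Perm (Fin n)) p, h (p ∘ σ) = h p) {C : ℝ} (hC : 0 ≤ C)
    (hb : ∀ p, ‖h p‖ ≤ C) : ‖extMul h hh‖ ≤ C := by
  refine ContinuousLinearMap.opNorm_le_bound _ hC fun g => ?_
  refine ((mulOp h).le_opNorm (g : TensorPower ε n)).trans ?_
  gcongr
  · exact (norm_mulOp_le h).trans ((ContinuousMap.norm_le h hC).2 hb)
  · exact le_rfl

/-- The function `h(p₁) + ⋯ + h(pₙ)`. -/
def sumFun (n : ℕ) (h : C(Zone ε, ℝ)) : C(Fin n → Zone ε, ℂ) :=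
  ⟨fun p => ((∑ i, h (p i) : ℝ) : ℂ), by fun_prop⟩

/-- The function `h(p₁) ⋯ h(pₙ)`. -/
def prodFun (n : ℕ) (h : C(Zone ε, Circle)) : C(Fin n → Zone ε, ℂ) :=
  ⟨fun p => ((∏ i, h (p i) : Circle) : ℂ), by fun_prop⟩

/-- The operator `u₁ ∧ ⋯ ∧ uₙ ↦ (h u₁) ∧ ⋯ ∧ uₙ + ⋯ + u₁ ∧ ⋯ ∧ (h uₙ)`;
see `extDeriv_wedge` below. -/
def extDeriv (n : ℕ) (h : C(Zone ε, ℝ)) : ExteriorPower ε n →L[ℂ] ExteriorPower ε n :=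
  extMul (sumFun n h) (fun σ p => by
    simp only [sumFun, ContinuousMap.coe_mk, Function.comp_apply]
    rw [Equiv.sum_comp σ fun i => h (p i)])

/-- The operator `u₁ ∧ ⋯ ∧ uₙ ↦ (h u₁) ∧ ⋯ ∧ (h uₙ)`; see `extMap_wedge` below. -/
def extMap (n : ℕ) (h : C(Zone ε, Circle)) : ExteriorPower ε n →L[ℂ] ExteriorPower ε n :=
  extMul (prodFun n h) (fun σ p => by
    simp only [prodFun, ContinuousMap.coe_mk, Function.comp_apply]
    rw [Equiv.prod_comp σ fun i => h (p i)])

theorem norm_extMap_le (n : ℕ) (h : C(Zone ε, Circle)) : ‖extMap n h‖ ≤ 1 :=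
  norm_extMul_le _ _ zero_le_one fun _ => (Circle.norm_coe _).le

theorem norm_extDeriv_le (n : ℕ) (h : C(Zone ε, ℝ)) : ‖extDeriv n h‖ ≤ n * ‖h‖ := by
  refine norm_extMul_le _ _ (by positivity) fun p => ?_
  simp only [sumFun, ContinuousMap.coe_mk, Complex.norm_real]
  refine (norm_sum_le _ _).trans ((Finset.sum_le_sum fun i _ => h.norm_coe_le_norm (p i)).trans ?_)
  simp

/-- The exterior product `f ∧ u = Alt (f ⊗ u)`. -/
def wedge {n : ℕ} (f : OneParticle ε) : ExteriorPower ε n →L[ℂ] ExteriorPower ε (n + 1) :=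
  (antisymmetrize (n + 1)).comp ((tensorCons f).comp (ExteriorPower ε n).subtypeL)

variable (ε) in
/-- The Hilbert sum of all the exterior powers of `L₂[-π/ε; π/ε]`. -/
abbrev Fock : Type := lp (fun n : ℕ => ExteriorPower ε n) 2

variable (ε) in
/-- The vector `1` of the zeroth exterior power. -/
def fockVacuum : Fock ε :=
  lp.single 2 0 ⟨ContinuousMap.toLp 2 volume ℂ 1, mem_exteriorPower.2 fun σ => by
    rw [Subsingleton.elim σ 1, permOp_one]; simp [signC]⟩

/-- The components of the vector obtained from `v` by creating a particle `f`:
`u ↦ √(n+1) f ∧ u` on the `n`-th exterior power. -/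
def createFun (f : OneParticle ε) (v : Fock ε) : ∀ n : ℕ, ExteriorPower ε n
  | 0 => 0
  | n + 1 => (Real.sqrt (n + 1) : ℂ) • wedge f (v n)

theorem norm_createFun_succ_le (f : OneParticle ε) (v : Fock ε) (n : ℕ) :
    ‖createFun f v (n + 1)‖ ≤ ‖f‖ * ‖v n‖ := by
  rw [createFun, norm_smul, Complex.norm_real, Real.norm_of_nonneg (Real.sqrt_nonneg _)]
  exact norm_wedge_le f (v n)

theorem summable_fock (v : Fock ε) : Summable fun n => ‖v n‖ ^ 2 := by
  simpa using (lp.memℓp v).summable (by norm_num)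

theorem shift_bound {a b : ℕ → ℝ} {C : ℝ} (ha0 : a 0 = 0) (ha : ∀ n, 0 ≤ a n)
    (hab : ∀ n, a (n + 1) ≤ C * b n) (hb : Summable fun n => b n ^ 2) :
    (Summable fun n => a n ^ 2) ∧ ∑' n, a n ^ 2 ≤ C ^ 2 * ∑' n, b n ^ 2 := by
  have hle : ∀ n, a (n + 1) ^ 2 ≤ C ^ 2 * b n ^ 2 := fun n => by
    rw [← mul_pow]
    exact pow_le_pow_left₀ (ha _) (hab n) 2
  have hs1 : Summable fun n => a (n + 1) ^ 2 :=
    Summable.of_nonneg_of_le (fun n => by positivity) hle (hb.mul_left (C ^ 2))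
  have hs : Summable fun n => a n ^ 2 := (summable_nat_add_iff 1).1 hs1
  refine ⟨hs, ?_⟩
  rw [← tsum_mul_left, hs.tsum_eq_zero_add, ha0, zero_pow two_ne_zero, zero_add]
  exact Summable.tsum_le_tsum hle hs1 (hb.mul_left (C ^ 2))

theorem createFun_bound (f : OneParticle ε) (v : Fock ε) :
    (Summable fun n => ‖createFun f v n‖ ^ 2) ∧
      ∑' n, ‖createFun f v n‖ ^ 2 ≤ ‖f‖ ^ 2 * ∑' n, ‖v n‖ ^ 2 :=
  shift_bound norm_zero (fun _ => norm_nonneg _) (norm_createFun_succ_le f v) (summable_fock v)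

theorem createFun_add (f : OneParticle ε) (v w : Fock ε) (n : ℕ) :
    createFun f (v + w) n = createFun f v n + createFun f w n := by
  cases n with
  | zero => simp only [createFun, add_zero]
  | succ n => simp only [createFun, lp.coeFn_add, Pi.add_apply, map_add, smul_add]

theorem createFun_smul (f : OneParticle ε) (c : ℂ) (v : Fock ε) (n : ℕ) :
    createFun f (c • v) n = c • createFun f v n := by
  cases n with
  | zero => simp only [createFun, smul_zero]
  | succ n => simp only [createFun, lp.coeFn_smul, Pi.smul_apply, map_smul]; exact smul_comm _ _ _

theorem tsum_createFun_le (f : OneParticle ε) (v : Fock ε) :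
    ∑' n, ‖createFun f v n‖ ^ 2 ≤ (‖f‖ * ‖v‖) ^ 2 := by
  have h2 : ‖v‖ ^ 2 = ∑' n, ‖v n‖ ^ 2 := by
    simpa using lp.norm_rpow_eq_tsum (p := 2) (by norm_num) v
  rw [mul_pow, h2]
  exact (createFun_bound f v).2

/-- The creation operator on the Fock space of one sort of particles. -/
def fockCreate (f : OneParticle ε) : Fock ε →L[ℂ] Fock ε :=
  LinearMap.mkContinuous
    { toFun := fun v => ⟨createFun f v, memℓp_gen (by simpa using (createFun_bound f v).1)⟩
      map_add' := fun v w => lp.ext (funext (createFun_add f v w))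
      map_smul' := fun c v => lp.ext (funext (createFun_smul f c v)) }
    ‖f‖ (fun v => lp.norm_le_of_tsum_le (by norm_num) (by positivity) (by
      simpa using tsum_createFun_le f v))

/-- The operator `u₁ ∧ ⋯ ∧ uₙ ↦ (h u₁) ∧ ⋯ ∧ (h uₙ)` on the Fock space. -/
def fockMap (h : C(Zone ε, Circle)) : Fock ε →L[ℂ] Fock ε :=
  lp.mapCLM 2 (fun n => extMap n h) zero_le_one (fun n => norm_extMap_le n h)

theorem norm_ite_le {E : Type*} [NormedAddCommGroup E] [NormedSpace ℂ E] (P : Prop) [Decidable P]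
    (T : E →L[ℂ] E) {C : ℝ} (hC : 0 ≤ C) (h : P → ‖T‖ ≤ C) : ‖if P then T else 0‖ ≤ C := by
  split_ifs with hP
  · exact h hP
  · simpa using hC

theorem norm_neg_one_pow_smul_id_le {E : Type*} [NormedAddCommGroup E] [NormedSpace ℂ E] (n : ℕ) :
    ‖(-1 : ℂ) ^ n • ContinuousLinearMap.id ℂ E‖ ≤ 1 := by
  rw [norm_smul]
  simpa using ContinuousLinearMap.norm_id_le

variable (ε) in
/-- The operator `(-1)ⁿ` on the `n`-th exterior power. -/
def fockParity : Fock ε →L[ℂ] Fock ε :=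
  lp.mapCLM 2 (fun n => (-1 : ℂ) ^ n • ContinuousLinearMap.id ℂ (ExteriorPower ε n)) zero_le_one
    (fun n => norm_neg_one_pow_smul_id_le n)

variable (ε) in
/-- The projection onto the sum of the exterior powers of degree at most `N`. -/
def fockCut (N : ℕ) : Fock ε →L[ℂ] Fock ε :=
  lp.mapCLM 2 (fun n => if n ≤ N then ContinuousLinearMap.id ℂ (ExteriorPower ε n) else 0)
    zero_le_one (fun _ => norm_ite_le _ _ zero_le_one fun _ => ContinuousLinearMap.norm_id_le)

/-- The operator `extDeriv` on the exterior powers of degree at most `N`, and zero on the others. -/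
def fockDeriv (N : ℕ) (h : C(Zone ε, ℝ)) : Fock ε →L[ℂ] Fock ε :=
  lp.mapCLM 2 (fun n => if n ≤ N then extDeriv n h else 0)
    (K := N * ‖h‖) (by positivity) (fun n => norm_ite_le _ _ (by positivity) fun hn =>
      (norm_extDeriv_le n h).trans (by gcongr))

variable (ε) in
/-- The Hilbert space of Feynman anticheckers: the tensor square of the Fock space. The first factor
describes electrons, the second one describes positrons. -/
abbrev StateSpace : Type := HilbertTensor (Fock ε) (Fock ε)

variable (ε) in
/-- The vacuum vector. -/
def vacuum : StateSpace ε := HilbertTensor.tmul (fockVacuum ε) (fockVacuum ε)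

theorem fockCut_apply (N : ℕ) (v : Fock ε) (n : ℕ) :
    fockCut ε N v n = if n ≤ N then v n else 0 := by
  change (if n ≤ N then ContinuousLinearMap.id ℂ (ExteriorPower ε n) else 0) (v n) = _
  split_ifs <;> rfl

theorem fockDeriv_apply (N : ℕ) (h : C(Zone ε, ℝ)) (v : Fock ε) (n : ℕ) :
    fockDeriv N h v n = if n ≤ N then extDeriv n h (v n) else 0 := by
  change (if n ≤ N then extDeriv n h else 0) (v n) = _
  split_ifs <;> rfl

theorem fockCut_comp {N M : ℕ} (hNM : N ≤ M) : (fockCut ε M).comp (fockCut ε N) = fockCut ε N := by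
  ext1 v
  refine lp.ext (funext fun n => ?_)
  rw [ContinuousLinearMap.comp_apply, fockCut_apply, fockCut_apply]
  split_ifs with h1 h2
  · rfl
  · rfl
  · omega
  · rfl

theorem fockCut_comp_fockDeriv {N M : ℕ} (hNM : N ≤ M) (h : C(Zone ε, ℝ)) :
    (fockCut ε M).comp (fockDeriv N h) = fockDeriv N h := by
  ext1 v
  refine lp.ext (funext fun n => ?_)
  rw [ContinuousLinearMap.comp_apply, fockCut_apply, fockDeriv_apply]
  split_ifs with h1 h2
  · rfl
  · rfl
  · omega
  · rfl

theorem fockDeriv_comp_fockCut {N M : ℕ} (hNM : N ≤ M) (h : C(Zone ε, ℝ)) :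
    (fockDeriv M h).comp (fockCut ε N) = fockDeriv N h := by
  ext1 v
  refine lp.ext (funext fun n => ?_)
  rw [ContinuousLinearMap.comp_apply, fockDeriv_apply, fockDeriv_apply, fockCut_apply]
  split_ifs with h1 h2
  · rfl
  · exact map_zero _
  · omega
  · rfl

variable (ε) in
/-- The projection onto the states with at most `N` electrons and at most `N` positrons. -/
def particleCut (N : ℕ) : StateSpace ε →L[ℂ] StateSpace ε := HilbertTensor.map (fockCut ε N) (fockCut ε N)

theorem cut_mono {N M : ℕ} (hNM : N ≤ M) {Ψ : StateSpace ε} (h : particleCut ε N Ψ = Ψ) :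
    particleCut ε M Ψ = Ψ := by
  rw [← h, particleCut, particleCut, HilbertTensor.map_map, fockCut_comp hNM]

variable (ε) in
/-- The incomplete linear span of the tensor products of the `n`-th and the `l`-th exterior powers
over all `n` and `l`: the states with a bounded number of particles. -/
def FiniteParticle : Submodule ℂ (StateSpace ε) where
  carrier := {Ψ | ∃ N, particleCut ε N Ψ = Ψ}
  add_mem' := by
    rintro Ψ Φ ⟨N, hN⟩ ⟨M, hM⟩
    exact ⟨max N M, by rw [map_add, cut_mono (le_max_left N M) hN, cut_mono (le_max_right N M) hM]⟩
  zero_mem' := ⟨0, map_zero _⟩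
  smul_mem' := by
    rintro c Ψ ⟨N, hN⟩
    exact ⟨N, by rw [map_smul, hN]⟩

/-- The operator `∑ h(pᵢ) + ∑ h(qⱼ)` on the states with at most `N` electrons and positrons. -/
def secondQuantSumAux (h : C(Zone ε, ℝ)) (N : ℕ) : StateSpace ε →L[ℂ] StateSpace ε :=
  HilbertTensor.map (fockDeriv N h) (fockCut ε N) + HilbertTensor.map (fockCut ε N) (fockDeriv N h)

theorem secondQuantSumAux_congr (h : C(Zone ε, ℝ)) {N M : ℕ} {Ψ : StateSpace ε} (hN : particleCut ε N Ψ = Ψ)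
    (hNM : N ≤ M) : secondQuantSumAux h M Ψ = secondQuantSumAux h N Ψ := by
  have key : ∀ K, N ≤ K → secondQuantSumAux h K Ψ
      = HilbertTensor.map (fockDeriv N h) (fockCut ε N) Ψ + HilbertTensor.map (fockCut ε N) (fockDeriv N h) Ψ := by
    intro K hK
    conv_lhs => rw [← hN]
    rw [secondQuantSumAux, add_apply, particleCut, HilbertTensor.map_map, HilbertTensor.map_map,
      fockDeriv_comp_fockCut hK, fockCut_comp hK]
  rw [key M hNM, key N le_rfl]

theorem secondQuantSumAux_mem (h : C(Zone ε, ℝ)) (N : ℕ) (Ψ : StateSpace ε) :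
    secondQuantSumAux h N Ψ ∈ FiniteParticle ε := by
  refine ⟨N, ?_⟩
  rw [secondQuantSumAux, add_apply, map_add, particleCut, HilbertTensor.map_map, HilbertTensor.map_map,
    fockCut_comp_fockDeriv le_rfl, fockCut_comp le_rfl]

theorem exists_cut (Ψ : FiniteParticle ε) : ∃ N, particleCut ε N (Ψ : StateSpace ε) = Ψ := Ψ.2

/-- The linear operator on finite-particle states taking `u₁ ∧ ⋯ ∧ uₙ ⊗ v₁ ∧ ⋯ ∧ vₗ` to the sum of
the products with one of the factors `uᵢ` or `vⱼ` multiplied by `h`; see `secondQuantSum_apply`. -/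
def secondQuantSum (h : C(Zone ε, ℝ)) : FiniteParticle ε →ₗ[ℂ] FiniteParticle ε where
  toFun Ψ := ⟨secondQuantSumAux h (exists_cut Ψ).choose Ψ, secondQuantSumAux_mem h _ _⟩
  map_add' Ψ Φ := by
    ext1
    have h1 := secondQuantSumAux_congr h (exists_cut (Ψ + Φ)).choose_spec (le_max_left _
      (max (exists_cut Ψ).choose (exists_cut Φ).choose))
    have h2 := secondQuantSumAux_congr h (exists_cut Ψ).choose_spec
      ((le_max_left _ (exists_cut Φ).choose).trans (le_max_right (exists_cut (Ψ + Φ)).choose _))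
    have h3 := secondQuantSumAux_congr h (exists_cut Φ).choose_spec
      ((le_max_right (exists_cut Ψ).choose _).trans (le_max_right (exists_cut (Ψ + Φ)).choose _))
    exact h1.symm.trans ((map_add _ _ _).trans (congr_arg₂ _ h2 h3))
  map_smul' c Ψ := by
    ext1
    have h1 := secondQuantSumAux_congr h (exists_cut (c • Ψ)).choose_spec
      (le_max_left _ (exists_cut Ψ).choose)
    have h2 := secondQuantSumAux_congr h (exists_cut Ψ).choose_spec
      (le_max_right (exists_cut (c • Ψ)).choose _)
    exact h1.symm.trans ((map_smul _ _ _).trans (congr_arg _ h2))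

theorem secondQuantSum_apply (h : C(Zone ε, ℝ)) (N : ℕ) (Ψ : FiniteParticle ε)
    (hN : particleCut ε N (Ψ : StateSpace ε) = Ψ) :
    (secondQuantSum h Ψ : StateSpace ε) = secondQuantSumAux h N Ψ := by
  change secondQuantSumAux h (exists_cut Ψ).choose Ψ = _
  rw [← secondQuantSumAux_congr h hN (le_max_left N (exists_cut Ψ).choose),
    secondQuantSumAux_congr h (exists_cut Ψ).choose_spec (le_max_right N (exists_cut Ψ).choose)]

/-- The operator taking `u₁ ∧ ⋯ ∧ uₙ ⊗ v₁ ∧ ⋯ ∧ vₗ` to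
`(h u₁) ∧ ⋯ ∧ (h uₙ) ⊗ (h v₁) ∧ ⋯ ∧ (h vₗ)`. -/
def secondQuantProd (h : C(Zone ε, Circle)) : StateSpace ε →L[ℂ] StateSpace ε :=
  HilbertTensor.map (fockMap h) (fockMap h)

/-- The creation operator of electrons: `u ⊗ v ↦ √(n+1) (f ∧ u) ⊗ v`. -/
def createA (f : OneParticle ε) : StateSpace ε →L[ℂ] StateSpace ε :=
  HilbertTensor.map (fockCreate f) (ContinuousLinearMap.id ℂ (Fock ε))

/-- The creation operator of positrons: `u ⊗ v ↦ (-1)ⁿ √(l+1) u ⊗ (f* ∧ v)`. -/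
def createB (f : OneParticle ε) : StateSpace ε →L[ℂ] StateSpace ε :=
  HilbertTensor.map (fockParity ε) (fockCreate (star f))

/-- The lattice dispersion relation `ω_p`. -/
def dispersion (ε m p : ℝ) : ℝ :=
  (1 / ε) * Real.arccos (Real.cos (p * ε) / Real.sqrt (1 + m ^ 2 * ε ^ 2))

/-- The angle `α_p ∈ [0; π]` such that `cot α_p = sin(pε)/(mε)`. -/
def mixingAngle (ε m p : ℝ) : ℝ := Real.pi / 2 - Real.arctan (Real.sin (p * ε) / (m * ε))

theorem mixingAngle_mem (ε m p : ℝ) : mixingAngle ε m p ∈ Set.Ioo 0 Real.pi := by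
  have h1 := Real.arctan_lt_pi_div_two (Real.sin (p * ε) / (m * ε))
  have h2 := Real.neg_pi_div_two_lt_arctan (Real.sin (p * ε) / (m * ε))
  constructor <;> unfold mixingAngle <;> linarith

theorem cot_mixingAngle (ε m p : ℝ) :
    Real.cot (mixingAngle ε m p) = Real.sin (p * ε) / (m * ε) := by
  rw [Real.cot_eq_cos_div_sin, mixingAngle, Real.cos_pi_div_two_sub, Real.sin_pi_div_two_sub,
    ← Real.tan_eq_sin_div_cos, Real.tan_arctan]

theorem continuous_dispersion (ε m : ℝ) : Continuous (dispersion ε m) := by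
  unfold dispersion
  exact continuous_const.mul (Real.continuous_arccos.comp (by fun_prop))

theorem continuous_mixingAngle (ε m : ℝ) : Continuous (mixingAngle ε m) := by
  unfold mixingAngle
  exact continuous_const.sub (Real.continuous_arctan.comp (by fun_prop))

variable (ε) in
/-- `ω_p` as a function of the momentum `p`. -/
def energy (m : ℝ) : C(Zone ε, ℝ) :=
  ⟨fun p => dispersion ε m p, (continuous_dispersion ε m).comp continuous_subtype_val⟩

variable (ε) in
/-- The momentum `p` as a function of itself. -/
def coordinate : C(Zone ε, ℝ) := ⟨fun p => p, continuous_subtype_val⟩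

/-- The function `e^{-i s h(p)}`. -/
def phase (h : C(Zone ε, ℝ)) (s : ℝ) : C(Zone ε, Circle) :=
  ⟨fun p => Circle.exp (-(s * h p)), by fun_prop⟩

variable (ε) in
/-- The Hamiltonian `H`. -/
def hamiltonian (m : ℝ) : FiniteParticle ε →ₗ[ℂ] FiniteParticle ε := secondQuantSum (energy ε m)

variable (ε) in
/-- The momentum operator `P`. -/
def momentum : FiniteParticle ε →ₗ[ℂ] FiniteParticle ε := secondQuantSum (coordinate ε)

variable (ε) in
/-- The evolution operator `e^{-iHt}`. -/
def expH (m t : ℝ) : StateSpace ε →L[ℂ] StateSpace ε := secondQuantProd (phase (energy ε m) t)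

variable (ε) in
/-- The translation operator `e^{-iPx}`. -/
def expP (x : ℝ) : StateSpace ε →L[ℂ] StateSpace ε := secondQuantProd (phase (coordinate ε) x)

variable (ε) in
/-- The two amplitudes `i cos(α_p/2)` and `sin(α_p/2)`. -/
def spinor (m p : ℝ) : Fin 2 → ℂ :=
  ![Complex.I * Real.cos (mixingAngle ε m p / 2), Real.sin (mixingAngle ε m p / 2)]

variable (ε) in
/-- The functions `√(ε/π) i cos(α_p/2) e^{iω_p t - ipx}` and `√(ε/π) sin(α_p/2) e^{iω_p t - ipx}`. -/
def modeFun (m : ℝ) (k : Fin 2) (x t : ℝ) : C(Zone ε, ℂ) where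
  toFun p := Real.sqrt (ε / Real.pi) * spinor ε m p k
    * Complex.exp (Complex.I * (dispersion ε m p * t - p * x))
  continuous_toFun := by
    have h1 := continuous_dispersion ε m
    have h2 := continuous_mixingAngle ε m
    fin_cases k <;> simp only [spinor] <;> simp <;> fun_prop

variable (ε) in
/-- These functions as elements of `L₂[-π/ε; π/ε]`. -/
def fieldMode (m : ℝ) (k : Fin 2) (x t : ℝ) : OneParticle ε :=
  ContinuousMap.toLp 2 volume ℂ (modeFun ε m k x t)

variable (ε) in
/-- The components `ψ_k(x,t) = a(f_{k,x,t}) + b(f_{k,x,t}^*)†` of the field operator, where `a(f)` is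
the adjoint of `a(f)†`. The index `k` runs through `0, 1` instead of `1, 2`. -/
def fieldOp (m : ℝ) (k : Fin 2) (x t : ℝ) : StateSpace ε →L[ℂ] StateSpace ε :=
  ContinuousLinearMap.adjoint (createA (fieldMode ε m k x t)) + createB (star (fieldMode ε m k x t))


theorem antisymmetrize_mulOp {n : ℕ} (h : C(Fin n → Zone ε, ℂ))
    (hh : ∀ (σ : Equiv.Perm (Fin n)) p, h (p ∘ σ) = h p) (w : TensorPower ε n) :
    antisymmetrize n (mulOp h w) = extMul h hh (antisymmetrize n w) := by
  refine Subtype.ext ?_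
  change _ = mulOp h (antisymmetrize n w : TensorPower ε n)
  rw [coe_antisymmetrize, coe_antisymmetrize, map_smul, map_sum]
  simp only [map_smul, permOp_mulOp _ (hh _)]

def ofRealFun (h : C(Zone ε, ℝ)) : C(Zone ε, ℂ) := ⟨fun p => (h p : ℂ), by fun_prop⟩

def ofCircleFun (h : C(Zone ε, Circle)) : C(Zone ε, ℂ) := ⟨fun p => (h p : ℂ), by fun_prop⟩

theorem quasiMeasurePreserving_zero (n : ℕ) :
    Measure.QuasiMeasurePreserving (fun p : Fin (n + 1) → Zone ε => p 0) volume volume :=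
  Measure.quasiMeasurePreserving_fst.comp
    (volume_preserving_piFinSuccAbove (fun _ : Fin (n + 1) => Zone ε) 0).quasiMeasurePreserving

theorem extDeriv_wedge {n : ℕ} (h : C(Zone ε, ℝ)) (f : OneParticle ε) (u : ExteriorPower ε n) :
    extDeriv (n + 1) h (wedge f u)
      = wedge (mulOp (ofRealFun h) f) u + wedge f (extDeriv n h u) := by
  change extMul _ _ (antisymmetrize (n + 1) (tensorCons f (u : TensorPower ε n))) =
    antisymmetrize (n + 1) (tensorCons (mulOp (ofRealFun h) f) (u : TensorPower ε n)) +
    antisymmetrize (n + 1) (tensorCons f (mulOp (sumFun n h) (u : TensorPower ε n)))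
  rw [← antisymmetrize_mulOp, ← map_add]
  congr 1
  ext1
  filter_upwards [coeFn_mulOp (sumFun (n + 1) h) (tensorCons f (u : TensorPower ε n)),
    coeFn_tensorCons f (u : TensorPower ε n),
    coeFn_tensorCons (mulOp (ofRealFun h) f) (u : TensorPower ε n),
    coeFn_tensorCons f (mulOp (sumFun n h) (u : TensorPower ε n)),
    Lp.coeFn_add (tensorCons (mulOp (ofRealFun h) f) (u : TensorPower ε n))
      (tensorCons f (mulOp (sumFun n h) (u : TensorPower ε n))),
    (quasiMeasurePreserving_zero n).ae (coeFn_mulOp (ofRealFun h) f),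
    (quasiMeasurePreserving_tail n).ae (coeFn_mulOp (sumFun n h) (u : TensorPower ε n))]
    with p h1 h2 h3 h4 h5 h6 h7
  rw [h1, h5, Pi.add_apply, h2, h3, h4, h6, h7]
  simp only [sumFun, ofRealFun, ContinuousMap.coe_mk, Fin.sum_univ_succ, Fin.tail]
  push_cast
  ring

theorem extMap_wedge {n : ℕ} (h : C(Zone ε, Circle)) (f : OneParticle ε) (u : ExteriorPower ε n) :
    extMap (n + 1) h (wedge f u) = wedge (mulOp (ofCircleFun h) f) (extMap n h u) := by
  change extMul _ _ (antisymmetrize (n + 1) (tensorCons f (u : TensorPower ε n))) =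
    antisymmetrize (n + 1) (tensorCons (mulOp (ofCircleFun h) f)
      (mulOp (prodFun n h) (u : TensorPower ε n)))
  rw [← antisymmetrize_mulOp]
  congr 1
  ext1
  filter_upwards [coeFn_mulOp (prodFun (n + 1) h) (tensorCons f (u : TensorPower ε n)),
    coeFn_tensorCons f (u : TensorPower ε n),
    coeFn_tensorCons (mulOp (ofCircleFun h) f) (mulOp (prodFun n h) (u : TensorPower ε n)),
    (quasiMeasurePreserving_zero n).ae (coeFn_mulOp (ofCircleFun h) f),
    (quasiMeasurePreserving_tail n).ae (coeFn_mulOp (prodFun n h) (u : TensorPower ε n))]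
    with p h1 h2 h3 h4 h5
  rw [h1, h2, h3, h4, h5]
  simp only [prodFun, ofCircleFun, ContinuousMap.coe_mk, Fin.prod_univ_succ, Fin.tail,
    Circle.coe_mul]
  ring

theorem fockCreate_single (f : OneParticle ε) (n : ℕ) (u : ExteriorPower ε n) :
    fockCreate f (lp.single 2 n u) = lp.single 2 (n + 1) ((Real.sqrt (n + 1) : ℂ) • wedge f u) := by
  refine lp.ext (funext fun j => ?_)
  change createFun f (lp.single 2 n u) j = _
  cases j with
  | zero => simp [createFun, lp.single_apply]
  | succ j =>
    by_cases hj : j = n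
    · subst hj
      simp [createFun]
    · rw [createFun, lp.single_apply_ne _ _ _ hj, map_zero, smul_zero,
        lp.single_apply_ne _ _ _ (by omega)]

theorem secondQuantSum_tmul (h : C(Zone ε, ℝ)) (N : ℕ) (u v : Fock ε)
    (hu : fockCut ε N u = u) (hv : fockCut ε N v = v) (hm : HilbertTensor.tmul u v ∈ FiniteParticle ε) :
    (secondQuantSum h ⟨HilbertTensor.tmul u v, hm⟩ : StateSpace ε)
      = HilbertTensor.tmul (fockDeriv N h u) v + HilbertTensor.tmul u (fockDeriv N h v) := by
  rw [secondQuantSum_apply h N _ (by rw [particleCut, HilbertTensor.map_tmul, hu, hv]), secondQuantSumAux,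
    add_apply, HilbertTensor.map_tmul, HilbertTensor.map_tmul, hu, hv]

theorem createA_tmul (f : OneParticle ε) {n l : ℕ} (u : ExteriorPower ε n)
    (v : ExteriorPower ε l) :
    createA f (HilbertTensor.tmul (lp.single 2 n u : Fock ε) (lp.single 2 l v : Fock ε))
      = HilbertTensor.tmul (lp.single 2 (n + 1) ((Real.sqrt (n + 1) : ℂ) • wedge f u) : Fock ε)
          (lp.single 2 l v : Fock ε) := by
  rw [createA, HilbertTensor.map_tmul, fockCreate_single, ContinuousLinearMap.id_apply]

theorem fockParity_single (n : ℕ) (u : ExteriorPower ε n) :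
    fockParity ε (lp.single 2 n u) = lp.single 2 n ((-1 : ℂ) ^ n • u) := by
  refine lp.ext (funext fun j => ?_)
  change (-1 : ℂ) ^ j • (lp.single 2 n u : Fock ε) j = _
  by_cases hj : j = n
  · subst hj
    rw [lp.single_apply_self, lp.single_apply_self]
  · rw [lp.single_apply_ne _ _ _ hj, lp.single_apply_ne _ _ _ hj, smul_zero]

theorem createB_tmul (f : OneParticle ε) {n l : ℕ} (u : ExteriorPower ε n)
    (v : ExteriorPower ε l) :
    createB f (HilbertTensor.tmul (lp.single 2 n u : Fock ε) (lp.single 2 l v : Fock ε))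
      = HilbertTensor.tmul (lp.single 2 n ((-1 : ℂ) ^ n • u) : Fock ε)
          (lp.single 2 (l + 1) ((Real.sqrt (l + 1) : ℂ) • wedge (star f) v) : Fock ε) := by
  rw [createB, HilbertTensor.map_tmul, fockCreate_single, fockParity_single]

end FeynmanAnticheckers
end

open FeynmanAnticheckers

noncomputable section
namespace FeynmanAnticheckers

/-! ### Hilbert tensor products and elementary tensors -/

section TensorProducts
open ContinuousLinearMap (adjoint)

/-! Every axiom is reduced to the one-particle space: second quantization turns facts about
multiplication operators and about inner products of the modes f_{k,x,t} into facts about the state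
space. Boundedness is built into the construction of the fields, and translation covariance is the
intertwining relation `secondQuantProd_mul_field`.

The main tool is the canonical anticommutation relations. On one Fock space they follow by expanding
g ∧ v over the transpositions (0 j) (`adjoint_wedge_wedge_succ`, `adjoint_fockCreate_mul_add`); the
sign (-1)ⁿ in b† makes electron operators anticommute with positron operators. Since b(f*)† creates
a positron in the state f itself, the field of f is a(f) plus this creation operator. Two fields
therefore always anticommute, and a field and an adjoint field have the scalar anticommutator ⟨f|g⟩
+ ⟨g|f⟩ (`field_mul_adjoint_field`).

Locality: for modes this scalar is a multiple of a real integral I(N, M) depending only on the time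
and space separations Nε, Mε. The dispersion relation cos ωε = cos pε / √(1+m²ε²) is a discrete wave
equation for I, which propagates by at most one site per time step; the identities for α_p make the
rows N = 0 and N = 1 vanish outside the light cone (`overlap_eq_zero`).

Cyclicity of the vacuum: at t = 0 the first components are the exponentials e^{-inεp} times the
nowhere vanishing cos(α_p/2), hence total in L₂. Adjoint fields then create all electron states, and
fields create positrons up to an electron annihilation term, which is removed by induction on the
number of positrons (`dense_span_field`).

Uniqueness of the vacuum: let U = e^{iPε}, u = e^{iεp} and UΨ = Ψ. For a creation operator c†,
⟨Ψ|c†(f)Φ⟩ = ⟨c(uᵏf)Ψ|UᵏΦ⟩ for every k. By the Riemann–Lebesgue lemma uᵏf tends to zero weakly, so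
c(uᵏf) tends to zero strongly, and Ψ is orthogonal to all states with at least one particle
(`eq_smul_vacuum_of_fixed`).

Spectral condition: with c = 1 - ω₀ε/π one has H² - c²P² = (H - cP)(H + cP), where the factors are
the second quantizations of ω_p ∓ cp. Their product expands into tensor products of positive
operators as soon as c|p| ≤ ω_p (`mul_abs_le_dispersion`), which comes from the inequality cos a cos
x ≤ cos((1 - a/π)x). -/

theorem eq_zero_of_orthogonal_total {E : Type*} [NormedAddCommGroup E] [InnerProductSpace ℂ E]
    {s : Set E} (hs : Dense (Submodule.span ℂ s : Set E)) {x : E}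
    (h : ∀ y ∈ s, inner ℂ x y = 0) : x = 0 := by
  refine hs.eq_zero_of_inner_left (𝕜 := ℂ) fun v hv => ?_
  induction hv using Submodule.span_induction with
  | mem y hy => exact h y hy
  | zero => exact inner_zero_right _
  | add y z _ _ hy hz => rw [inner_add_right, hy, hz, add_zero]
  | smul c y _ hy => rw [inner_smul_right, hy, mul_zero]

theorem clm_eq_of_total {E F : Type*} [NormedAddCommGroup E] [NormedSpace ℂ E]
    [NormedAddCommGroup F] [NormedSpace ℂ F] {s : Set E}
    (hs : Dense (Submodule.span ℂ s : Set E)) {S T : E →L[ℂ] F} (h : ∀ y ∈ s, S y = T y) :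
    S = T :=
  ContinuousLinearMap.ext_on hs h

namespace HilbertTensor

variable {E F E' F' : Type} [NormedAddCommGroup E] [InnerProductSpace ℂ E]
  [NormedAddCommGroup F] [InnerProductSpace ℂ F] [NormedAddCommGroup E'] [InnerProductSpace ℂ E']
  [NormedAddCommGroup F'] [InnerProductSpace ℂ F']

theorem inner_tmul_tmul (u u' : E) (v v' : F) :
    inner ℂ (tmul u v) (tmul u' v') = inner ℂ u u' * inner ℂ v v' := by
  rw [tmul, tmul, LinearIsometry.inner_map_map, TensorProduct.inner_tmul]

theorem norm_tmul (u : E) (v : F) : ‖tmul u v‖ = ‖u‖ * ‖v‖ := by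
  rw [tmul, LinearIsometry.norm_map, TensorProduct.norm_tmul]

variable (E F) in
/-- The elementary tensor `u ⊗ v` as a linear function of `v`, and of `u`. -/
def tmulₗ : E →ₗ[ℂ] F →ₗ[ℂ] HilbertTensor E F :=
  (TensorProduct.mk ℂ E F).compr₂ (incl E F).toLinearMap

theorem add_tmul (u u' : E) (v : F) : tmul (u + u') v = tmul u v + tmul u' v :=
  LinearMap.map_add₂ (tmulₗ E F) u u' v

theorem smul_tmul (c : ℂ) (u : E) (v : F) : tmul (c • u) v = c • tmul u v :=
  LinearMap.map_smul₂ (tmulₗ E F) c u v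

theorem tmul_smul (c : ℂ) (u : E) (v : F) : tmul u (c • v) = c • tmul u v :=
  map_smul (tmulₗ E F u) c v

theorem zero_tmul (v : F) : tmul (0 : E) v = 0 := LinearMap.map_zero₂ (tmulₗ E F) v

theorem tmul_zero (u : E) : tmul u (0 : F) = 0 := map_zero (tmulₗ E F u)

theorem continuous_tmul_left (v : F) : Continuous fun u : E => tmul u v :=
  (incl E F).continuous.comp (by fun_prop)

theorem continuous_tmul_right (u : E) : Continuous fun v : F => tmul u v :=
  (incl E F).continuous.comp (by fun_prop)

/-- One factor is approximated at a time, first v for fixed u ∈ s, then u for arbitrary v, so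
separate continuity of the tensor product is enough. -/
theorem tmul_mem_closure_span {s : Set E} {t : Set F}
    (hs : Dense (Submodule.span ℂ s : Set E)) (ht : Dense (Submodule.span ℂ t : Set F))
    (u : E) (v : F) :
    tmul u v ∈ (Submodule.span ℂ (Set.image2 tmul s t)).topologicalClosure := by
  set V := (Submodule.span ℂ (Set.image2 (tmul (E := E) (F := F)) s t)).topologicalClosure
  have hV : IsClosed (V : Set (HilbertTensor E F)) := Submodule.isClosed_topologicalClosure _
  have h1 : ∀ u ∈ s, ∀ v : F, tmul u v ∈ V := by
    intro u hu v
    have hc : IsClosed ((fun v => tmul u v) ⁻¹' (V : Set (HilbertTensor E F))) :=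
      hV.preimage (continuous_tmul_right u)
    have hle : Submodule.span ℂ t ≤ V.comap (tmulₗ E F u) :=
      Submodule.span_le.2 fun v hv =>
        Submodule.le_topologicalClosure _ (Submodule.subset_span ⟨u, hu, v, hv, rfl⟩)
    exact (hc.closure_subset_iff.2 hle) (ht v)
  have hc : IsClosed ((fun u => tmul u v) ⁻¹' (V : Set (HilbertTensor E F))) :=
    hV.preimage (continuous_tmul_left v)
  have hle : Submodule.span ℂ s ≤ V.comap ((tmulₗ E F).flip v) :=
    Submodule.span_le.2 fun u hu => h1 u hu v
  exact (hc.closure_subset_iff.2 hle) (hs u)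

theorem dense_span_image2 {s : Set E} {t : Set F}
    (hs : Dense (Submodule.span ℂ s : Set E)) (ht : Dense (Submodule.span ℂ t : Set F)) :
    Dense (Submodule.span ℂ (Set.image2 (tmul (E := E) (F := F)) s t) :
      Set (HilbertTensor E F)) := by
  rw [Submodule.dense_iff_topologicalClosure_eq_top, eq_top_iff]
  set V := (Submodule.span ℂ (Set.image2 (tmul (E := E) (F := F)) s t)).topologicalClosure with hVd
  have hV : IsClosed (V : Set (HilbertTensor E F)) := Submodule.isClosed_topologicalClosure _
  have hr : Set.range (incl E F) ⊆ V := by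
    rintro _ ⟨x, rfl⟩
    induction x with
    | zero => rw [map_zero]; exact V.zero_mem
    | tmul u v => exact tmul_mem_closure_span hs ht u v
    | add x y hx hy => rw [map_add]; exact V.add_mem hx hy
  exact fun x _ => (hV.closure_subset_iff.2 hr) (denseRange_incl x)

theorem dense_span_range_tmul :
    Dense (Submodule.span ℂ (Set.image2 (tmul (E := E) (F := F)) Set.univ Set.univ) :
      Set (HilbertTensor E F)) :=
  dense_span_image2 (by simp) (by simp)

theorem clm_ext {G : Type*} [NormedAddCommGroup G] [NormedSpace ℂ G]
    {S T : HilbertTensor E F →L[ℂ] G} (h : ∀ u v, S (tmul u v) = T (tmul u v)) : S = T :=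
  clm_eq_of_total dense_span_range_tmul (by rintro _ ⟨u, _, v, _, rfl⟩; exact h u v)

theorem adjoint_map [CompleteSpace E] [CompleteSpace F] [CompleteSpace E'] [CompleteSpace F']
    (S : E →L[ℂ] E') (T : F →L[ℂ] F') :
    adjoint (map S T) = map (adjoint S) (adjoint T) := by
  refine clm_ext fun u v => ?_
  rw [← sub_eq_zero]
  refine eq_zero_of_orthogonal_total dense_span_range_tmul ?_
  rintro _ ⟨u', _, v', _, rfl⟩
  rw [inner_sub_left, ContinuousLinearMap.adjoint_inner_left, map_tmul, map_tmul,
    inner_tmul_tmul, inner_tmul_tmul, ContinuousLinearMap.adjoint_inner_left,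
    ContinuousLinearMap.adjoint_inner_left, sub_self]

/-- Positive operators factor as R*R and Q*Q, so the tensor product is (R ⊗ Q)*(R ⊗ Q). -/
theorem map_isPositive [CompleteSpace E] [CompleteSpace F] {S : E →L[ℂ] E} {T : F →L[ℂ] F}
    (hS : S.IsPositive) (hT : T.IsPositive) : (map S T).IsPositive := by
  obtain ⟨R, hR⟩ := CStarAlgebra.nonneg_iff_eq_star_mul_self.1
    ((ContinuousLinearMap.nonneg_iff_isPositive S).2 hS)
  obtain ⟨Q, hQ⟩ := CStarAlgebra.nonneg_iff_eq_star_mul_self.1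
    ((ContinuousLinearMap.nonneg_iff_isPositive T).2 hT)
  have : map S T = (adjoint (map R Q)).comp (map R Q) := by
    refine clm_ext fun u v => ?_
    rw [adjoint_map, ContinuousLinearMap.comp_apply, map_tmul, map_tmul, map_tmul, hR, hQ]
    rfl
  rw [this]
  exact ContinuousLinearMap.isPositive_adjoint_comp_self _

end HilbertTensor

variable {ε : ℝ}

theorem inner_tensorCons {n : ℕ} (f g : OneParticle ε) (u v : TensorPower ε n) :
    inner ℂ (tensorCons f u) (tensorCons g v) = inner ℂ f g * inner ℂ u v := by
  have hmp := volume_preserving_piFinSuccAbove (fun _ : Fin (n + 1) => Zone ε) 0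
  rw [L2.inner_def, L2.inner_def, L2.inner_def, ← integral_prod_mul]
  rw [integral_congr_ae (g := fun p : Fin (n + 1) → Zone ε =>
    inner ℂ (f (p 0)) (g (p 0)) * inner ℂ (u (Fin.tail p)) (v (Fin.tail p)))]
  · exact hmp.integral_comp' (fun z : Zone ε × (Fin n → Zone ε) =>
      inner ℂ (f z.1) (g z.1) * inner ℂ (u z.2) (v z.2))
  · filter_upwards [coeFn_tensorCons f u, coeFn_tensorCons g v] with p h1 h2
    rw [h1, h2]
    simp only [RCLike.inner_apply, map_mul]
    ring

/-- Rectangles form a π-system generating the product σ-algebra. Complements are covered because the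
whole space is itself a rectangle. -/
theorem ae_eq_zero_of_forall_rectangle {X Y : Type*} [MeasurableSpace X] [MeasurableSpace Y]
    {μ : Measure (X × Y)} {g : X × Y → ℂ} (hg : Integrable g μ)
    (h : ∀ (A : Set X) (B : Set Y), MeasurableSet A → MeasurableSet B →
      ∫ z in A ×ˢ B, g z ∂μ = 0) : g =ᵐ[μ] 0 := by
  refine hg.ae_eq_zero_of_forall_setIntegral_eq_zero fun s hs hlt => ?_
  -- Integrability of g makes the finiteness of the measure of s superfluous, and without that
  -- condition the π-λ induction passes to complements and unions.
  clear hlt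
  induction s, hs using MeasurableSpace.induction_on_inter generateFrom_prod.symm
    isPiSystem_prod with
  | empty => simp
  | basic t ht =>
    obtain ⟨A, hA, B, hB, rfl⟩ := ht
    exact h A B hA hB
  | compl t ht ih =>
    have h1 := integral_add_compl ht hg
    have h2 := h Set.univ Set.univ .univ .univ
    rw [Set.univ_prod_univ, setIntegral_univ] at h2
    rwa [ih, zero_add, h2] at h1
  | iUnion t hd ht ih =>
    rw [integral_iUnion ht hd hg.integrableOn]
    simp [ih]

/-- The momentum space has finite measure, so indicators of measurable sets are in L₂ and w is
integrable. Orthogonality to products of indicators says that w has zero integral over every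
rectangle. -/
theorem dense_span_tensorCons (n : ℕ) :
    Dense (Submodule.span ℂ (Set.image2 (fun (f : OneParticle ε) (u : TensorPower ε n) =>
      tensorCons f u) Set.univ Set.univ) : Set (TensorPower ε (n + 1))) := by
  rw [Submodule.dense_iff_topologicalClosure_eq_top, Submodule.topologicalClosure_eq_top_iff,
    Submodule.eq_bot_iff]
  intro w hw
  have hmp := volume_preserving_piFinSuccAbove (fun _ : Fin (n + 1) => Zone ε) 0
  set e := MeasurableEquiv.piFinSuccAbove (fun _ : Fin (n + 1) => Zone ε) 0 with he
  have hwint : Integrable (fun p => w p) volume := (Lp.memLp w).integrable (by norm_num)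
  have hwint' : Integrable (fun z => w (e.symm z)) volume :=
    (hmp.symm e).integrable_comp_emb e.symm.measurableEmbedding |>.2 hwint
  have key : (fun z => w (e.symm z)) =ᵐ[volume] 0 := by
    refine ae_eq_zero_of_forall_rectangle hwint' fun A B hA hB => ?_
    set f : OneParticle ε := indicatorConstLp 2 hA (measure_ne_top _ _) (1 : ℂ)
    set u : TensorPower ε n := indicatorConstLp 2 hB (measure_ne_top _ _) (1 : ℂ)
    have h0 := (Submodule.mem_orthogonal _ _).1 hw (tensorCons f u)
      (Submodule.subset_span ⟨f, trivial, u, trivial, rfl⟩)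
    rw [L2.inner_def] at h0
    rw [← integral_indicator (hA.prod hB), ← h0, ← (hmp.symm e).integral_comp']
    refine integral_congr_ae ?_
    have hf : f =ᵐ[volume] A.indicator fun _ => (1 : ℂ) := indicatorConstLp_coeFn
    have hu : u =ᵐ[volume] B.indicator fun _ => (1 : ℂ) := indicatorConstLp_coeFn
    filter_upwards [(hmp.symm e).quasiMeasurePreserving.ae (coeFn_tensorCons f u),
      (hmp.symm e).quasiMeasurePreserving.ae ((quasiMeasurePreserving_zero n).ae hf),
      (hmp.symm e).quasiMeasurePreserving.ae ((quasiMeasurePreserving_tail n).ae hu)]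
      with z h1 h2 h3
    have e0 : e.symm z 0 = z.1 := rfl
    have e1 : Fin.tail (e.symm z) = z.2 := by ext i; rfl
    rw [h1, h2, h3, e0, e1]
    by_cases ha : z.1 ∈ A <;> by_cases hb : z.2 ∈ B <;>
      simp [Set.indicator, ha, hb]
  rw [Lp.eq_zero_iff_ae_eq_zero]
  filter_upwards [hmp.quasiMeasurePreserving.ae key] with p hp
  simpa using hp

end TensorProducts

/-! ### Exterior powers: contraction and the anticommutation identity -/

section Antisymmetrization
open ContinuousLinearMap (adjoint)

variable {ε : ℝ}

/-- The permutation of `0, …, n` fixing `0` and acting as `σ` on the other elements. -/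
def liftPerm {n : ℕ} (σ : Equiv.Perm (Fin n)) : Equiv.Perm (Fin (n + 1)) :=
  Equiv.Perm.decomposeFin.symm (0, σ)

theorem signC_liftPerm {n : ℕ} (σ : Equiv.Perm (Fin n)) : signC (liftPerm σ) = signC σ := by
  simp [signC, liftPerm, Equiv.Perm.decomposeFin.symm_sign]

theorem liftPerm_inv {n : ℕ} (σ : Equiv.Perm (Fin n)) : (liftPerm σ)⁻¹ = liftPerm σ⁻¹ := by
  rw [inv_eq_iff_mul_eq_one]
  ext x
  refine Fin.cases ?_ (fun y => ?_) x <;> simp [liftPerm]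

theorem signC_inv {n : ℕ} (σ : Equiv.Perm (Fin n)) : signC σ⁻¹ = signC σ := by
  simp [signC]

theorem inner_permOp_left {n : ℕ} (σ : Equiv.Perm (Fin n)) (u v : TensorPower ε n) :
    inner ℂ (permOp σ u) v = inner ℂ u (permOp σ⁻¹ v) := by
  conv_lhs => rw [← permOp_one v, ← mul_inv_cancel σ, permOp_mul]
  exact LinearIsometry.inner_map_map _ _ _

theorem tensorCons_permOp {n : ℕ} (σ : Equiv.Perm (Fin n)) (f : OneParticle ε)
    (u : TensorPower ε n) :
    permOp (liftPerm σ) (tensorCons f u) = tensorCons f (permOp σ u) := by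
  ext1
  have hw := coeFn_tensorCons f u
  filter_upwards [coeFn_permOp (liftPerm σ) (tensorCons f u),
    (measurePreserving_perm (liftPerm σ)).quasiMeasurePreserving.ae hw,
    coeFn_tensorCons f (permOp σ u),
    (quasiMeasurePreserving_tail n).ae (coeFn_permOp σ u)] with p h1 h2 h3 h4
  rw [h1, h2, h3, h4]
  congr 2

theorem permOp_swap_tensorCons {n : ℕ} (f g : OneParticle ε) (u : TensorPower ε n) :
    permOp (Equiv.swap 0 1) (tensorCons f (tensorCons g u)) = tensorCons g (tensorCons f u) := by
  ext1
  have h := fun f g : OneParticle ε =>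
    (coeFn_tensorCons f (tensorCons g u)).and
      ((quasiMeasurePreserving_tail (n + 1)).ae (coeFn_tensorCons g u))
  filter_upwards [coeFn_permOp (Equiv.swap 0 1) (tensorCons f (tensorCons g u)),
    (measurePreserving_perm (Equiv.swap 0 1)).quasiMeasurePreserving.ae (h f g), h g f]
    with p h1 h2 h3
  rw [h1, h2.1, h2.2, h3.1, h3.2]
  have e : Fin.tail (Fin.tail (p ∘ (Equiv.swap 0 1 : Equiv.Perm (Fin (n + 2)))))
      = Fin.tail (Fin.tail p) := by
    ext1 i
    simp only [Fin.tail, Function.comp_apply]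
    rw [Equiv.swap_apply_of_ne_of_ne (Fin.succ_ne_zero _)]
    exact fun h => Fin.succ_ne_zero i (Fin.succ_injective _ h)
  rw [e]
  simp only [Fin.tail, Function.comp_apply, Equiv.swap_apply_left]
  rw [show (Fin.succ 0 : Fin (n + 2)) = 1 from rfl, Equiv.swap_apply_right]
  ring

theorem antisymmetrize_permOp {n : ℕ} (σ : Equiv.Perm (Fin n)) (w : TensorPower ε n) :
    antisymmetrize n (permOp σ w) = signC σ • antisymmetrize n w := by
  refine Subtype.ext ?_
  have key : ∑ τ : Equiv.Perm (Fin n), signC τ • permOp τ (permOp σ w)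
      = signC σ • ∑ τ : Equiv.Perm (Fin n), signC τ • permOp τ w := by
    rw [Finset.smul_sum]
    refine Fintype.sum_equiv (Equiv.mulRight σ) _ _ fun τ => ?_
    rw [Equiv.coe_mulRight, signC_mul, smul_smul, mul_comm (signC τ), ← mul_assoc,
      signC_mul_self, one_mul, permOp_mul]
  rw [Submodule.coe_smul, coe_antisymmetrize, coe_antisymmetrize, key, smul_comm]

theorem antisymmetrize_coe {n : ℕ} (w : ExteriorPower ε n) :
    antisymmetrize n (w : TensorPower ε n) = w := by
  refine Subtype.ext ?_
  rw [coe_antisymmetrize]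
  have : ∀ σ : Equiv.Perm (Fin n), signC σ • permOp σ (w : TensorPower ε n) = w := fun σ => by
    rw [w.2 σ, smul_smul, signC_mul_self, one_smul]
  simp only [this, Finset.sum_const, Finset.card_univ, Fintype.card_perm, Fintype.card_fin]
  rw [← Nat.cast_smul_eq_nsmul ℂ, smul_smul, inv_mul_cancel₀ (by exact_mod_cast
    n.factorial_ne_zero), one_smul]

/-- A permutation of the last n factors lifts to one of all n + 1 factors with the same sign, and
the outer projection absorbs it. All n! terms of the inner projection thus contribute equally. -/
theorem antisymmetrize_tensorCons_antisymmetrize {n : ℕ} (f : OneParticle ε)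
    (w : TensorPower ε n) :
    antisymmetrize (n + 1) (tensorCons f (antisymmetrize n w : TensorPower ε n))
      = antisymmetrize (n + 1) (tensorCons f w) := by
  have h : ∀ σ : Equiv.Perm (Fin n), signC σ •
      antisymmetrize (n + 1) (tensorCons f (permOp σ w)) = antisymmetrize (n + 1) (tensorCons f w) := by
    intro σ
    rw [← tensorCons_permOp, antisymmetrize_permOp, smul_smul, signC_liftPerm, signC_mul_self,
      one_smul]
  rw [coe_antisymmetrize]
  simp only [map_smul, map_sum, h, Finset.sum_const, Finset.card_univ, Fintype.card_perm,
    Fintype.card_fin]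
  rw [← Nat.cast_smul_eq_nsmul ℂ, smul_smul, inv_mul_cancel₀ (by exact_mod_cast
    n.factorial_ne_zero), one_smul]

theorem wedge_apply {n : ℕ} (f : OneParticle ε) (u : ExteriorPower ε n) :
    wedge f u = antisymmetrize (n + 1) (tensorCons f (u : TensorPower ε n)) := rfl

/-- With the inner projections dropped, the two sides differ by exchanging the first two tensor
factors, an odd permutation. -/
theorem wedge_wedge {n : ℕ} (f g : OneParticle ε) (u : ExteriorPower ε n) :
    wedge f (wedge g u) = -wedge g (wedge f u) := by
  simp only [wedge_apply, antisymmetrize_tensorCons_antisymmetrize]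
  rw [← permOp_swap_tensorCons f g, antisymmetrize_permOp]
  have : signC (Equiv.swap 0 1 : Equiv.Perm (Fin (n + 2))) = -1 := by
    rw [signC, Equiv.Perm.sign_swap (by simp)]; simp
  rw [this, neg_one_smul, neg_neg]

/-- The contraction of a tensor with `f` in the first factor. -/
def contract {n : ℕ} (f : OneParticle ε) : TensorPower ε (n + 1) →L[ℂ] TensorPower ε n :=
  adjoint (tensorCons f)

theorem contract_tensorCons {n : ℕ} (f g : OneParticle ε) (u : TensorPower ε n) :
    contract f (tensorCons g u) = (inner ℂ f g : ℂ) • u := by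
  refine ext_inner_left ℂ fun v => ?_
  rw [contract, ContinuousLinearMap.adjoint_inner_right, inner_tensorCons, inner_smul_right]

theorem contract_permOp {n : ℕ} (σ : Equiv.Perm (Fin n)) (f : OneParticle ε)
    (u : TensorPower ε (n + 1)) :
    contract f (permOp (liftPerm σ) u) = permOp σ (contract f u) := by
  refine ext_inner_right ℂ fun v => ?_
  rw [contract, ContinuousLinearMap.adjoint_inner_left, inner_permOp_left, inner_permOp_left,
    ContinuousLinearMap.adjoint_inner_left, liftPerm_inv, tensorCons_permOp]

theorem contract_mem {n : ℕ} (f : OneParticle ε) (u : ExteriorPower ε (n + 1)) :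
    contract f (u : TensorPower ε (n + 1)) ∈ ExteriorPower ε n := by
  refine mem_exteriorPower.2 fun σ => ?_
  rw [← contract_permOp, u.2, map_smul, signC_liftPerm]

/-- The antisymmetrizing projection disappears when paired with the antisymmetric u, and the
contraction of u is already antisymmetric, so no projection is needed on the other side either. -/
theorem coe_adjoint_wedge {n : ℕ} (f : OneParticle ε) (u : ExteriorPower ε (n + 1)) :
    (adjoint (wedge f) u : TensorPower ε n) = contract f (u : TensorPower ε (n + 1)) := by
  have : adjoint (wedge f) u = ⟨_, contract_mem f u⟩ := by
    refine ext_inner_right ℂ fun v => ?_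
    have h := antisymmetrize_inner (tensorCons f (v : TensorPower ε n)) u
    rw [ContinuousLinearMap.adjoint_inner_left, Submodule.coe_inner, Submodule.coe_inner,
      wedge_apply, ← inner_conj_symm, h, inner_conj_symm]
    exact (ContinuousLinearMap.adjoint_inner_left _ _ _).symm
  rw [this]

/-- After the swap, f meets the first factor of v instead of g. By density it suffices to take v = h
⊗ b, where both sides are ⟨f|h⟩ g ⊗ b. -/
theorem contract_swap_tensorCons {n : ℕ} (f g : OneParticle ε) (v : TensorPower ε (n + 1)) :
    contract f (permOp (Equiv.swap 0 1) (tensorCons g v)) = tensorCons g (contract f v) := by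
  have : ((contract f).comp (permOp (Equiv.swap 0 1)).toContinuousLinearMap).comp (tensorCons g)
      = (tensorCons g).comp (contract (n := n) f) := by
    refine clm_eq_of_total (dense_span_tensorCons n) ?_
    rintro _ ⟨h, _, b, _, rfl⟩
    simp only [ContinuousLinearMap.comp_apply, LinearIsometry.coe_toContinuousLinearMap,
      permOp_swap_tensorCons, contract_tensorCons, map_smul]
  exact congrArg (fun T => T v) this

/-- Every permutation of n + 1 letters is uniquely (0 j) times a permutation fixing 0. The latter
acts on g ⊗ w by its sign, so each j collects n! equal terms, and n!/(n+1)! leaves the factor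
1/(n+1). -/
theorem antisymmetrize_tensorCons_eq_sum {n : ℕ} (g : OneParticle ε) (w : ExteriorPower ε n) :
    ((n : ℂ) + 1) • (wedge g w : TensorPower ε (n + 1))
      = ∑ j : Fin (n + 1), signC (Equiv.swap 0 j) •
        permOp (Equiv.swap 0 j) (tensorCons g (w : TensorPower ε n)) := by
  have hn : (n.factorial : ℂ) ≠ 0 := by exact_mod_cast n.factorial_ne_zero
  have hn' : (n : ℂ) + 1 ≠ 0 := by exact_mod_cast n.succ_ne_zero
  rw [wedge_apply, coe_antisymmetrize, ← Equiv.sum_comp Equiv.Perm.decomposeFin.symm,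
    Fintype.sum_prod_type, smul_smul, Nat.factorial_succ, Finset.smul_sum]
  refine Finset.sum_congr rfl fun j _ => ?_
  have h : ∀ e : Equiv.Perm (Fin n), signC (Equiv.Perm.decomposeFin.symm (j, e)) •
      permOp (Equiv.Perm.decomposeFin.symm (j, e)) (tensorCons g (w : TensorPower ε n))
      = signC (Equiv.swap 0 j) • permOp (Equiv.swap 0 j) (tensorCons g (w : TensorPower ε n)) := by
    intro e
    have hdec : Equiv.Perm.decomposeFin.symm (j, e) = Equiv.swap 0 j * liftPerm e := by
      ext x
      refine Fin.cases ?_ (fun y => ?_) x <;> simp [liftPerm]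
    rw [permOp_decomposeFin, hdec, signC_mul, signC_liftPerm, smul_smul, mul_assoc,
      signC_mul_self, mul_one]
  simp only [h, Finset.sum_const, Finset.card_univ, Fintype.card_perm, Fintype.card_fin]
  rw [← Nat.cast_smul_eq_nsmul ℂ, smul_smul]
  push_cast
  rw [mul_inv, ← mul_assoc, mul_inv_cancel₀ hn', one_mul, inv_mul_cancel₀ hn, one_smul]

/-- The transposition (0 i+1) is the conjugate of (0 1) by the lift of (0 i). The rightmost factor
acts on the antisymmetric v by its sign, the leftmost one commutes with the contraction. -/
theorem contract_swap_succ {n : ℕ} (f g : OneParticle ε) (v : ExteriorPower ε (n + 1))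
    (i : Fin (n + 1)) :
    contract f (permOp (Equiv.swap 0 i.succ) (tensorCons g (v : TensorPower ε (n + 1))))
      = signC (Equiv.swap 0 i) • permOp (Equiv.swap 0 i)
        (tensorCons g (contract f (v : TensorPower ε (n + 1)))) := by
  have hs : (Equiv.swap 0 i.succ : Equiv.Perm (Fin (n + 2)))
      = liftPerm (Equiv.swap 0 i) * Equiv.swap 0 1 * (liftPerm (Equiv.swap 0 i))⁻¹ := by
    rw [← Equiv.swap_apply_apply]
    simp [liftPerm]
  rw [hs, permOp_mul, permOp_mul, liftPerm_inv, tensorCons_permOp, v.2, map_smul, map_smul,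
    map_smul, map_smul, contract_permOp, contract_swap_tensorCons, signC_inv]

theorem adjoint_wedge_wedge_zero (f g : OneParticle ε) (v : ExteriorPower ε 0) :
    adjoint (wedge f) (wedge g v) = (inner ℂ f g : ℂ) • v := by
  refine Subtype.ext ?_
  have h := antisymmetrize_tensorCons_eq_sum g v
  rw [Fin.sum_univ_one, Equiv.swap_self] at h
  change _ = signC (1 : Equiv.Perm (Fin 1)) • permOp 1 (tensorCons g (v : TensorPower ε 0)) at h
  rw [permOp_one] at h
  simp only [signC, Equiv.Perm.sign_one, CharP.cast_eq_zero, zero_add, one_smul, Units.val_one,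
    Int.cast_one] at h
  rw [coe_adjoint_wedge, h, contract_tensorCons]
  rfl

/-- Contract the expansion of (n+2) g ∧ v with f. The term j = 0 gives ⟨f|g⟩ v; the remaining terms
are, up to a common minus sign, the expansion of (n+1) g ∧ (contraction of v). -/
theorem adjoint_wedge_wedge_succ {n : ℕ} (f g : OneParticle ε) (v : ExteriorPower ε (n + 1)) :
    ((n : ℂ) + 2) • adjoint (wedge f) (wedge g v)
        + ((n : ℂ) + 1) • wedge g (adjoint (wedge f) v)
      = (inner ℂ f g : ℂ) • v := by
  refine Subtype.ext ?_
  have h1 := congrArg (contract f) (antisymmetrize_tensorCons_eq_sum g v)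
  have h2 := antisymmetrize_tensorCons_eq_sum g (adjoint (wedge f) v)
  rw [map_smul, map_sum, Fin.sum_univ_succ] at h1
  simp only [map_smul, contract_swap_succ] at h1
  rw [Equiv.swap_self] at h1
  change _ = signC (1 : Equiv.Perm (Fin (n + 2))) • contract f (permOp 1 _) + _ at h1
  rw [permOp_one, contract_tensorCons] at h1
  have hs : ∀ i : Fin (n + 1), signC (Equiv.swap (0 : Fin (n + 2)) i.succ) = -1 := fun i => by
    rw [signC, Equiv.Perm.sign_swap (Fin.succ_ne_zero i).symm]; simp
  simp only [hs, neg_one_smul, Finset.sum_neg_distrib] at h1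
  rw [coe_adjoint_wedge] at h2
  rw [← h2] at h1
  simp only [Submodule.coe_add, Submodule.coe_smul, coe_adjoint_wedge]
  have e : (((n + 1 : ℕ) : ℂ) + 1) = (n : ℂ) + 2 := by push_cast; ring
  rw [e] at h1
  rw [h1]
  simp [signC]

end Antisymmetrization

/-! ### One Fock space: anticommutation relations, parity, totality -/

section FockSpace
open ContinuousLinearMap (adjoint)

variable {ε : ℝ}

theorem fock_clm_ext {G : Type*} [NormedAddCommGroup G] [NormedSpace ℂ G]
    {S T : Fock ε →L[ℂ] G}
    (h : ∀ (n : ℕ) (u : ExteriorPower ε n), S (lp.single 2 n u) = T (lp.single 2 n u)) : S = T := by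
  ext v
  have hs := lp.hasSum_single (p := 2) (by norm_num) v
  refine (hs.mapL S).unique ?_
  simp only [h]
  exact hs.mapL T

theorem tensorCons_add {n : ℕ} (f g : OneParticle ε) (u : TensorPower ε n) :
    tensorCons (f + g) u = tensorCons f u + tensorCons g u := by
  ext1
  filter_upwards [coeFn_tensorCons (f + g) u, coeFn_tensorCons f u, coeFn_tensorCons g u,
    Lp.coeFn_add (tensorCons f u) (tensorCons g u),
    (quasiMeasurePreserving_zero n).ae (Lp.coeFn_add f g)] with p h1 h2 h3 h4 h5
  rw [h1, h4, Pi.add_apply, h2, h3, h5, Pi.add_apply, add_mul]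

theorem tensorCons_smul {n : ℕ} (c : ℂ) (f : OneParticle ε) (u : TensorPower ε n) :
    tensorCons (c • f) u = c • tensorCons f u := by
  ext1
  filter_upwards [coeFn_tensorCons (c • f) u, coeFn_tensorCons f u,
    Lp.coeFn_smul c (tensorCons f u),
    (quasiMeasurePreserving_zero n).ae (Lp.coeFn_smul c f)] with p h1 h2 h3 h4
  rw [h1, h3, Pi.smul_apply, h2, h4, Pi.smul_apply, smul_eq_mul, smul_eq_mul, mul_assoc]

theorem fockCreate_add (f g : OneParticle ε) :
    fockCreate (f + g) = fockCreate f + fockCreate g := by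
  refine fock_clm_ext fun n u => ?_
  rw [add_apply, fockCreate_single, fockCreate_single, fockCreate_single, ← lp.single_add,
    ← smul_add, wedge_apply, tensorCons_add, map_add, wedge_apply, wedge_apply]

theorem fockCreate_smul (c : ℂ) (f : OneParticle ε) :
    fockCreate (c • f) = c • fockCreate f := by
  refine fock_clm_ext fun n u => ?_
  rw [smul_apply, fockCreate_single, fockCreate_single, ← lp.single_smul, wedge_apply,
    tensorCons_smul, map_smul, wedge_apply, smul_comm]

theorem norm_fockCreate_le (f : OneParticle ε) : ‖fockCreate f‖ ≤ ‖f‖ :=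
  LinearMap.mkContinuous_norm_le _ (norm_nonneg _) _

variable (ε) in
/-- The creation operators of the Fock space as a function of the created particle. -/
def fockCreateL : OneParticle ε →L[ℂ] (Fock ε →L[ℂ] Fock ε) :=
  LinearMap.mkContinuous
    { toFun := fockCreate
      map_add' := fockCreate_add
      map_smul' := fockCreate_smul } 1 fun f => by simpa using norm_fockCreate_le f

theorem adjoint_fockCreate_single_succ (f : OneParticle ε) (n : ℕ) (u : ExteriorPower ε (n + 1)) :
    adjoint (fockCreate f) (lp.single 2 (n + 1) u)
      = lp.single 2 n ((Real.sqrt (n + 1) : ℂ) • adjoint (wedge f) u) := by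
  refine ext_inner_right ℂ fun v => ?_
  rw [ContinuousLinearMap.adjoint_inner_left, lp.inner_single_left, lp.inner_single_left]
  have key : ∀ w : ExteriorPower ε n, inner ℂ u ((Real.sqrt (n + 1) : ℂ) • wedge f w)
      = inner ℂ ((Real.sqrt (n + 1) : ℂ) • adjoint (wedge f) u) w := fun w => by
    have h := ContinuousLinearMap.adjoint_inner_left (wedge f) w u
    rw [Submodule.coe_inner, Submodule.coe_inner] at h
    rw [Submodule.coe_inner, Submodule.coe_inner, Submodule.coe_smul, Submodule.coe_smul,
      inner_smul_left, inner_smul_right, Complex.conj_ofReal, h]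
  exact key (v n)

theorem adjoint_fockCreate_single_zero (f : OneParticle ε) (u : ExteriorPower ε 0) :
    adjoint (fockCreate f) (lp.single 2 0 u) = 0 := by
  refine ext_inner_right ℂ fun v => ?_
  rw [ContinuousLinearMap.adjoint_inner_left, lp.inner_single_left, inner_zero_left]
  exact inner_zero_right _

theorem adjoint_fockCreate_vacuum (f : OneParticle ε) :
    adjoint (fockCreate f) (fockVacuum ε) = 0 := adjoint_fockCreate_single_zero f _

theorem sqrt_succ_mul_self (n : ℕ) : (Real.sqrt (n + 1) : ℂ) * (Real.sqrt (n + 1) : ℂ) = n + 1 := by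
  rw [← Complex.ofReal_mul, Real.mul_self_sqrt (by positivity)]
  push_cast; rfl

/-- The scalars a and b stand for the normalizations √(n+2) and √(n+1) of the creation operators.
Only their squares enter, and these are exactly the weights of `adjoint_wedge_wedge_succ`. -/
theorem adjoint_wedge_wedge_smul {n : ℕ} (f g : OneParticle ε) (u : ExteriorPower ε (n + 1))
    {a b : ℂ} (ha : a * a = (n + 1 : ℕ) + 1) (hb : b * b = n + 1) :
    a • adjoint (wedge f) (a • wedge g u) + b • wedge g (b • adjoint (wedge f) u)
      = (inner ℂ f g : ℂ) • u := by
  have ha' : a * a = (n : ℂ) + 2 := by rw [ha]; push_cast; ring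
  rw [ContinuousLinearMap.map_smul, ContinuousLinearMap.map_smul, smul_smul, smul_smul, ha', hb]
  exact adjoint_wedge_wedge_succ f g u

/-- The canonical anticommutation relation on the Fock space. -/
theorem adjoint_fockCreate_mul_add (f g : OneParticle ε) :
    adjoint (fockCreate f) * fockCreate g + fockCreate g * adjoint (fockCreate f)
      = (inner ℂ f g : ℂ) • 1 := by
  refine fock_clm_ext fun n u => ?_
  simp only [add_apply, mul_apply_eq_comp, smul_apply, one_apply_eq_self]
  cases n with
  | zero =>
    rw [adjoint_fockCreate_single_zero, map_zero, add_zero, fockCreate_single,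
      adjoint_fockCreate_single_succ, map_smul, adjoint_wedge_wedge_zero, ← lp.single_smul]
    simp
  | succ n =>
    rw [adjoint_fockCreate_single_succ, fockCreate_single, fockCreate_single,
      adjoint_fockCreate_single_succ, ← lp.single_add, ← lp.single_smul,
      adjoint_wedge_wedge_smul f g u (sqrt_succ_mul_self _) (sqrt_succ_mul_self _)]

theorem fockCreate_mul_add (f g : OneParticle ε) :
    fockCreate f * fockCreate g + fockCreate g * fockCreate f = 0 := by
  refine fock_clm_ext fun n u => ?_
  simp only [add_apply, mul_apply_eq_comp, zero_apply]
  rw [fockCreate_single, fockCreate_single, fockCreate_single, fockCreate_single, ← lp.single_add,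
    map_smul, map_smul, wedge_wedge f g, smul_neg, smul_neg, neg_add_cancel]
  exact lp.single_zero _ _

theorem fockParity_mul_self : fockParity ε * fockParity ε = 1 := by
  refine fock_clm_ext fun n u => ?_
  rw [mul_apply_eq_comp, fockParity_single, fockParity_single, smul_smul, ← mul_pow]
  simp

/-- Creation raises the degree by one. This relation is the source of the anticommutation between
electrons and positrons. -/
theorem fockParity_mul_fockCreate (f : OneParticle ε) :
    fockParity ε * fockCreate f + fockCreate f * fockParity ε = 0 := by
  refine fock_clm_ext fun n u => ?_
  simp only [add_apply, mul_apply_eq_comp, zero_apply]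
  rw [fockCreate_single, fockParity_single, fockParity_single, fockCreate_single, map_smul,
    ← lp.single_add, pow_succ, mul_neg_one, neg_smul, smul_comm, neg_add_cancel]
  exact lp.single_zero _ _

theorem adjoint_fockParity : adjoint (fockParity ε) = fockParity ε := by
  refine fock_clm_ext fun n u => ?_
  refine ext_inner_right ℂ fun v => ?_
  rw [ContinuousLinearMap.adjoint_inner_left, fockParity_single, lp.inner_single_left,
    lp.inner_single_left]
  have key : ∀ w : ExteriorPower ε n,
      inner ℂ u ((-1 : ℂ) ^ n • w) = inner ℂ ((-1 : ℂ) ^ n • u) w := fun w => by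
    rw [Submodule.coe_inner, Submodule.coe_inner, Submodule.coe_smul, Submodule.coe_smul,
      inner_smul_left, inner_smul_right]
    simp
  exact key (v n)

theorem fockParity_vacuum : fockParity ε (fockVacuum ε) = fockVacuum ε := by
  rw [fockVacuum, fockParity_single, pow_zero, one_smul]

theorem fockMap_single (h : C(Zone ε, Circle)) (n : ℕ) (u : ExteriorPower ε n) :
    fockMap h (lp.single 2 n u) = lp.single 2 n (extMap n h u) := by
  refine lp.ext (funext fun j => ?_)
  change extMap j h ((lp.single 2 n u : Fock ε) j) = _
  by_cases hj : j = n
  · subst hj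
    rw [lp.single_apply_self, lp.single_apply_self]
  · rw [lp.single_apply_ne _ _ _ hj, lp.single_apply_ne _ _ _ hj, map_zero]

theorem fockMap_mul_fockCreate (h : C(Zone ε, Circle)) (f : OneParticle ε) :
    fockMap h * fockCreate f = fockCreate (mulOp (ofCircleFun h) f) * fockMap h := by
  refine fock_clm_ext fun n u => ?_
  rw [mul_apply_eq_comp, mul_apply_eq_comp, fockCreate_single, fockMap_single,
    fockMap_single, fockCreate_single, map_smul, extMap_wedge]

theorem fockMap_mul_fockParity (h : C(Zone ε, Circle)) :
    fockMap h * fockParity ε = fockParity ε * fockMap h := by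
  refine fock_clm_ext fun n u => ?_
  rw [mul_apply_eq_comp, mul_apply_eq_comp, fockParity_single, fockMap_single,
    fockMap_single, fockParity_single, map_smul]

theorem fockMap_vacuum (h : C(Zone ε, Circle)) : fockMap h (fockVacuum ε) = fockVacuum ε := by
  rw [fockVacuum, fockMap_single]
  congr 1
  refine Subtype.ext ?_
  change mulOp (prodFun 0 h) (ContinuousMap.toLp 2 volume ℂ 1) = _
  ext1
  filter_upwards [coeFn_mulOp (prodFun 0 h) (ContinuousMap.toLp 2 volume ℂ 1)] with p hp
  rw [hp]
  simp [prodFun]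

theorem mulOp_mulOp {X : Type} [TopologicalSpace X] [CompactSpace X] [MeasureSpace X]
    [OpensMeasurableSpace X] (h k : C(X, ℂ)) (g : Lp ℂ 2 (volume : Measure X)) :
    mulOp h (mulOp k g) = mulOp (h * k) g := by
  ext1
  filter_upwards [coeFn_mulOp h (mulOp k g), coeFn_mulOp k g, coeFn_mulOp (h * k) g]
    with p h1 h2 h3
  rw [h1, h2, h3, ContinuousMap.mul_apply, mul_assoc]

theorem mulOp_one {X : Type} [TopologicalSpace X] [CompactSpace X] [MeasureSpace X]
    [OpensMeasurableSpace X] (g : Lp ℂ 2 (volume : Measure X)) : mulOp 1 g = g := by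
  ext1
  filter_upwards [coeFn_mulOp 1 g] with p h1
  rw [h1, ContinuousMap.one_apply, one_mul]

theorem prodFun_mul (n : ℕ) (h k : C(Zone ε, Circle)) :
    prodFun n h * prodFun n k = prodFun n (h * k) := by
  ext p
  simp [prodFun, Finset.prod_mul_distrib]

theorem fockMap_mul (h k : C(Zone ε, Circle)) : fockMap h * fockMap k = fockMap (h * k) := by
  refine fock_clm_ext fun n u => ?_
  rw [mul_apply_eq_comp, fockMap_single, fockMap_single, fockMap_single]
  congr 1
  refine Subtype.ext ?_
  change mulOp _ (mulOp _ _) = mulOp _ _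
  rw [mulOp_mulOp, prodFun_mul]

theorem fockMap_one : fockMap (1 : C(Zone ε, Circle)) = 1 := by
  refine fock_clm_ext fun n u => ?_
  rw [fockMap_single]
  congr 1
  refine Subtype.ext ?_
  change mulOp _ (u : TensorPower ε n) = u
  have : prodFun n (1 : C(Zone ε, Circle)) = 1 := by ext p; simp [prodFun]
  rw [this, mulOp_one]

/-- The vector `c(f₁) ⋯ c(fₙ) 1`, where `c(f)` are the creation operators. -/
def fockProduct (F : List (OneParticle ε)) : Fock ε := (F.map fockCreate).prod (fockVacuum ε)

theorem fockProduct_nil : fockProduct ([] : List (OneParticle ε)) = fockVacuum ε := rfl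

theorem fockProduct_cons (f : OneParticle ε) (F : List (OneParticle ε)) :
    fockProduct (f :: F) = fockCreate f (fockProduct F) := rfl

/-- The closed span V of the products is invariant under creation by elements of s, hence by all
one-particle functions, and induction on the degree then yields every antisymmetric tensor. -/
theorem dense_span_fockProduct {s : Set (OneParticle ε)}
    (hs : Dense (Submodule.span ℂ s : Set (OneParticle ε))) :
    Dense (Submodule.span ℂ (fockProduct '' {F | ∀ f ∈ F, f ∈ s}) : Set (Fock ε)) := by
  rw [Submodule.dense_iff_topologicalClosure_eq_top, eq_top_iff]
  set V := (Submodule.span ℂ (fockProduct '' {F | ∀ f ∈ F, f ∈ s})).topologicalClosure with hVdef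
  have hV : IsClosed (V : Set (Fock ε)) := Submodule.isClosed_topologicalClosure _
  have h1 : ∀ f ∈ s, ∀ v ∈ V, fockCreate f v ∈ V := by
    intro f hf
    have hle : Submodule.span ℂ (fockProduct '' {F | ∀ f ∈ F, f ∈ s})
        ≤ V.comap (fockCreate f).toLinearMap := by
      refine Submodule.span_le.2 ?_
      rintro _ ⟨F, hF, rfl⟩
      refine Submodule.le_topologicalClosure _ (Submodule.subset_span ⟨f :: F, ?_, rfl⟩)
      intro g hg
      rcases List.mem_cons.1 hg with rfl | hg
      · exact hf
      · exact hF g hg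
    exact fun v hv => Submodule.topologicalClosure_minimal _ hle
      (hV.preimage (fockCreate f).continuous) hv
  -- For fixed v, creation depends linearly and continuously on the created function, so invariance
  -- extends from s to its closed span.
  have h2 : ∀ (f : OneParticle ε), ∀ v ∈ V, fockCreate f v ∈ V := by
    intro f v hv
    have hle : Submodule.span ℂ s
        ≤ V.comap ((ContinuousLinearMap.apply ℂ (Fock ε) v).comp (fockCreateL ε)).toLinearMap :=
      Submodule.span_le.2 fun f hf => h1 f hf v hv
    have := Submodule.topologicalClosure_minimal _ hle (hV.preimage (ContinuousLinearMap.continuous _))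
    exact this (hs f)
  have h3 : ∀ (n : ℕ) (w : TensorPower ε n),
      (lp.single 2 n (antisymmetrize n w) : Fock ε) ∈ V := by
    intro n
    induction n with
    | zero =>
      intro w
      -- A tensor of degree zero is a function on a one-point space, hence a constant.
      have hw : w = (w default) • ContinuousMap.toLp 2 volume ℂ (1 : C(Fin 0 → Zone ε, ℂ)) := by
        ext1
        filter_upwards [Lp.coeFn_smul (w default)
          (ContinuousMap.toLp 2 volume ℂ (1 : C(Fin 0 → Zone ε, ℂ))),
          ContinuousMap.coeFn_toLp (p := 2) (𝕜 := ℂ) volume (1 : C(Fin 0 → Zone ε, ℂ))]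
          with p h1 h2
        rw [h1, Pi.smul_apply, h2, Subsingleton.elim p default]
        simp
      have hv : fockVacuum ε ∈ V := Submodule.le_topologicalClosure _
        (Submodule.subset_span ⟨[], by simp, rfl⟩)
      rw [hw, map_smul, lp.single_smul]
      refine V.smul_mem _ ?_
      have := antisymmetrize_coe (n := 0) (ε := ε) ⟨ContinuousMap.toLp 2 volume ℂ 1,
        mem_exteriorPower.2 fun σ => by
          rw [Subsingleton.elim σ 1, permOp_one]; simp [signC]⟩
      rw [this]
      exact hv
    | succ n ih =>
      have hle : Submodule.span ℂ (Set.image2 (fun (f : OneParticle ε) (u : TensorPower ε n) =>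
          tensorCons f u) Set.univ Set.univ)
          ≤ V.comap ((lp.singleContinuousLinearMap ℂ (fun n : ℕ => ExteriorPower ε n) 2
            (n + 1)).comp (antisymmetrize (n + 1))).toLinearMap := by
        refine Submodule.span_le.2 ?_
        rintro _ ⟨f, _, u, _, rfl⟩
        change (lp.single 2 (n + 1) (antisymmetrize (n + 1) (tensorCons f u)) : Fock ε) ∈ V
        have hne : (Real.sqrt (n + 1) : ℂ) ≠ 0 := by
          exact_mod_cast (Real.sqrt_pos.2 (by positivity : (0 : ℝ) < n + 1)).ne'
        -- Up to the factor √(n+1), the vector Alt(f ⊗ u) is the creation operator of f applied to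
        -- Alt u, which is in V by induction.
        have := V.smul_mem (Real.sqrt (n + 1) : ℂ)⁻¹ (h2 f _ (ih u))
        rwa [fockCreate_single, ← lp.single_smul, smul_smul, inv_mul_cancel₀ hne, one_smul,
          wedge_apply, antisymmetrize_tensorCons_antisymmetrize] at this
      have := Submodule.topologicalClosure_minimal _ hle
        (hV.preimage (ContinuousLinearMap.continuous _))
      exact fun w => this (dense_span_tensorCons n w)
  intro v _
  refine hV.mem_of_tendsto (lp.hasSum_single (p := 2) (by norm_num) v)
    (.of_forall fun t => V.sum_mem fun n _ => ?_)
  have := h3 n (v n : TensorPower ε n)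
  rwa [antisymmetrize_coe] at this

end FockSpace

/-! ### Electrons and positrons: anticommutators of the fields -/

section StateSpace
open ContinuousLinearMap (adjoint)

namespace HilbertTensor

variable {E F : Type} [NormedAddCommGroup E] [InnerProductSpace ℂ E]
  [NormedAddCommGroup F] [InnerProductSpace ℂ F]

theorem map_mul_map (S S' : E →L[ℂ] E) (T T' : F →L[ℂ] F) :
    map S T * map S' T' = map (S * S') (T * T') := by
  ext1 Ψ
  exact map_map S T S' T' Ψ

theorem map_one_one : map (1 : E →L[ℂ] E) (1 : F →L[ℂ] F) = 1 :=
  clm_ext fun u v => by simp only [map_tmul, one_apply_eq_self]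

theorem map_add_left (S S' : E →L[ℂ] E) (T : F →L[ℂ] F) :
    map (S + S') T = map S T + map S' T :=
  clm_ext fun u v => by simp only [map_tmul, add_apply, add_tmul]

theorem tmul_add (u : E) (v v' : F) : tmul u (v + v') = tmul u v + tmul u v' :=
  map_add (tmulₗ E F u) v v'

theorem map_add_right (S : E →L[ℂ] E) (T T' : F →L[ℂ] F) :
    map S (T + T') = map S T + map S T' :=
  clm_ext fun u v => by simp only [map_tmul, add_apply, tmul_add]

theorem map_zero_left (T : F →L[ℂ] F) : map (0 : E →L[ℂ] E) T = 0 :=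
  clm_ext fun u v => by simp only [map_tmul, zero_apply, zero_tmul]

theorem map_zero_right (S : E →L[ℂ] E) : map S (0 : F →L[ℂ] F) = 0 :=
  clm_ext fun u v => by simp only [map_tmul, zero_apply, tmul_zero]

theorem map_smul_left (c : ℂ) (S : E →L[ℂ] E) (T : F →L[ℂ] F) :
    map (c • S) T = c • map S T :=
  clm_ext fun u v => by simp only [map_tmul, smul_apply, smul_tmul]

theorem map_smul_right (c : ℂ) (S : E →L[ℂ] E) (T : F →L[ℂ] F) :
    map S (c • T) = c • map S T :=
  clm_ext fun u v => by simp only [map_tmul, smul_apply, tmul_smul]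

end HilbertTensor

variable {ε : ℝ}

open HilbertTensor

theorem adjoint_mul {H : Type*} [NormedAddCommGroup H] [InnerProductSpace ℂ H] [CompleteSpace H]
    (S T : H →L[ℂ] H) : adjoint (S * T) = adjoint T * adjoint S :=
  ContinuousLinearMap.adjoint_comp S T

/-- The creation operator of positrons in the state `f`. -/
def createPos (f : OneParticle ε) : StateSpace ε →L[ℂ] StateSpace ε :=
  map (fockParity ε) (fockCreate f)

/-- The conjugation of the argument in the field operator cancels the one in the definition of
b(f)†. -/
theorem createB_star (f : OneParticle ε) : createB (star f) = createPos f := by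
  rw [createB, star_star, createPos]

theorem createA_eq (f : OneParticle ε) : createA f = map (fockCreate f) 1 := rfl

theorem adjoint_createA (f : OneParticle ε) :
    adjoint (createA f) = map (adjoint (fockCreate f)) 1 := by
  rw [createA_eq, adjoint_map, ← ContinuousLinearMap.star_eq_adjoint 1, star_one]

theorem adjoint_createPos (f : OneParticle ε) :
    adjoint (createPos f) = map (fockParity ε) (adjoint (fockCreate f)) := by
  rw [createPos, adjoint_map, adjoint_fockParity]

theorem createA_mul_createA (f g : OneParticle ε) :
    createA f * createA g + createA g * createA f = 0 := by
  rw [createA_eq, createA_eq, map_mul_map, map_mul_map, ← map_add_left, fockCreate_mul_add,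
    map_zero_left]

theorem createPos_mul_createPos (f g : OneParticle ε) :
    createPos f * createPos g + createPos g * createPos f = 0 := by
  rw [createPos, createPos, map_mul_map, map_mul_map, ← map_add_right, fockCreate_mul_add,
    map_zero_right]

theorem createPos_mul_createA (f g : OneParticle ε) :
    createPos f * createA g + createA g * createPos f = 0 := by
  rw [createA_eq, createPos, map_mul_map, map_mul_map, mul_one, one_mul, ← map_add_left,
    fockParity_mul_fockCreate, map_zero_left]

theorem adjoint_createA_mul_createA (f g : OneParticle ε) :
    adjoint (createA f) * createA g + createA g * adjoint (createA f) = (inner ℂ f g : ℂ) • 1 := by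
  rw [adjoint_createA, createA_eq, map_mul_map, map_mul_map, ← map_add_left,
    adjoint_fockCreate_mul_add, map_smul_left, mul_one, map_one_one]

theorem adjoint_createPos_mul_createPos (f g : OneParticle ε) :
    adjoint (createPos f) * createPos g + createPos g * adjoint (createPos f)
      = (inner ℂ f g : ℂ) • 1 := by
  rw [adjoint_createPos, createPos, map_mul_map, map_mul_map, ← map_add_right,
    adjoint_fockCreate_mul_add, map_smul_right, fockParity_mul_self, map_one_one]

theorem adjoint_createA_mul_createPos (f g : OneParticle ε) :
    adjoint (createA f) * createPos g + createPos g * adjoint (createA f) = 0 := by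
  have h := congrArg adjoint (fockParity_mul_fockCreate f)
  rw [map_add, adjoint_mul, adjoint_mul, adjoint_fockParity, map_zero] at h
  rw [adjoint_createA, createPos, map_mul_map, map_mul_map, mul_one, one_mul, ← map_add_left,
    h, map_zero_left]

theorem adjoint_createPos_mul_createA (f g : OneParticle ε) :
    adjoint (createPos f) * createA g + createA g * adjoint (createPos f) = 0 := by
  have h := congrArg adjoint (adjoint_createA_mul_createPos g f)
  rw [map_add, adjoint_mul, adjoint_mul, ContinuousLinearMap.adjoint_adjoint, map_zero] at h
  exact h

theorem adjoint_createA_vacuum (f : OneParticle ε) : adjoint (createA f) (vacuum ε) = 0 := by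
  rw [adjoint_createA, vacuum, map_tmul, adjoint_fockCreate_vacuum, zero_tmul]

theorem adjoint_createPos_vacuum (f : OneParticle ε) : adjoint (createPos f) (vacuum ε) = 0 := by
  rw [adjoint_createPos, vacuum, map_tmul, adjoint_fockCreate_vacuum, tmul_zero]

/-- Pair the relation with v. Discarding ‖S v‖² then bounds annihilation operators by the norm of
the mode. -/
theorem norm_sq_add_norm_sq_of_car {H : Type*} [NormedAddCommGroup H] [InnerProductSpace ℂ H]
    [CompleteSpace H] {S : H →L[ℂ] H} {c : ℝ}
    (h : adjoint S * S + S * adjoint S = ((c : ℂ)) • 1) (v : H) :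
    ‖S v‖ ^ 2 + ‖adjoint S v‖ ^ 2 = c * ‖v‖ ^ 2 := by
  have h1 := congrArg (fun T : H →L[ℂ] H => (inner ℂ v (T v)).re) h
  simp only [add_apply, mul_apply_eq_comp, smul_apply, one_apply_eq_self, inner_add_right,
    inner_smul_right, ContinuousLinearMap.adjoint_inner_right, Complex.add_re,
    Complex.re_ofReal_mul] at h1
  rw [← ContinuousLinearMap.adjoint_inner_left S (adjoint S v) v] at h1
  have h2 : ∀ w : H, (inner ℂ w w).re = ‖w‖ ^ 2 := fun w => inner_self_eq_norm_sq (𝕜 := ℂ) w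
  rw [h2, h2, h2] at h1
  exact h1

theorem inner_self_ofReal (f : OneParticle ε) : (inner ℂ f f : ℂ) = ((‖f‖ ^ 2 : ℝ) : ℂ) := by
  rw [inner_self_eq_norm_sq_to_K]
  push_cast
  rfl

theorem norm_adjoint_createA_le (f : OneParticle ε) (v : StateSpace ε) :
    ‖adjoint (createA f) v‖ ≤ ‖f‖ * ‖v‖ := by
  have h := norm_sq_add_norm_sq_of_car
    ((adjoint_createA_mul_createA f f).trans (by rw [inner_self_ofReal])) v
  refine le_of_sq_le_sq ?_ (by positivity)
  rw [mul_pow]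
  nlinarith [sq_nonneg ‖createA f v‖]

theorem norm_adjoint_createPos_le (f : OneParticle ε) (v : StateSpace ε) :
    ‖adjoint (createPos f) v‖ ≤ ‖f‖ * ‖v‖ := by
  have h := norm_sq_add_norm_sq_of_car
    ((adjoint_createPos_mul_createPos f f).trans (by rw [inner_self_ofReal])) v
  refine le_of_sq_le_sq ?_ (by positivity)
  rw [mul_pow]
  nlinarith [sq_nonneg ‖createPos f v‖]

/-- The field operator `a(f) + b(f*)†`. -/
def field (f : OneParticle ε) : StateSpace ε →L[ℂ] StateSpace ε :=
  adjoint (createA f) + createPos f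

theorem fieldOp_eq (m : ℝ) (k : Fin 2) (x t : ℝ) :
    fieldOp ε m k x t = field (fieldMode ε m k x t) := by
  rw [fieldOp, createB_star, field]

theorem adjoint_field (f : OneParticle ε) :
    adjoint (field f) = createA f + adjoint (createPos f) := by
  rw [field, map_add, ContinuousLinearMap.adjoint_adjoint]

theorem anticommutator_add {R : Type*} [Ring R] (a b c d : R) :
    (a + b) * (c + d) + (c + d) * (a + b)
      = (a * c + c * a) + (a * d + d * a) + (b * c + c * b) + (b * d + d * b) := by
  simp only [mul_add, add_mul]
  abel

/-- A field contains electron annihilation and positron creation only, so in a product of two fields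
no creation operator meets the annihilation operator of its own sort. -/
theorem field_mul_field (f g : OneParticle ε) : field f * field g + field g * field f = 0 := by
  have h1 := congrArg adjoint (createA_mul_createA g f)
  rw [map_add, adjoint_mul, adjoint_mul, map_zero] at h1
  have h2 := adjoint_createA_mul_createPos g f
  rw [add_comm] at h2
  rw [field, field, anticommutator_add, h1, h2, adjoint_createA_mul_createPos,
    createPos_mul_createPos]
  simp

theorem adjoint_field_mul_adjoint_field (f g : OneParticle ε) :
    adjoint (field f) * adjoint (field g) + adjoint (field g) * adjoint (field f) = 0 := by
  have h := congrArg adjoint (field_mul_field g f)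
  rwa [map_add, adjoint_mul, adjoint_mul, map_zero] at h

/-- The electron parts contribute ⟨f|g⟩. In the positron parts the annihilation operator belongs to
g, so they contribute ⟨g|f⟩. -/
theorem field_mul_adjoint_field (f g : OneParticle ε) :
    field f * adjoint (field g) + adjoint (field g) * field f
      = (inner ℂ f g + inner ℂ g f : ℂ) • 1 := by
  have h1 := congrArg adjoint (createPos_mul_createA g f)
  rw [map_add, adjoint_mul, adjoint_mul, map_zero] at h1
  have h2 := adjoint_createPos_mul_createPos g f
  rw [add_comm] at h2
  rw [field, adjoint_field, anticommutator_add, h1, h2, adjoint_createA_mul_createA,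
    createPos_mul_createA, add_zero, add_zero, ← add_smul]

/-! ### Second quantized multiplication operators and their intertwining relations -/

theorem adjoint_mulOp {X : Type} [TopologicalSpace X] [CompactSpace X] [MeasureSpace X]
    [OpensMeasurableSpace X] (h : C(X, ℂ)) :
    adjoint (mulOp h : Lp ℂ 2 (volume : Measure X) →L[ℂ] _) = mulOp (star h) := by
  ext1 u
  refine ext_inner_right ℂ fun v => ?_
  rw [ContinuousLinearMap.adjoint_inner_left, L2.inner_def, L2.inner_def]
  refine integral_congr_ae ?_
  filter_upwards [coeFn_mulOp h v, coeFn_mulOp (star h) u] with p h1 h2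
  rw [h1, h2]
  simp only [RCLike.inner_apply, map_mul, ContinuousMap.star_apply, RCLike.star_def,
    RCLike.conj_conj]
  ring

/-- On the unit circle complex conjugation is inversion. -/
theorem adjoint_fockMap (h : C(Zone ε, Circle)) : adjoint (fockMap h) = fockMap h⁻¹ := by
  refine fock_clm_ext fun n u => ?_
  refine ext_inner_right ℂ fun v => ?_
  rw [ContinuousLinearMap.adjoint_inner_left, fockMap_single, lp.inner_single_left,
    lp.inner_single_left]
  have key : ∀ w : ExteriorPower ε n, inner ℂ u (extMap n h w) = inner ℂ (extMap n h⁻¹ u) w := by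
    intro w
    change inner ℂ (u : TensorPower ε n) (mulOp (prodFun n h) (w : TensorPower ε n))
      = inner ℂ (mulOp (prodFun n h⁻¹) (u : TensorPower ε n)) (w : TensorPower ε n)
    rw [← ContinuousLinearMap.adjoint_inner_left, adjoint_mulOp]
    congr 3
    ext p
    simp [prodFun, ← Circle.coe_inv_eq_conj]
  exact key (v n)

theorem secondQuantProd_mul (h k : C(Zone ε, Circle)) :
    secondQuantProd h * secondQuantProd k = secondQuantProd (h * k) := by
  rw [secondQuantProd, secondQuantProd, map_mul_map, fockMap_mul, secondQuantProd]

theorem secondQuantProd_one : secondQuantProd (1 : C(Zone ε, Circle)) = 1 := by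
  rw [secondQuantProd, fockMap_one, map_one_one]

theorem adjoint_secondQuantProd (h : C(Zone ε, Circle)) :
    adjoint (secondQuantProd h) = secondQuantProd h⁻¹ := by
  rw [secondQuantProd, adjoint_map, adjoint_fockMap, secondQuantProd]

theorem secondQuantProd_vacuum (h : C(Zone ε, Circle)) :
    secondQuantProd h (vacuum ε) = vacuum ε := by
  rw [secondQuantProd, vacuum, map_tmul, fockMap_vacuum]

theorem secondQuantProd_mul_createA (h : C(Zone ε, Circle)) (f : OneParticle ε) :
    secondQuantProd h * createA f = createA (mulOp (ofCircleFun h) f) * secondQuantProd h := by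
  rw [secondQuantProd, createA_eq, createA_eq, map_mul_map, map_mul_map, mul_one, one_mul,
    fockMap_mul_fockCreate]

theorem secondQuantProd_mul_createPos (h : C(Zone ε, Circle)) (f : OneParticle ε) :
    secondQuantProd h * createPos f = createPos (mulOp (ofCircleFun h) f) * secondQuantProd h := by
  rw [secondQuantProd, createPos, createPos, map_mul_map, map_mul_map, fockMap_mul_fockParity,
    fockMap_mul_fockCreate]

theorem mulOp_ofCircleFun_mul (h k : C(Zone ε, Circle)) (f : OneParticle ε) :
    mulOp (ofCircleFun h) (mulOp (ofCircleFun k) f) = mulOp (ofCircleFun (h * k)) f := by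
  rw [mulOp_mulOp]
  congr 2

theorem mulOp_ofCircleFun_one (f : OneParticle ε) :
    mulOp (ofCircleFun (1 : C(Zone ε, Circle))) f = f := by
  have : ofCircleFun (1 : C(Zone ε, Circle)) = 1 := by ext p; simp [ofCircleFun]
  rw [this, mulOp_one]

/-- This is the adjoint of the relation for creation operators. Taking adjoints inverts the
multiplier, so that relation is used for h⁻¹ and the mode hf. -/
theorem secondQuantProd_mul_adjoint_createA (h : C(Zone ε, Circle)) (f : OneParticle ε) :
    secondQuantProd h * adjoint (createA f)
      = adjoint (createA (mulOp (ofCircleFun h) f)) * secondQuantProd h := by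
  have h1 := congrArg adjoint (secondQuantProd_mul_createA h⁻¹ (mulOp (ofCircleFun h) f))
  rw [adjoint_mul, adjoint_mul, adjoint_secondQuantProd, inv_inv, mulOp_ofCircleFun_mul,
    inv_mul_cancel, mulOp_ofCircleFun_one] at h1
  exact h1.symm

theorem secondQuantProd_mul_field (h : C(Zone ε, Circle)) (f : OneParticle ε) :
    secondQuantProd h * field f = field (mulOp (ofCircleFun h) f) * secondQuantProd h := by
  rw [field, field, mul_add, add_mul, secondQuantProd_mul_adjoint_createA,
    secondQuantProd_mul_createPos]

theorem norm_fockVacuum : ‖fockVacuum ε‖ = 1 := by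
  rw [fockVacuum, lp.norm_single (by norm_num), Submodule.coe_norm]
  rw [norm_eq_sqrt_re_inner (𝕜 := ℂ)]
  rw [L2.inner_def, integral_congr_ae (g := fun _ => (1 : ℂ))]
  -- The empty product of momentum intervals is a single point of measure 1.
  · have hvol : (volume : Measure (Fin 0 → Zone ε)) Set.univ = 1 := by
      rw [← Set.pi_univ Set.univ, volume_pi_pi]
      simp
    simp [Measure.real, hvol]
  · filter_upwards [ContinuousMap.coeFn_toLp (p := 2) (𝕜 := ℂ) volume (1 : C(Fin 0 → Zone ε, ℂ))]
      with p h1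
    rw [h1]
    simp

theorem norm_vacuum : ‖vacuum ε‖ = 1 := by
  rw [vacuum, norm_tmul, norm_fockVacuum, one_mul]

end StateSpace

/-! ### Cyclicity of the vacuum -/

section Totality
open ContinuousLinearMap (adjoint)
open HilbertTensor Filter Topology

variable {ε : ℝ}

theorem apply_apply_of_anticomm {H : Type*} [NormedAddCommGroup H] [NormedSpace ℂ H]
    {S T : H →L[ℂ] H} {c : ℂ} (h : S * T + T * S = c • 1) (v : H) :
    S (T v) = c • v - T (S v) := by
  have := congrArg (fun R : H →L[ℂ] H => R v) h
  simp only [add_apply, mul_apply_eq_comp, smul_apply, one_apply_eq_self] at this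
  exact eq_sub_of_add_eq this

theorem apply_apply_of_anticomm_zero {H : Type*} [NormedAddCommGroup H] [NormedSpace ℂ H]
    {S T : H →L[ℂ] H} (h : S * T + T * S = 0) (v : H) : S (T v) = -T (S v) := by
  rw [apply_apply_of_anticomm (h.trans (zero_smul ℂ 1).symm), zero_smul, zero_sub]

/-- The state with electrons `F` and no positrons. -/
def electronProduct (F : List (OneParticle ε)) : StateSpace ε := (F.map createA).prod (vacuum ε)

theorem electronProduct_cons (f : OneParticle ε) (F : List (OneParticle ε)) :
    electronProduct (f :: F) = createA f (electronProduct F) := rfl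

theorem electronProduct_eq_tmul (F : List (OneParticle ε)) :
    electronProduct F = tmul (fockProduct F) (fockVacuum ε) := by
  induction F with
  | nil => rfl
  | cons f F ih =>
    rw [electronProduct_cons, ih, createA, map_tmul, fockProduct_cons]
    rfl

theorem fockParity_fockProduct (F : List (OneParticle ε)) :
    fockParity ε (fockProduct F) = (-1 : ℂ) ^ F.length • fockProduct F := by
  induction F with
  | nil => rw [fockProduct_nil, fockParity_vacuum]; simp
  | cons f F ih =>
    rw [fockProduct_cons, apply_apply_of_anticomm_zero (fockParity_mul_fockCreate f), ih, map_smul,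
      List.length_cons, pow_succ, mul_neg_one, neg_smul]

/-- The state with electrons `F` and positrons `G`. -/
def productState (F G : List (OneParticle ε)) : StateSpace ε :=
  (G.map createPos).prod (electronProduct F)

theorem productState_nil (F : List (OneParticle ε)) : productState F [] = electronProduct F := rfl

theorem productState_cons (F : List (OneParticle ε)) (g : OneParticle ε)
    (G : List (OneParticle ε)) :
    productState F (g :: G) = createPos g (productState F G) := rfl

/-- Each positron creation meets the parity (-1)^|F| of the electrons once. The total sign is
invertible, so these states span the same space as the elementary tensors. -/
theorem productState_eq_smul_tmul (F G : List (OneParticle ε)) :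
    productState F G = ((-1 : ℂ) ^ F.length) ^ G.length • tmul (fockProduct F) (fockProduct G) := by
  induction G with
  | nil => rw [productState_nil, electronProduct_eq_tmul]; simp [fockProduct_nil]
  | cons g G ih =>
    rw [productState_cons, ih, createPos, map_smul, map_tmul, fockParity_fockProduct,
      ← fockProduct_cons, smul_tmul, smul_smul, List.length_cons, pow_succ]

theorem dense_span_productState {s : Set (OneParticle ε)}
    (hs : Dense (Submodule.span ℂ s : Set (OneParticle ε))) :
    Dense (Submodule.span ℂ {Ψ : StateSpace ε | ∃ F G : List (OneParticle ε),
      (∀ f ∈ F, f ∈ s) ∧ (∀ g ∈ G, g ∈ s) ∧ Ψ = productState F G} : Set (StateSpace ε)) := by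
  refine (dense_span_image2 (dense_span_fockProduct hs) (dense_span_fockProduct hs)).mono ?_
  refine Submodule.span_le.2 ?_
  rintro _ ⟨_, ⟨F, hF, rfl⟩, _, ⟨G, hG, rfl⟩, rfl⟩
  have h := Submodule.smul_mem _ (((-1 : ℂ) ^ F.length) ^ G.length)⁻¹
    (Submodule.subset_span (R := ℂ) (s := {Ψ : StateSpace ε | ∃ F G : List (OneParticle ε),
      (∀ f ∈ F, f ∈ s) ∧ (∀ g ∈ G, g ∈ s) ∧ Ψ = productState F G}) ⟨F, G, hF, hG, rfl⟩)
  rwa [productState_eq_smul_tmul, smul_smul, inv_mul_cancel₀ (by simp), one_smul] at h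

theorem adjoint_createPos_electronProduct (g : OneParticle ε) (F : List (OneParticle ε)) :
    adjoint (createPos g) (electronProduct F) = 0 := by
  induction F with
  | nil => exact adjoint_createPos_vacuum g
  | cons f F ih =>
    rw [electronProduct_cons, apply_apply_of_anticomm_zero (adjoint_createPos_mul_createA g f), ih,
      map_zero, neg_zero]

/-- The positron annihilation part of an adjoint field moves past the electrons and kills the
vacuum, leaving pure electron creation. -/
theorem adjoint_field_prod_vacuum (F : List (OneParticle ε)) :
    (F.map fun f => adjoint (field f)).prod (vacuum ε) = electronProduct F := by
  induction F with
  | nil => rfl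
  | cons f F ih =>
    rw [List.map_cons, List.prod_cons, mul_apply_eq_comp, ih, adjoint_field, add_apply,
      adjoint_createPos_electronProduct, add_zero, electronProduct_cons]

theorem adjoint_createA_positrons (g : OneParticle ε) (G : List (OneParticle ε))
    (v : StateSpace ε) :
    adjoint (createA g) ((G.map createPos).prod v)
      = (-1 : ℂ) ^ G.length • (G.map createPos).prod (adjoint (createA g) v) := by
  induction G with
  | nil => simp
  | cons h G ih =>
    rw [List.map_cons, List.prod_cons, mul_apply_eq_comp, mul_apply_eq_comp,
      apply_apply_of_anticomm_zero (adjoint_createA_mul_createPos g h), ih, map_smul,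
      List.length_cons, pow_succ, mul_neg_one, neg_smul]

/-- The fields applied to the vacuum span a dense subspace, if the modes span a dense subspace. -/
theorem dense_span_field {ι : Type*} {f : ι → OneParticle ε}
    (hf : Dense (Submodule.span ℂ (Set.range f) : Set (OneParticle ε))) :
    Dense (Submodule.span ℂ {Ψ : StateSpace ε | ∃ A B : List ι,
      Ψ = (A.map fun i => field (f i)).prod
        ((B.map fun i => adjoint (field (f i))).prod (vacuum ε))} : Set (StateSpace ε)) := by
  set E := Submodule.span ℂ {Ψ : StateSpace ε | ∃ A B : List ι,
      Ψ = (A.map fun i => field (f i)).prod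
        ((B.map fun i => adjoint (field (f i))).prod (vacuum ε))} with hE
  set K := Submodule.span ℂ (Set.range fun F : List ι => electronProduct (F.map f)) with hK
  have hKE : K ≤ E := by
    refine Submodule.span_le.2 ?_
    rintro _ ⟨F, rfl⟩
    refine Submodule.subset_span ⟨[], F, ?_⟩
    change electronProduct (F.map f) = _
    rw [← adjoint_field_prod_vacuum, List.map_map]
    rfl
  have hE1 : ∀ i, ∀ v ∈ E, field (f i) v ∈ E := by
    intro i
    have : E ≤ E.comap (field (f i)).toLinearMap := by
      refine Submodule.span_le.2 ?_
      rintro _ ⟨A, B, rfl⟩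
      exact Submodule.subset_span ⟨i :: A, B, rfl⟩
    exact this
  -- The span K of electron states is stable under annihilation: moving it past a creation operator
  -- leaves a scalar times a shorter product, and on the vacuum it gives zero.
  have hK1 : ∀ i, ∀ v ∈ K, adjoint (createA (f i)) v ∈ K := by
    intro i
    have hA : ∀ j, ∀ v ∈ K, createA (f j) v ∈ K := by
      intro j
      have : K ≤ K.comap (createA (f j)).toLinearMap := by
        refine Submodule.span_le.2 ?_
        rintro _ ⟨F, rfl⟩
        exact Submodule.subset_span ⟨j :: F, rfl⟩
      exact this
    have : K ≤ K.comap (adjoint (createA (f i))).toLinearMap := by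
      refine Submodule.span_le.2 ?_
      rintro _ ⟨F, rfl⟩
      change adjoint (createA (f i)) (electronProduct (F.map f)) ∈ K
      induction F with
      | nil =>
        rw [List.map_nil]
        change adjoint (createA (f i)) (vacuum ε) ∈ K
        rw [adjoint_createA_vacuum]
        exact K.zero_mem
      | cons j F ih =>
        rw [List.map_cons, electronProduct_cons,
          apply_apply_of_anticomm (adjoint_createA_mul_createA (f i) (f j))]
        exact K.sub_mem (K.smul_mem _ (Submodule.subset_span ⟨F, rfl⟩)) (hA j _ ih)
    exact this
  -- Positron creation is the field minus electron annihilation. The subtracted term moves past the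
  -- other positrons, up to a sign, and acts on v inside K, so quantifying over all of K makes the
  -- induction close.
  have key : ∀ G : List ι, ∀ v ∈ K, ((G.map f).map createPos).prod v ∈ E := by
    intro G
    induction G with
    | nil => exact fun v hv => hKE hv
    | cons i G ih =>
      intro v hv
      have h1 := hE1 i _ (ih v hv)
      rw [field, add_apply, adjoint_createA_positrons] at h1
      have h2 := E.smul_mem ((-1 : ℂ) ^ (G.map f).length) (ih _ (hK1 i v hv))
      have h3 := E.sub_mem h1 h2
      rw [add_sub_cancel_left] at h3
      exact h3
  refine (dense_span_productState hf).mono (Submodule.span_le.2 ?_)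
  rintro _ ⟨F, G, hF, hG, rfl⟩
  obtain ⟨F, rfl⟩ : F ∈ Set.range (List.map f) := by rw [Set.range_list_map]; exact hF
  obtain ⟨G, rfl⟩ : G ∈ Set.range (List.map f) := by rw [Set.range_list_map]; exact hG
  exact key G _ (Submodule.subset_span ⟨F, rfl⟩)

/-! ### Uniqueness of the vacuum -/

theorem tendsto_apply_zero_of_total {H : Type*} [NormedAddCommGroup H] [NormedSpace ℂ H]
    {s : Set H} (hs : Dense (Submodule.span ℂ s : Set H)) {T : ℕ → H →L[ℂ] H} {C : ℝ}
    (hC : ∀ k v, ‖T k v‖ ≤ C * ‖v‖) (h : ∀ v ∈ s, Tendsto (fun k => T k v) atTop (𝓝 0)) (v : H) :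
    Tendsto (fun k => T k v) atTop (𝓝 0) := by
  have h1 : ∀ w ∈ Submodule.span ℂ s, Tendsto (fun k => T k w) atTop (𝓝 0) := by
    intro w hw
    induction hw using Submodule.span_induction with
    | mem y hy => exact h y hy
    | zero => simp
    | add y z _ _ hy hz => simpa using hy.add hz
    | smul c y _ hy => simpa using hy.const_smul c
  rw [Metric.tendsto_atTop]
  intro δ hδ
  -- With this radius the uniform bound costs at most δ/2 on v - w; adding 1 to |C| keeps the
  -- denominator positive.
  obtain ⟨w, hw, hvw⟩ := Metric.dense_iff.1 hs v (δ / (2 * (|C| + 1))) (by positivity)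
  obtain ⟨N, hN⟩ := Metric.tendsto_atTop.1 (h1 _ hvw) (δ / 2) (by positivity)
  refine ⟨N, fun k hk => ?_⟩
  have h2 := hN k hk
  rw [Metric.mem_ball, dist_comm, dist_eq_norm] at hw
  rw [dist_zero_right] at h2 ⊢
  have h3 : ‖T k (v - w)‖ ≤ δ / 2 := by
    refine (hC k _).trans ?_
    calc C * ‖v - w‖ ≤ (|C| + 1) * (δ / (2 * (|C| + 1))) := by
          gcongr
          linarith [le_abs_self C]
      _ = δ / 2 := by field_simp
  calc ‖T k v‖ = ‖T k (v - w) + T k w‖ := by rw [← map_add, sub_add_cancel]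
    _ ≤ ‖T k (v - w)‖ + ‖T k w‖ := norm_add_le _ _
    _ < δ := by linarith

theorem dense_span_univ_productState :
    Dense (Submodule.span ℂ {Ψ : StateSpace ε | ∃ F G : List (OneParticle ε),
      (∀ f ∈ F, f ∈ Set.univ) ∧ (∀ g ∈ G, g ∈ Set.univ) ∧ Ψ = productState F G} :
        Set (StateSpace ε)) :=
  dense_span_productState (by simp)

/-- Annihilation operators of a weakly vanishing bounded sequence of electrons vanish strongly. -/
theorem tendsto_adjoint_createA {f : ℕ → OneParticle ε} {C : ℝ} (hC : ∀ k, ‖f k‖ ≤ C)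
    (h : ∀ g, Tendsto (fun k => (inner ℂ (f k) g : ℂ)) atTop (𝓝 0)) (v : StateSpace ε) :
    Tendsto (fun k => adjoint (createA (f k)) v) atTop (𝓝 0) := by
  refine tendsto_apply_zero_of_total dense_span_univ_productState
    (fun k v => (norm_adjoint_createA_le (f k) v).trans
      (mul_le_mul_of_nonneg_right (hC k) (norm_nonneg v))) ?_ v
  rintro _ ⟨F, G, hF, hG, rfl⟩
  clear hF hG
  -- Moving the annihilation operator past the first electron g leaves ⟨f k|g⟩ times a fixed state,
  -- which vanishes in the limit, and an annihilation applied to a shorter product.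
  have h1 : Tendsto (fun k => adjoint (createA (f k)) (electronProduct F)) atTop (𝓝 0) := by
    induction F with
    | nil =>
      refine tendsto_const_nhds.congr fun k => ?_
      exact (adjoint_createA_vacuum _).symm
    | cons g F ih =>
      simp only [electronProduct_cons,
        apply_apply_of_anticomm (adjoint_createA_mul_createA _ g)]
      simpa using ((h g).smul_const (electronProduct F)).sub
        (((createA g).continuous.tendsto 0).comp ih)
  simp only [productState, adjoint_createA_positrons]
  simpa using (((G.map createPos).prod.continuous.tendsto 0).comp h1).const_smul
    ((-1 : ℂ) ^ G.length)

/-- Annihilation operators of a weakly vanishing bounded sequence of positrons vanish strongly. -/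
theorem tendsto_adjoint_createPos {f : ℕ → OneParticle ε} {C : ℝ} (hC : ∀ k, ‖f k‖ ≤ C)
    (h : ∀ g, Tendsto (fun k => (inner ℂ (f k) g : ℂ)) atTop (𝓝 0)) (v : StateSpace ε) :
    Tendsto (fun k => adjoint (createPos (f k)) v) atTop (𝓝 0) := by
  refine tendsto_apply_zero_of_total dense_span_univ_productState
    (fun k v => (norm_adjoint_createPos_le (f k) v).trans
      (mul_le_mul_of_nonneg_right (hC k) (norm_nonneg v))) ?_ v
  rintro _ ⟨F, G, hF, hG, rfl⟩
  clear hF hG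
  induction G with
  | nil =>
    refine tendsto_const_nhds.congr fun k => ?_
    exact (adjoint_createPos_electronProduct _ _).symm
  | cons g G ih =>
    simp only [productState_cons, apply_apply_of_anticomm (adjoint_createPos_mul_createPos _ g)]
    simpa using ((h g).smul_const (productState F G)).sub
      (((createPos g).continuous.tendsto 0).comp ih)

theorem norm_mulOp_ofCircleFun_le (h : C(Zone ε, Circle)) (f : OneParticle ε) :
    ‖mulOp (ofCircleFun h) f‖ ≤ ‖f‖ := by
  refine ((mulOp _).le_opNorm f).trans ?_
  refine mul_le_of_le_one_left (norm_nonneg _) ((norm_mulOp_le _).trans ?_)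
  exact (ContinuousMap.norm_le _ zero_le_one).2 fun p => (Circle.norm_coe _).le

theorem inner_secondQuantProd (h : C(Zone ε, Circle)) (Ψ Φ : StateSpace ε) :
    inner ℂ (secondQuantProd h Ψ) (secondQuantProd h Φ) = inner ℂ Ψ Φ := by
  rw [← ContinuousLinearMap.adjoint_inner_left, adjoint_secondQuantProd, ← mul_apply_eq_comp,
    secondQuantProd_mul, inv_mul_cancel, secondQuantProd_one, one_apply_eq_self]

theorem norm_secondQuantProd (h : C(Zone ε, Circle)) (Ψ : StateSpace ε) :
    ‖secondQuantProd h Ψ‖ = ‖Ψ‖ := by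
  rw [norm_eq_sqrt_re_inner (𝕜 := ℂ), inner_secondQuantProd, ← norm_eq_sqrt_re_inner]

theorem secondQuantProd_pow_fixed {u : C(Zone ε, Circle)} {Ψ : StateSpace ε}
    (hΨ : secondQuantProd u Ψ = Ψ) (k : ℕ) : secondQuantProd (u ^ k) Ψ = Ψ := by
  induction k with
  | zero => rw [pow_zero, secondQuantProd_one, one_apply_eq_self]
  | succ k ih => rw [pow_succ, ← secondQuantProd_mul, mul_apply_eq_comp, hΨ, ih]

/-- By unitarity and invariance of Ψ, the inner product equals ⟨S(uᵏf)*Ψ|UᵏΦ⟩ for every k, where U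
is the second quantization of u. The left vector tends to zero while the norm of the right one stays
constant. -/
theorem inner_fixed_eq_zero {u : C(Zone ε, Circle)} {Ψ : StateSpace ε}
    (hΨ : secondQuantProd u Ψ = Ψ) {S : OneParticle ε → StateSpace ε →L[ℂ] StateSpace ε}
    (hS : ∀ h f, secondQuantProd h * S f = S (mulOp (ofCircleFun h) f) * secondQuantProd h)
    (f : OneParticle ε)
    (ht : Tendsto (fun k : ℕ => adjoint (S (mulOp (ofCircleFun (u ^ k)) f)) Ψ) atTop (𝓝 0))
    (Φ : StateSpace ε) : inner ℂ Ψ (S f Φ) = 0 := by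
  have h1 : ∀ k : ℕ, ‖(inner ℂ Ψ (S f Φ) : ℂ)‖
      ≤ ‖adjoint (S (mulOp (ofCircleFun (u ^ k)) f)) Ψ‖ * ‖Φ‖ := by
    intro k
    rw [← inner_secondQuantProd (u ^ k), secondQuantProd_pow_fixed hΨ, ← mul_apply_eq_comp, hS,
      mul_apply_eq_comp, ← ContinuousLinearMap.adjoint_inner_left]
    refine (norm_inner_le_norm _ _).trans ?_
    rw [norm_secondQuantProd]
  have h2 := ht.norm.mul_const ‖Φ‖
  rw [norm_zero, zero_mul] at h2
  exact norm_le_zero_iff.1 (ge_of_tendsto' h2 h1)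

/-- A multiplication operator with weakly vanishing powers fixes the multiples of the vacuum
only. -/
theorem eq_smul_vacuum_of_fixed {u : C(Zone ε, Circle)}
    (hu : ∀ f g, Tendsto (fun k : ℕ => (inner ℂ (mulOp (ofCircleFun (u ^ k)) f) g : ℂ))
      atTop (𝓝 0))
    {Ψ : StateSpace ε} (hΨ : secondQuantProd u Ψ = Ψ) : ∃ c : ℂ, Ψ = c • vacuum ε := by
  refine ⟨inner ℂ (vacuum ε) Ψ, ?_⟩
  rw [← sub_eq_zero]
  refine eq_zero_of_orthogonal_total dense_span_univ_productState ?_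
  -- Removing the vacuum component keeps the vector invariant; the remainder is orthogonal to the
  -- vacuum by construction and to every state with a particle by weak decay.
  have hfix : secondQuantProd u (Ψ - (inner ℂ (vacuum ε) Ψ : ℂ) • vacuum ε)
      = Ψ - (inner ℂ (vacuum ε) Ψ : ℂ) • vacuum ε := by
    rw [map_sub, map_smul, hΨ, secondQuantProd_vacuum]
  rintro _ ⟨F, G, _, _, rfl⟩
  cases G with
  | cons g G =>
    exact inner_fixed_eq_zero hfix secondQuantProd_mul_createPos g
      (tendsto_adjoint_createPos (fun k => norm_mulOp_ofCircleFun_le _ g) (hu g) _) _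
  | nil =>
    cases F with
    | cons f F =>
      exact inner_fixed_eq_zero hfix secondQuantProd_mul_createA f
        (tendsto_adjoint_createA (fun k => norm_mulOp_ofCircleFun_le _ f) (hu f) _) _
    | nil =>
      change inner ℂ _ (vacuum ε) = (0 : ℂ)
      rw [inner_sub_left, inner_smul_left, inner_conj_symm, inner_self_eq_norm_sq_to_K,
        norm_vacuum]
      simp

end Totality

/-! ### Fourier analysis of the modes -/

section Modes
open ContinuousLinearMap (adjoint)
open HilbertTensor Filter Topology

variable {ε : ℝ}

theorem integral_zone {E : Type*} [NormedAddCommGroup E] [NormedSpace ℝ E] (g : ℝ → E) :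
    ∫ p : Zone ε, g p = ∫ p in Set.Icc (-(Real.pi / ε)) (Real.pi / ε), g p :=
  integral_subtype_comap measurableSet_Icc g

/-- The extension of a function on the interval of momenta by zero. -/
def zeroExtend (g : Zone ε → ℂ) : ℝ → ℂ := Function.extend Subtype.val g 0

theorem zeroExtend_coe (g : Zone ε → ℂ) (p : Zone ε) : zeroExtend g p = g p :=
  Subtype.val_injective.extend_apply g 0 p

theorem zeroExtend_of_notMem (g : Zone ε → ℂ) {p : ℝ}
    (hp : p ∉ Set.Icc (-(Real.pi / ε)) (Real.pi / ε)) : zeroExtend g p = 0 :=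
  Function.extend_apply' _ _ _ (by rintro ⟨q, rfl⟩; exact hp q.2)

/-- This is the Riemann–Lebesgue lemma for the function f*g extended by zero to the line. -/
theorem tendsto_phase_pow (hε : 0 < ε) (f g : OneParticle ε) :
    Tendsto (fun k : ℕ =>
      (inner ℂ (mulOp (ofCircleFun (phase (coordinate ε) (-ε) ^ k)) f) g : ℂ)) atTop (𝓝 0) := by
  -- At the frequency kε/(2π) the Fourier character e^{-2πipw} becomes e^{-ikεp}, the conjugate of
  -- the multiplier (e^{iεp})ᵏ.
  have hw : Tendsto (fun k : ℕ => (k : ℝ) * (ε / (2 * Real.pi))) atTop (cocompact ℝ) :=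
    (tendsto_natCast_atTop_atTop.atTop_mul_const (by positivity)).mono_right
      atTop_le_cocompact
  have h := (Real.tendsto_integral_exp_smul_cocompact
    (zeroExtend fun p : Zone ε => star (f p) * g p)).comp hw
  refine h.congr fun k => ?_
  rw [Function.comp_apply, L2.inner_def, ← setIntegral_eq_integral_of_forall_compl_eq_zero
    (s := Set.Icc (-(Real.pi / ε)) (Real.pi / ε)), ← integral_zone]
  · refine integral_congr_ae ?_
    filter_upwards [coeFn_mulOp (ofCircleFun (phase (coordinate ε) (-ε) ^ k)) f] with p hp
    rw [hp, zeroExtend_coe, Circle.smul_def, Real.fourierChar_apply]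
    simp only [ofCircleFun, phase, coordinate, ContinuousMap.coe_mk, ContinuousMap.pow_apply,
      Circle.coe_pow, Circle.coe_exp, RCLike.inner_apply, map_mul, map_pow, smul_eq_mul]
    rw [← Complex.exp_conj, ← Complex.exp_nat_mul]
    have : (2 * Real.pi * -((p : ℝ) * (k * (ε / (2 * Real.pi)))) : ℝ) = -(k * (ε * p)) := by
      field_simp
    rw [this]
    simp only [map_mul, Complex.conj_I, Complex.conj_ofReal, RCLike.star_def]
    push_cast
    ring_nf
  · intro p hp
    rw [zeroExtend_of_notMem _ hp, smul_zero]

theorem coeFn_fieldMode (m : ℝ) (k : Fin 2) (x t : ℝ) :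
    fieldMode ε m k x t =ᵐ[volume] modeFun ε m k x t :=
  ContinuousMap.coeFn_toLp volume _

theorem mulOp_fieldMode (m : ℝ) (k : Fin 2) (x t a b : ℝ) :
    mulOp (ofCircleFun (phase (energy ε m) (-b) * phase (coordinate ε) a)) (fieldMode ε m k x t)
      = fieldMode ε m k (x + a) (t + b) := by
  ext1
  filter_upwards [coeFn_mulOp (ofCircleFun (phase (energy ε m) (-b) * phase (coordinate ε) a))
    (fieldMode ε m k x t), coeFn_fieldMode m k x t, coeFn_fieldMode m k (x + a) (t + b)]
    with p h1 h2 h3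
  rw [h1, h2, h3]
  simp only [ofCircleFun, phase, energy, coordinate, modeFun, ContinuousMap.coe_mk,
    ContinuousMap.mul_apply, Circle.coe_mul, Circle.coe_exp]
  rw [← Complex.exp_add, mul_left_comm, ← Complex.exp_add]
  congr 2
  push_cast
  ring

/-- Conjugation multiplies the mode by e^{ibω_p - iap}, which is precisely a shift of its argument
by (a, b). -/
theorem fieldOp_translate (m : ℝ) (k : Fin 2) (x t a b : ℝ) :
    (expH ε m (-b) * expP ε a) * fieldOp ε m k x t * (expP ε (-a) * expH ε m b)
      = fieldOp ε m k (x + a) (t + b) := by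
  have hinv : ∀ (h : C(Zone ε, ℝ)) (s : ℝ), phase h s * phase h (-s) = 1 := by
    intro h s
    ext p
    simp [phase]
  rw [expH, expP, expP, expH, secondQuantProd_mul, secondQuantProd_mul, fieldOp_eq,
    secondQuantProd_mul_field, mulOp_fieldMode, mul_assoc, secondQuantProd_mul, ← fieldOp_eq]
  have : phase (energy ε m) (-b) * phase (coordinate ε) a
      * (phase (coordinate ε) (-a) * phase (energy ε m) b) = 1 := by
    have h1 := hinv (coordinate ε) a
    have h2 := hinv (energy ε m) b
    calc _ = (phase (energy ε m) b * phase (energy ε m) (-b))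
        * (phase (coordinate ε) a * phase (coordinate ε) (-a)) := by
          simp only [mul_comm, mul_left_comm]
      _ = 1 := by rw [h1, h2, one_mul]
  rw [this, secondQuantProd_one, mul_one]

/-- The exponentials e^{inεp} are the Fourier basis of an interval of length 2π/ε, so Parseval's
identity gives zero L₂ norm. -/
theorem eq_zero_of_fourier (hε : 0 < ε) {g : Zone ε → ℂ} (hg : MemLp g 2 volume)
    (h : ∀ n : ℤ, ∫ p : Zone ε, Complex.exp (Complex.I * (n * ε * (p : ℝ))) * g p = 0) :
    g =ᵐ[volume] 0 := by
  set a := -(Real.pi / ε) with ha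
  set b := Real.pi / ε with hb
  have hab : a < b := by
    have : 0 < Real.pi / ε := by positivity
    linarith
  set G := zeroExtend g with hG
  have hemb : MeasurableEmbedding (Subtype.val : Zone ε → ℝ) :=
    MeasurableEmbedding.subtype_coe measurableSet_Icc
  have hmap : Measure.map (Subtype.val : Zone ε → ℝ) volume = volume.restrict (Set.Icc a b) :=
    map_comap_subtype_coe measurableSet_Icc volume
  have hGL : MemLp G 2 (volume.restrict (Set.Icc a b)) := by
    rw [← hmap, hemb.memLp_map_measure_iff]
    have : G ∘ (Subtype.val : Zone ε → ℝ) = g := funext fun p => zeroExtend_coe g p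
    rwa [this]
  have hGL' : MemLp G 2 (volume.restrict (Set.Ioc a b)) := by
    rwa [← Measure.restrict_congr_set Ioc_ae_eq_Icc] at hGL
  have hcoeff : ∀ n : ℤ, fourierCoeffOn hab G n = 0 := by
    intro n
    -- The n-th Fourier coefficient integrates against the character of index -n, hence the use of
    -- `h (-n)`.
    rw [fourierCoeffOn_eq_integral, intervalIntegral.integral_of_le hab.le,
      ← integral_Icc_eq_integral_Ioc, ← integral_zone, ← smul_zero (1 / (b - a)), ← h (-n)]
    congr 1
    refine integral_congr_ae (.of_forall fun p => ?_)
    simp only [hG, zeroExtend_coe, smul_eq_mul]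
    rw [fourier_coe_apply]
    congr 2
    have : (b - a : ℝ) = 2 * Real.pi / ε := by rw [ha, hb]; ring
    rw [this]
    have hε' : (ε : ℂ) ≠ 0 := by exact_mod_cast hε.ne'
    have hπ : (Real.pi : ℂ) ≠ 0 := by exact_mod_cast Real.pi_ne_zero
    push_cast
    field_simp
  have hsum := hasSum_sq_fourierCoeffOn hab hGL'
  simp only [hcoeff, norm_zero, ne_eq, OfNat.ofNat_ne_zero, not_false_eq_true, zero_pow] at hsum
  have h0 : ∫ p in a..b, ‖G p‖ ^ 2 = 0 := by
    have := hsum.unique hasSum_zero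
    rcases smul_eq_zero.1 this with h1 | h1
    · exact absurd h1 (inv_ne_zero (by linarith))
    · exact h1
  rw [intervalIntegral.integral_of_le hab.le, ← integral_Icc_eq_integral_Ioc,
    ← integral_zone, integral_eq_zero_iff_of_nonneg (fun p => by positivity)] at h0
  · filter_upwards [h0] with p hp
    simpa [hG, zeroExtend_coe] using hp
  · have := (memLp_two_iff_integrable_sq_norm hg.aestronglyMeasurable).1 hg
    simpa only [hG, zeroExtend_coe] using this

theorem cos_half_mixingAngle_pos (ε m p : ℝ) : 0 < Real.cos (mixingAngle ε m p / 2) := by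
  have h := mixingAngle_mem ε m p
  exact Real.cos_pos_of_mem_Ioo ⟨by linarith [h.1, Real.pi_pos], by linarith [h.2]⟩

/-- The first components at time zero suffice. If g is orthogonal to them, all Fourier coefficients
of cos(α_p/2) g vanish, and cos(α_p/2) > 0 because 0 < α_p < π. -/
theorem dense_span_fieldMode (hε : 0 < ε) (m : ℝ) :
    Dense (Submodule.span ℂ (Set.range
      fun s : Fin 2 × AddSubgroup.zmultiples ε × AddSubgroup.zmultiples ε =>
        fieldMode ε m s.1 s.2.1 s.2.2) : Set (OneParticle ε)) := by
  rw [Submodule.dense_iff_topologicalClosure_eq_top, Submodule.topologicalClosure_eq_top_iff,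
    Submodule.eq_bot_iff]
  intro g hg
  set c : C(Zone ε, ℂ) := ⟨fun p => (Real.cos (mixingAngle ε m p / 2) : ℂ), by
    have := continuous_mixingAngle ε m
    fun_prop⟩ with hc
  have key : (fun p : Zone ε => c p * g p) =ᵐ[volume] 0 := by
    refine eq_zero_of_fourier hε (memLp_mul c g) fun n => ?_
    have h0 := (Submodule.mem_orthogonal _ _).1 hg _ (Submodule.subset_span
      ⟨(0, ⟨n • ε, n, rfl⟩, 0), rfl⟩)
    rw [L2.inner_def] at h0
    -- This is the conjugate of the constant √(ε/π) i in the first component.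
    have hne : (Real.sqrt (ε / Real.pi) : ℂ) * -Complex.I ≠ 0 := by
      have : 0 < Real.sqrt (ε / Real.pi) := Real.sqrt_pos.2 (by positivity)
      exact mul_ne_zero (by exact_mod_cast this.ne') (neg_ne_zero.2 Complex.I_ne_zero)
    refine (mul_eq_zero.1 ?_).resolve_left hne
    rw [← h0, ← integral_const_mul]
    refine integral_congr_ae ?_
    filter_upwards [coeFn_fieldMode m 0 (n • ε) 0] with p hp
    change _ = inner ℂ (fieldMode ε m 0 (n • ε) 0 p) (g p)
    rw [hp]
    simp only [modeFun, spinor, ContinuousMap.coe_mk, Matrix.cons_val_zero, RCLike.inner_apply,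
      map_mul, Complex.conj_I, Complex.conj_ofReal, ← Complex.exp_conj, hc,
      zsmul_eq_mul, Complex.ofReal_zero, mul_zero, zero_sub, Complex.ofReal_mul,
      Complex.ofReal_intCast, map_neg, map_intCast]
    ring_nf
  rw [Lp.eq_zero_iff_ae_eq_zero]
  filter_upwards [key] with p hp
  have hne : c p ≠ 0 := by
    have := (cos_half_mixingAngle_pos ε m p).ne'
    simp only [hc, ContinuousMap.coe_mk]
    exact_mod_cast this
  exact (mul_eq_zero.1 hp).resolve_left hne

end Modes

/-! ### Locality: overlaps of modes at spacelike separation -/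

section Locality
open ContinuousLinearMap (adjoint)

variable {ε : ℝ}

/-- The recursion expresses row N + 1 through the neighbours in row N and the same site in row N -
1, so the support widens by at most one site per step. -/
theorem eq_zero_of_lattice_recursion {κ : ℝ} {I : ℤ → ℤ → ℝ}
    (hrec : ∀ N M, I (N + 1) M + I (N - 1) M = κ * (I N (M + 1) + I N (M - 1)))
    (h0 : ∀ M, 0 < |M| → I 0 M = 0) (h1 : ∀ M, 1 < |M| → I 1 M = 0) {N M : ℤ}
    (h : |N| < |M|) : I N M = 0 := by
  have aux : ∀ J : ℤ → ℤ → ℝ,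
      (∀ N M, J (N + 1) M + J (N - 1) M = κ * (J N (M + 1) + J N (M - 1))) →
      (∀ M, 0 < |M| → J 0 M = 0) → (∀ M, 1 < |M| → J 1 M = 0) →
      ∀ (n : ℕ) (M : ℤ), (n : ℤ) < |M| → J n M = 0 := by
    intro J hJ hJ0 hJ1 n
    induction n using Nat.twoStepInduction with
    | zero => exact fun M hM => by simpa using hJ0 M (by simpa using hM)
    | one => exact fun M hM => by simpa using hJ1 M (by simpa using hM)
    | more n ih0 ih1 =>
      intro M hM
      push_cast at hM ih1 ⊢
      have hr := hJ (n + 1) M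
      rw [ih1 (M + 1) (by grind), ih1 (M - 1) (by grind), add_sub_cancel_right,
        ih0 M (by linarith)] at hr
      rw [show (n : ℤ) + 2 = n + 1 + 1 by ring]
      linarith
  obtain ⟨n, rfl | rfl⟩ := N.eq_nat_or_neg
  · exact aux I hrec h0 h1 n M (by simpa using h)
  -- Negative times are reached by reflecting N, which preserves the recursion.
  · refine aux (fun N M => I (-N) M) (fun N M => ?_) (fun M hM => by simpa using h0 M hM)
      (fun M hM => ?_) n M (by simpa using h)
    · have := hrec (-N) M
      rw [add_comm, show -N - 1 = -(N + 1) by ring, show -N + 1 = -(N - 1) by ring] at this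
      linarith
    -- Row -1 is obtained from rows 0 and 1 by the recursion at N = 0; for |M| > 1 the neighbours M
    -- ± 1 are nonzero.
    · have hr := hrec 0 M
      rw [h0 (M + 1) (by grind), h0 (M - 1) (by grind), zero_add, zero_sub, h1 M hM] at hr
      linarith

theorem integral_cos_lattice (hε : 0 < ε) {n : ℤ} (hn : n ≠ 0) :
    ∫ p in -(Real.pi / ε)..(Real.pi / ε), Real.cos (n * (p * ε)) = 0 := by
  have hne : (n : ℝ) * ε ≠ 0 := mul_ne_zero (by exact_mod_cast hn) hε.ne'
  have : ∀ p : ℝ, (n : ℝ) * (p * ε) = (n * ε) * p := fun p => by ring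
  simp only [this]
  rw [intervalIntegral.integral_comp_mul_left _ hne, integral_cos]
  have e1 : (n : ℝ) * ε * (Real.pi / ε) = n * Real.pi := by field_simp
  rw [mul_neg, e1, Real.sin_neg, Real.sin_int_mul_pi]
  simp

/-- Only the even part contributes on a symmetric interval, and the cosine is integrated over |n|
full periods. -/
theorem integral_eq_zero_of_even_part (hε : 0 < ε) {f : ℝ → ℝ} (hf : Continuous f) {n : ℤ}
    (hn : n ≠ 0) {C : ℝ} (h : ∀ p, f p + f (-p) = C * Real.cos (n * (p * ε))) :
    ∫ p in -(Real.pi / ε)..(Real.pi / ε), f p = 0 := by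
  have h1 : ∫ p in -(Real.pi / ε)..(Real.pi / ε), f (-p)
      = ∫ p in -(Real.pi / ε)..(Real.pi / ε), f p := by
    rw [intervalIntegral.integral_comp_neg, neg_neg]
  have h2 : ∫ p in -(Real.pi / ε)..(Real.pi / ε), (f p + f (-p)) = 0 := by
    simp only [h]
    rw [intervalIntegral.integral_const_mul, integral_cos_lattice hε hn, mul_zero]
  have hf' : Continuous fun p => f (-p) := hf.comp continuous_neg
  rw [intervalIntegral.integral_add (hf.intervalIntegrable _ _)
    (hf'.intervalIntegrable _ _), h1] at h2
  linarith

theorem abs_cos_div_sqrt_le (ε m p : ℝ) :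
    |Real.cos (p * ε) / Real.sqrt (1 + m ^ 2 * ε ^ 2)| ≤ 1 := by
  have h1 : 1 ≤ Real.sqrt (1 + m ^ 2 * ε ^ 2) := Real.one_le_sqrt.2 (by nlinarith [sq_nonneg (m * ε)])
  rw [abs_div, abs_of_nonneg (Real.sqrt_nonneg _), div_le_one (by linarith)]
  exact (Real.abs_cos_le_one _).trans h1

theorem dispersion_mul (hε : 0 < ε) (m p : ℝ) :
    dispersion ε m p * ε = Real.arccos (Real.cos (p * ε) / Real.sqrt (1 + m ^ 2 * ε ^ 2)) := by
  rw [dispersion]; field_simp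

theorem cos_dispersion (hε : 0 < ε) (m p : ℝ) :
    Real.cos (dispersion ε m p * ε) = Real.cos (p * ε) / Real.sqrt (1 + m ^ 2 * ε ^ 2) := by
  have := abs_le.1 (abs_cos_div_sqrt_le ε m p)
  rw [dispersion_mul hε, Real.cos_arccos this.1 this.2]

/-- The form displays √(1 + cot² α_p), the factor that cancels against the same root in cos α_p and
sin α_p. -/
theorem sin_dispersion {m : ℝ} (hε : 0 < ε) (hm : 0 < m) (p : ℝ) :
    Real.sin (dispersion ε m p * ε) = m * ε / Real.sqrt (1 + m ^ 2 * ε ^ 2)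
      * Real.sqrt (1 + (Real.sin (p * ε) / (m * ε)) ^ 2) := by
  have h0 : 0 < 1 + m ^ 2 * ε ^ 2 := by positivity
  rw [dispersion_mul hε, Real.sin_arccos]
  have : 1 - (Real.cos (p * ε) / Real.sqrt (1 + m ^ 2 * ε ^ 2)) ^ 2
      = (m * ε / Real.sqrt (1 + m ^ 2 * ε ^ 2)) ^ 2 * (1 + (Real.sin (p * ε) / (m * ε)) ^ 2) := by
    rw [div_pow, div_pow, div_pow, Real.sq_sqrt h0.le, Real.cos_sq']
    field_simp
    ring
  rw [this, Real.sqrt_mul (by positivity), Real.sqrt_sq (by positivity)]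

theorem cos_mixingAngle (ε m p : ℝ) : Real.cos (mixingAngle ε m p)
    = Real.sin (p * ε) / (m * ε) / Real.sqrt (1 + (Real.sin (p * ε) / (m * ε)) ^ 2) := by
  rw [mixingAngle, Real.cos_pi_div_two_sub, Real.sin_arctan]

theorem sin_mixingAngle (ε m p : ℝ) : Real.sin (mixingAngle ε m p)
    = 1 / Real.sqrt (1 + (Real.sin (p * ε) / (m * ε)) ^ 2) := by
  rw [mixingAngle, Real.sin_pi_div_two_sub, Real.cos_arctan]

theorem cos_mixingAngle_mul_sin_dispersion {m : ℝ} (hε : 0 < ε) (hm : 0 < m) (p : ℝ) :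
    Real.cos (mixingAngle ε m p) * Real.sin (dispersion ε m p * ε)
      = Real.sin (p * ε) / Real.sqrt (1 + m ^ 2 * ε ^ 2) := by
  have h : 0 < Real.sqrt (1 + (Real.sin (p * ε) / (m * ε)) ^ 2) := Real.sqrt_pos.2 (by positivity)
  rw [cos_mixingAngle, sin_dispersion hε hm]
  generalize Real.sqrt (1 + (Real.sin (p * ε) / (m * ε)) ^ 2) = r at h
  field_simp

theorem sin_mixingAngle_mul_sin_dispersion {m : ℝ} (hε : 0 < ε) (hm : 0 < m) (p : ℝ) :
    Real.sin (mixingAngle ε m p) * Real.sin (dispersion ε m p * ε)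
      = m * ε / Real.sqrt (1 + m ^ 2 * ε ^ 2) := by
  have h : 0 < Real.sqrt (1 + (Real.sin (p * ε) / (m * ε)) ^ 2) := Real.sqrt_pos.2 (by positivity)
  rw [sin_mixingAngle, sin_dispersion hε hm]
  generalize Real.sqrt (1 + (Real.sin (p * ε) / (m * ε)) ^ 2) = r at h
  field_simp

theorem mixingAngle_neg (ε m p : ℝ) : mixingAngle ε m (-p) = Real.pi - mixingAngle ε m p := by
  rw [mixingAngle, mixingAngle, neg_mul, Real.sin_neg, neg_div, Real.arctan_neg]
  ring

theorem dispersion_neg (ε m p : ℝ) : dispersion ε m (-p) = dispersion ε m p := by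
  rw [dispersion, dispersion, neg_mul, Real.cos_neg]

theorem cos_half_mixingAngle_neg (ε m p : ℝ) :
    Real.cos (mixingAngle ε m (-p) / 2) = Real.sin (mixingAngle ε m p / 2) := by
  rw [mixingAngle_neg, sub_div, Real.cos_pi_div_two_sub]

theorem sin_half_mixingAngle_neg (ε m p : ℝ) :
    Real.sin (mixingAngle ε m (-p) / 2) = Real.cos (mixingAngle ε m p / 2) := by
  rw [mixingAngle_neg, sub_div, Real.sin_pi_div_two_sub]

variable (ε) in
/-- The product of two modes, up to a constant factor, for the separation `(Mε, Nε)`. -/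
def overlapFun (m : ℝ) (k k' : Fin 2) (N M : ℤ) (p : ℝ) : ℂ :=
  star (spinor ε m p k) * spinor ε m p k'
    * Complex.exp (Complex.I * (N * (dispersion ε m p * ε) - M * (p * ε)))

theorem continuous_spinor (m : ℝ) (k : Fin 2) : Continuous fun p => spinor ε m p k := by
  have h2 := continuous_mixingAngle ε m
  fin_cases k <;> simp only [spinor] <;> simp <;> fun_prop

theorem continuous_overlapFun (m : ℝ) (k k' : Fin 2) (N M : ℤ) :
    Continuous (overlapFun ε m k k' N M) := by
  have h1 := continuous_dispersion ε m
  have h2 := continuous_spinor (ε := ε) m k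
  have h3 := continuous_spinor (ε := ε) m k'
  unfold overlapFun
  fun_prop

/-- Shifting N or M by ±1 multiplies the integrand by e^{±iω_pε} or e^{∓ipε}. The sums of the two
shifts are 2cos ω_pε and 2cos pε, which the dispersion relation makes proportional. -/
theorem overlapFun_recursion (hε : 0 < ε) (m : ℝ) (k k' : Fin 2) (N M : ℤ) (p : ℝ) :
    overlapFun ε m k k' (N + 1) M p + overlapFun ε m k k' (N - 1) M p
      = ((1 / Real.sqrt (1 + m ^ 2 * ε ^ 2) : ℝ) : ℂ)
        * (overlapFun ε m k k' N (M + 1) p + overlapFun ε m k k' N (M - 1) p) := by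
  have hcos : ∀ θ : ℝ, Complex.exp (Complex.I * θ) + Complex.exp (-(Complex.I * θ))
      = ((2 * Real.cos θ : ℝ) : ℂ) := by
    intro θ
    push_cast
    rw [Complex.two_cos, neg_mul, mul_comm (θ : ℂ)]
  have h1 := hcos (dispersion ε m p * ε)
  have h2 := hcos (p * ε)
  rw [cos_dispersion hε] at h1
  have h3 : ((2 * (Real.cos (p * ε) / Real.sqrt (1 + m ^ 2 * ε ^ 2)) : ℝ) : ℂ)
      = ((1 / Real.sqrt (1 + m ^ 2 * ε ^ 2) : ℝ) : ℂ) * ((2 * Real.cos (p * ε) : ℝ) : ℂ) := by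
    rw [← Complex.ofReal_mul]
    congr 1
    ring
  rw [h3, ← h2] at h1
  set W := star (spinor ε m p k) * spinor ε m p k' with hW
  set E := Complex.exp (Complex.I * (N * (dispersion ε m p * ε) - M * (p * ε))) with hE
  have e1 : overlapFun ε m k k' (N + 1) M p
      = W * E * Complex.exp (Complex.I * ((dispersion ε m p * ε : ℝ) : ℂ)) := by
    rw [mul_assoc, hE, ← Complex.exp_add, overlapFun, ← hW]
    push_cast
    ring_nf
  have e2 : overlapFun ε m k k' (N - 1) M p
      = W * E * Complex.exp (-(Complex.I * ((dispersion ε m p * ε : ℝ) : ℂ))) := by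
    rw [mul_assoc, hE, ← Complex.exp_add, overlapFun, ← hW]
    push_cast
    ring_nf
  have e3 : overlapFun ε m k k' N (M + 1) p
      = W * E * Complex.exp (-(Complex.I * ((p * ε : ℝ) : ℂ))) := by
    rw [mul_assoc, hE, ← Complex.exp_add, overlapFun, ← hW]
    push_cast
    ring_nf
  have e4 : overlapFun ε m k k' N (M - 1) p
      = W * E * Complex.exp (Complex.I * ((p * ε : ℝ) : ℂ)) := by
    rw [mul_assoc, hE, ← Complex.exp_add, overlapFun, ← hW]
    push_cast
    ring_nf
  rw [e1, e2, e3, e4, ← mul_add, h1]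
  ring

variable (ε) in
/-- The real part of the product of two modes integrated over momenta. -/
def overlap (m : ℝ) (k k' : Fin 2) (N M : ℤ) : ℝ :=
  ∫ p in -(Real.pi / ε)..(Real.pi / ε), (overlapFun ε m k k' N M p).re

theorem continuous_re_overlapFun (m : ℝ) (k k' : Fin 2) (N M : ℤ) :
    Continuous fun p => (overlapFun ε m k k' N M p).re :=
  Complex.continuous_re.comp (continuous_overlapFun m k k' N M)

theorem overlap_recursion (hε : 0 < ε) (m : ℝ) (k k' : Fin 2) (N M : ℤ) :
    overlap ε m k k' (N + 1) M + overlap ε m k k' (N - 1) M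
      = (1 / Real.sqrt (1 + m ^ 2 * ε ^ 2))
        * (overlap ε m k k' N (M + 1) + overlap ε m k k' N (M - 1)) := by
  have hi := fun N M => (continuous_re_overlapFun (ε := ε) m k k' N M).intervalIntegrable
    (μ := volume) (-(Real.pi / ε)) (Real.pi / ε)
  simp only [overlap]
  rw [← intervalIntegral.integral_add (hi _ _) (hi _ _),
    ← intervalIntegral.integral_add (hi _ _) (hi _ _), ← intervalIntegral.integral_const_mul]
  refine intervalIntegral.integral_congr fun p _ => ?_
  have := congrArg Complex.re (overlapFun_recursion hε m k k' N M p)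
  rw [Complex.re_ofReal_mul, Complex.add_re, Complex.add_re] at this
  exact this

theorem re_overlapFun (m : ℝ) (N M : ℤ) (p : ℝ) (w : ℂ) :
    (w * Complex.exp (Complex.I * (N * (dispersion ε m p * ε) - M * (p * ε)))).re
      = w.re * Real.cos (N * (dispersion ε m p * ε) - M * (p * ε))
        - w.im * Real.sin (N * (dispersion ε m p * ε) - M * (p * ε)) := by
  have : Complex.I * (N * (dispersion ε m p * ε) - M * (p * ε))
      = ((N * (dispersion ε m p * ε) - M * (p * ε) : ℝ) : ℂ) * Complex.I := by
    push_cast; ring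
  rw [this, Complex.mul_re, Complex.exp_ofReal_mul_I_re, Complex.exp_ofReal_mul_I_im]

theorem re_overlapFun_zero_zero (m : ℝ) (N M : ℤ) (p : ℝ) :
    (overlapFun ε m 0 0 N M p).re = Real.cos (mixingAngle ε m p / 2) ^ 2
      * Real.cos (N * (dispersion ε m p * ε) - M * (p * ε)) := by
  rw [overlapFun, re_overlapFun]
  simp [spinor, -Complex.ofReal_cos, -Complex.ofReal_sin, -mul_eq_mul_right_iff, sq]

theorem re_overlapFun_one_one (m : ℝ) (N M : ℤ) (p : ℝ) :
    (overlapFun ε m 1 1 N M p).re = Real.sin (mixingAngle ε m p / 2) ^ 2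
      * Real.cos (N * (dispersion ε m p * ε) - M * (p * ε)) := by
  rw [overlapFun, re_overlapFun]
  simp [spinor, -Complex.ofReal_cos, -Complex.ofReal_sin, -mul_eq_mul_right_iff, sq]

/-- The product of the two amplitudes is -(i/2) sin α_p, so taking the real part selects the sine of
the phase. -/
theorem re_overlapFun_zero_one (m : ℝ) (N M : ℤ) (p : ℝ) :
    (overlapFun ε m 0 1 N M p).re = Real.sin (mixingAngle ε m p) / 2
      * Real.sin (N * (dispersion ε m p * ε) - M * (p * ε)) := by
  have h : Real.sin (mixingAngle ε m p)
      = 2 * Real.sin (mixingAngle ε m p / 2) * Real.cos (mixingAngle ε m p / 2) := by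
    rw [← Real.sin_two_mul]; ring_nf
  rw [overlapFun, re_overlapFun, h]
  simp [spinor, -Complex.ofReal_cos, -Complex.ofReal_sin, -mul_eq_mul_right_iff]
  ring

theorem re_overlapFun_one_zero (m : ℝ) (N M : ℤ) (p : ℝ) :
    (overlapFun ε m 1 0 N M p).re = -(overlapFun ε m 0 1 N M p).re := by
  rw [overlapFun, re_overlapFun, overlapFun, re_overlapFun]
  simp [spinor, -Complex.ofReal_cos, -Complex.ofReal_sin, -mul_eq_mul_right_iff]
  ring

theorem cos_half_sq_sub_sin_half_sq (α : ℝ) :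
    Real.cos (α / 2) ^ 2 - Real.sin (α / 2) ^ 2 = Real.cos α := by
  rw [← Real.cos_two_mul']; ring_nf

/-- The reflection p ↦ -p sends α_p to π - α_p and so exchanges cos²(α_p/2) with sin²(α_p/2). In the
diagonal cases the weights therefore add up to 1 and leave cos(Mpε); in the mixed cases the
integrand is odd. -/
theorem overlap_zero (hε : 0 < ε) (m : ℝ) (k k' : Fin 2) {M : ℤ} (hM : 0 < |M|) :
    overlap ε m k k' 0 M = 0 := by
  have hM' : M ≠ 0 := abs_pos.1 hM
  have h01 : overlap ε m 0 1 0 M = 0 := by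
    refine integral_eq_zero_of_even_part hε (continuous_re_overlapFun m 0 1 0 M) hM' (C := 0)
      fun p => ?_
    rw [re_overlapFun_zero_one, re_overlapFun_zero_one, mixingAngle_neg, Real.sin_pi_sub]
    simp
  fin_cases k <;> fin_cases k'
  · change overlap ε m 0 0 0 M = 0
    refine integral_eq_zero_of_even_part hε (continuous_re_overlapFun m 0 0 0 M) hM' (C := 1)
      fun p => ?_
    rw [re_overlapFun_zero_zero, re_overlapFun_zero_zero, cos_half_mixingAngle_neg]
    simp only [Int.cast_zero, zero_mul, zero_sub, neg_mul, mul_neg, neg_neg, Real.cos_neg]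
    rw [← add_mul, Real.cos_sq_add_sin_sq]
  · exact h01
  · change ∫ p in _.._, (overlapFun ε m 1 0 0 M p).re = 0
    simp only [re_overlapFun_one_zero, intervalIntegral.integral_neg]
    exact neg_eq_zero.2 h01
  · change overlap ε m 1 1 0 M = 0
    refine integral_eq_zero_of_even_part hε (continuous_re_overlapFun m 1 1 0 M) hM' (C := 1)
      fun p => ?_
    rw [re_overlapFun_one_one, re_overlapFun_one_one, sin_half_mixingAngle_neg]
    simp only [Int.cast_zero, zero_mul, zero_sub, neg_mul, mul_neg, neg_neg, Real.cos_neg]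
    rw [← add_mul, Real.sin_sq_add_cos_sq]

/-- By the formulas for cos ω_pε and cos α_p sin ω_pε, adding the reflected integrand gives
cos((M-1)pε) and cos((M+1)pε), up to the factor 1/√(1+m²ε²), in the two diagonal cases. The product
sin α_p sin ω_pε is constant in p, so the mixed cases give a multiple of cos(Mpε). The condition |M|
> 1 makes all three frequencies nonzero. -/
theorem overlap_one {m : ℝ} (hε : 0 < ε) (hm : 0 < m) (k k' : Fin 2) {M : ℤ} (hM : 1 < |M|) :
    overlap ε m k k' 1 M = 0 := by
  have hM0 : M ≠ 0 := by grind
  have hM1 : M - 1 ≠ 0 := by grind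
  have hM2 : M + 1 ≠ 0 := by grind
  have h01 : overlap ε m 0 1 1 M = 0 := by
    refine integral_eq_zero_of_even_part hε (continuous_re_overlapFun m 0 1 1 M) hM0
      (C := m * ε / Real.sqrt (1 + m ^ 2 * ε ^ 2)) fun p => ?_
    rw [re_overlapFun_zero_one, re_overlapFun_zero_one, mixingAngle_neg, Real.sin_pi_sub,
      dispersion_neg, ← sin_mixingAngle_mul_sin_dispersion hε hm p]
    simp only [Int.cast_one, one_mul, neg_mul, mul_neg, sub_neg_eq_add, Real.sin_add, Real.sin_sub]
    ring
  fin_cases k <;> fin_cases k'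
  · change overlap ε m 0 0 1 M = 0
    refine integral_eq_zero_of_even_part hε (continuous_re_overlapFun m 0 0 1 M) hM1
      (C := 1 / Real.sqrt (1 + m ^ 2 * ε ^ 2)) fun p => ?_
    rw [re_overlapFun_zero_zero, re_overlapFun_zero_zero, cos_half_mixingAngle_neg, dispersion_neg]
    have h1 := cos_mixingAngle_mul_sin_dispersion hε hm p
    rw [← cos_half_sq_sub_sin_half_sq] at h1
    have h2 := cos_dispersion hε m p
    have h3 := Real.cos_sq_add_sin_sq (mixingAngle ε m p / 2)
    have e : ((M - 1 : ℤ) : ℝ) * (p * ε) = M * (p * ε) - p * ε := by push_cast; ring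
    rw [e]
    simp only [Int.cast_one, one_mul, neg_mul, mul_neg, sub_neg_eq_add, Real.cos_add, Real.cos_sub]
    linear_combination Real.sin (M * (p * ε)) * h1 + Real.cos (M * (p * ε)) * h2
      + Real.cos (M * (p * ε)) * Real.cos (dispersion ε m p * ε) * h3
  · exact h01
  · change ∫ p in _.._, (overlapFun ε m 1 0 1 M p).re = 0
    simp only [re_overlapFun_one_zero, intervalIntegral.integral_neg]
    exact neg_eq_zero.2 h01
  · change overlap ε m 1 1 1 M = 0
    refine integral_eq_zero_of_even_part hε (continuous_re_overlapFun m 1 1 1 M) hM2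
      (C := 1 / Real.sqrt (1 + m ^ 2 * ε ^ 2)) fun p => ?_
    rw [re_overlapFun_one_one, re_overlapFun_one_one, sin_half_mixingAngle_neg, dispersion_neg]
    have h1 := cos_mixingAngle_mul_sin_dispersion hε hm p
    rw [← cos_half_sq_sub_sin_half_sq] at h1
    have h2 := cos_dispersion hε m p
    have h3 := Real.cos_sq_add_sin_sq (mixingAngle ε m p / 2)
    have e : ((M + 1 : ℤ) : ℝ) * (p * ε) = M * (p * ε) + p * ε := by push_cast; ring
    rw [e]
    simp only [Int.cast_one, one_mul, neg_mul, mul_neg, sub_neg_eq_add, Real.cos_add, Real.cos_sub]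
    linear_combination -Real.sin (M * (p * ε)) * h1 + Real.cos (M * (p * ε)) * h2
      + Real.cos (M * (p * ε)) * Real.cos (dispersion ε m p * ε) * h3

theorem overlap_eq_zero {m : ℝ} (hε : 0 < ε) (hm : 0 < m) (k k' : Fin 2) {N M : ℤ}
    (h : |N| < |M|) : overlap ε m k k' N M = 0 :=
  eq_zero_of_lattice_recursion (overlap_recursion hε m k k')
    (fun _ => overlap_zero hε m k k') (fun _ => overlap_one hε hm k k') h

/-- The two inner products are complex conjugates, so only twice the real part survives; the phases
combine into one depending on the separations alone. -/
theorem inner_fieldMode_add (hε : 0 < ε) (m : ℝ) (k k' : Fin 2) {x t x' t' : ℝ} {N M : ℤ}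
    (hN : t' - t = N * ε) (hM : x' - x = M * ε) :
    (inner ℂ (fieldMode ε m k x t) (fieldMode ε m k' x' t')
      + inner ℂ (fieldMode ε m k' x' t') (fieldMode ε m k x t) : ℂ)
      = ((2 * (ε / Real.pi) * overlap ε m k k' N M : ℝ) : ℂ) := by
  have hle : -(Real.pi / ε) ≤ Real.pi / ε := by
    have : 0 < Real.pi / ε := by positivity
    linarith
  have hinner : (inner ℂ (fieldMode ε m k x t) (fieldMode ε m k' x' t') : ℂ)
      = ((ε / Real.pi : ℝ) : ℂ)
        * ∫ p in -(Real.pi / ε)..(Real.pi / ε), overlapFun ε m k k' N M p := by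
    rw [intervalIntegral.integral_of_le hle, ← integral_Icc_eq_integral_Ioc, ← integral_zone,
      ← integral_const_mul, L2.inner_def]
    refine integral_congr_ae ?_
    filter_upwards [coeFn_fieldMode m k x t, coeFn_fieldMode m k' x' t'] with p h1 h2
    rw [h1, h2]
    have hs : (Real.sqrt (ε / Real.pi) : ℂ) * Real.sqrt (ε / Real.pi) = ((ε / Real.pi : ℝ) : ℂ) := by
      rw [← Complex.ofReal_mul, Real.mul_self_sqrt (by positivity)]
    rw [← hs, overlapFun]
    have hN' : (t' : ℂ) - t = N * ε := by exact_mod_cast hN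
    have hM' : (x' : ℂ) - x = M * ε := by exact_mod_cast hM
    have hexp : Complex.exp (Complex.I * (N * (dispersion ε m p * ε) - M * ((p : ℝ) * ε)))
        = Complex.exp (Complex.I * (dispersion ε m p * t' - (p : ℝ) * x'))
          * Complex.exp (-Complex.I * (dispersion ε m p * t - (p : ℝ) * x)) := by
      rw [← Complex.exp_add]
      congr 1
      linear_combination (-Complex.I * dispersion ε m p) * hN' + Complex.I * (p : ℝ) * hM'
    rw [hexp]
    simp only [modeFun, ContinuousMap.coe_mk, RCLike.inner_apply, map_mul, Complex.conj_I,
      Complex.conj_ofReal, ← Complex.exp_conj, map_sub, RCLike.star_def]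
    ring
  have hre : (inner ℂ (fieldMode ε m k x t) (fieldMode ε m k' x' t') : ℂ).re
      = ε / Real.pi * overlap ε m k k' N M := by
    rw [hinner, Complex.re_ofReal_mul, overlap]
    congr 1
    exact (Complex.reCLM.intervalIntegral_comp_comm
      ((continuous_overlapFun m k k' N M).intervalIntegrable _ _)).symm
  rw [← inner_conj_symm (fieldMode ε m k' x' t'), Complex.add_conj, hre]
  push_cast
  ring

theorem inner_fieldMode_add_eq_zero {m : ℝ} (hε : 0 < ε) (hm : 0 < m) (k k' : Fin 2)
    (x t x' t' : AddSubgroup.zmultiples ε) (h : |(t : ℝ) - t'| < |(x : ℝ) - x'|) :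
    (inner ℂ (fieldMode ε m k x t) (fieldMode ε m k' x' t')
      + inner ℂ (fieldMode ε m k' x' t') (fieldMode ε m k x t) : ℂ) = 0 := by
  obtain ⟨_, X, rfl⟩ := x
  obtain ⟨_, T, rfl⟩ := t
  obtain ⟨_, X', rfl⟩ := x'
  obtain ⟨_, T', rfl⟩ := t'
  simp only [zsmul_eq_mul] at h ⊢
  have hlt : |T' - T| < |X' - X| := by
    rw [← sub_mul, ← sub_mul, abs_mul, abs_mul] at h
    have h2 := lt_of_mul_lt_mul_right h (abs_nonneg ε)
    rw [abs_sub_comm, abs_sub_comm (X : ℝ)] at h2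
    exact_mod_cast h2
  rw [inner_fieldMode_add hε m k k' (N := T' - T) (M := X' - X) (by push_cast; ring)
    (by push_cast; ring), overlap_eq_zero hε hm k k' hlt]
  simp

end Locality

/-! ### Spectral condition: a trigonometric inequality and positive operators -/

section Positivity
open ContinuousLinearMap (adjoint)
open HilbertTensor

variable {ε : ℝ}

/-- The difference of the sides vanishes at u = 0 and has derivative (1 - s²) sin(su) sin u ≥ 0. It
is the numerator of the derivative of sin(su)/sin u. -/
theorem sin_mul_cos_le_mul_cos_mul_sin {s u : ℝ} (hs0 : 0 ≤ s) (hs1 : s ≤ 1) (hu0 : 0 ≤ u)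
    (hu : u ≤ Real.pi / 2) :
    Real.sin (s * u) * Real.cos u ≤ s * Real.cos (s * u) * Real.sin u := by
  have hmono : MonotoneOn (fun u => s * Real.cos (s * u) * Real.sin u
      - Real.sin (s * u) * Real.cos u) (Set.Icc 0 (Real.pi / 2)) := by
    have hd : ∀ u : ℝ, HasDerivAt (fun u => s * Real.cos (s * u) * Real.sin u
        - Real.sin (s * u) * Real.cos u) ((1 - s ^ 2) * Real.sin (s * u) * Real.sin u) u := by
      intro u
      have h1 : HasDerivAt (fun u : ℝ => s * u) s u := by
        simpa using (hasDerivAt_id u).const_mul s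
      have h2 := ((h1.cos.const_mul s).mul (Real.hasDerivAt_sin u)).sub
        (h1.sin.mul (Real.hasDerivAt_cos u))
      exact h2.congr_deriv (by ring)
    refine monotoneOn_of_deriv_nonneg (convex_Icc _ _)
      (fun u _ => (hd u).continuousAt.continuousWithinAt)
      (fun u _ => (hd u).differentiableAt.differentiableWithinAt) fun u hu => ?_
    rw [interior_Icc] at hu
    rw [(hd u).deriv]
    have hsu : s * u ≤ u := mul_le_of_le_one_left hu.1.le hs1
    have h1 : 0 ≤ Real.sin (s * u) :=
      Real.sin_nonneg_of_nonneg_of_le_pi (mul_nonneg hs0 hu.1.le) (by linarith [hu.2, Real.pi_pos])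
    have h2 : 0 ≤ Real.sin u :=
      Real.sin_nonneg_of_nonneg_of_le_pi hu.1.le (by linarith [hu.2, Real.pi_pos])
    have h3 : 0 ≤ 1 - s ^ 2 := by nlinarith
    positivity
  have := hmono ⟨le_rfl, by positivity⟩ ⟨hu0, hu⟩ hu0
  simp only [mul_zero, Real.sin_zero, zero_mul, sub_zero] at this
  linarith

/-- The ratio sin(su)/sin u increases on (0, π/2]; compare its value at u with the one at π/2. -/
theorem sin_mul_le_sin_mul_sin {s u : ℝ} (hs0 : 0 ≤ s) (hs1 : s ≤ 1) (hu0 : 0 ≤ u)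
    (hu : u ≤ Real.pi / 2) :
    Real.sin (s * u) ≤ Real.sin (s * (Real.pi / 2)) * Real.sin u := by
  rcases hu0.eq_or_lt with rfl | hu0
  · simp
  have hmono : MonotoneOn (fun u => Real.sin (s * u) / Real.sin u) (Set.Ioc 0 (Real.pi / 2)) := by
    have hsin : ∀ u ∈ Set.Ioc 0 (Real.pi / 2), 0 < Real.sin u := fun u hu =>
      Real.sin_pos_of_pos_of_lt_pi hu.1 (by linarith [hu.2, Real.pi_pos])
    have hd : ∀ u ∈ Set.Ioc 0 (Real.pi / 2), HasDerivAt (fun u => Real.sin (s * u) / Real.sin u)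
        ((Real.cos (s * u) * s * Real.sin u - Real.sin (s * u) * Real.cos u)
          / Real.sin u ^ 2) u := by
      intro u hu
      have h1 : HasDerivAt (fun u : ℝ => s * u) s u := by
        simpa using (hasDerivAt_id u).const_mul s
      exact h1.sin.div (Real.hasDerivAt_sin u) (hsin u hu).ne'
    refine monotoneOn_of_deriv_nonneg (convex_Ioc _ _)
      (fun u hu => (hd u hu).continuousAt.continuousWithinAt)
      (fun u hu => (hd u (interior_subset hu)).differentiableAt.differentiableWithinAt)
      fun u hu => ?_
    have hu' := interior_subset hu
    rw [(hd u hu').deriv]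
    have := sin_mul_cos_le_mul_cos_mul_sin hs0 hs1 hu'.1.le hu'.2
    exact div_nonneg (by linarith) (sq_nonneg _)
  have h := hmono ⟨hu0, hu⟩ ⟨by positivity, le_rfl⟩ hu
  simp only [Real.sin_pi_div_two, div_one] at h
  rwa [div_le_iff₀ (Real.sin_pos_of_pos_of_lt_pi hu0 (by linarith [Real.pi_pos]))] at h

theorem cos_mul_cos_le {a x : ℝ} (ha0 : 0 ≤ a) (ha : a ≤ Real.pi / 2) (hx0 : 0 ≤ x)
    (hx : x ≤ Real.pi) : Real.cos a * Real.cos x ≤ Real.cos ((1 - a / Real.pi) * x) := by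
  have hπ := Real.pi_pos
  have haπ : a / Real.pi ≤ 1 / 2 := by rw [div_le_iff₀ hπ]; linarith
  have haπ0 : 0 ≤ a / Real.pi := by positivity
  rcases le_total x (Real.pi / 2) with hx2 | hx2
  -- For x ≤ π/2 shrinking the angle and dropping the factor cos a ≤ 1 both go the right way, since
  -- cos x ≥ 0.
  · have h1 : Real.cos x ≤ Real.cos ((1 - a / Real.pi) * x) := by
      refine Real.cos_le_cos_of_nonneg_of_le_pi (by nlinarith) hx ?_
      nlinarith
    have h2 : 0 ≤ Real.cos x := Real.cos_nonneg_of_mem_Icc ⟨by linarith, hx2⟩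
    nlinarith [Real.cos_le_one a]
  -- For x ≥ π/2 the choice of s makes sπ/2 = x - π/2, so with z = su the product sin(sπ/2) sin u is
  -- -cos x cos a, whence cos a cos x ≤ -sin z = cos(z + π/2).
  · have h1 := sin_mul_le_sin_mul_sin (s := 2 * (x - Real.pi / 2) / Real.pi)
      (u := Real.pi / 2 - a) (div_nonneg (by linarith) hπ.le)
      (by rw [div_le_one hπ]; linarith) (by linarith) (by linarith)
    have e1 : 2 * (x - Real.pi / 2) / Real.pi * (Real.pi / 2) = x - Real.pi / 2 := by
      field_simp
    rw [e1, Real.sin_pi_div_two_sub, Real.sin_sub_pi_div_two] at h1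
    set z := 2 * (x - Real.pi / 2) / Real.pi * (Real.pi / 2 - a) with hz
    -- The gap between the two angles is exactly a(π - x)/π ≥ 0, and cosine decreases on [0, π].
    have hle : (1 - a / Real.pi) * x ≤ z + Real.pi / 2 := by
      have : z + Real.pi / 2 - (1 - a / Real.pi) * x = a * (Real.pi - x) / Real.pi := by
        rw [hz]; field_simp; ring
      have h3 : 0 ≤ a * (Real.pi - x) / Real.pi :=
        div_nonneg (mul_nonneg ha0 (by linarith)) hπ.le
      linarith
    have hzle : z ≤ Real.pi / 2 := by
      have h3 : 2 * (x - Real.pi / 2) / Real.pi ≤ 1 := by rw [div_le_one hπ]; linarith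
      calc z ≤ 1 * (Real.pi / 2 - a) := mul_le_mul_of_nonneg_right h3 (by linarith)
        _ ≤ Real.pi / 2 := by linarith
    have h2 := Real.cos_le_cos_of_nonneg_of_le_pi
      (mul_nonneg (by linarith : 0 ≤ 1 - a / Real.pi) hx0) (by linarith) hle
    rw [Real.cos_add_pi_div_two] at h2
    linarith

/-- With a = ω₀ε one has cos a = 1/√(1+m²ε²), so ω_pε = arccos(cos a cos pε). Applying the
decreasing arccos to `cos_mul_cos_le` at x = |p|ε gives the bound. -/
theorem mul_abs_le_dispersion (hε : 0 < ε) (m : ℝ) {p : ℝ}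
    (hp : p ∈ Set.Icc (-(Real.pi / ε)) (Real.pi / ε)) :
    (1 - dispersion ε m 0 * ε / Real.pi) * |p| ≤ dispersion ε m p := by
  have hπ := Real.pi_pos
  set r := Real.sqrt (1 + m ^ 2 * ε ^ 2) with hr
  have hr0 : 0 ≤ r := Real.sqrt_nonneg _
  set a := dispersion ε m 0 * ε with ha
  have hcos : Real.cos a = 1 / r := by rw [ha, cos_dispersion hε]; simp [hr]
  have ha' : a = Real.arccos (1 / r) := by rw [ha, dispersion_mul hε]; simp [hr]
  have ha0 : 0 ≤ a := by rw [ha']; exact Real.arccos_nonneg _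
  have ha2 : a ≤ Real.pi / 2 := by rw [ha']; exact Real.arccos_le_pi_div_two.2 (by positivity)
  have hp1 : |p| * ε ≤ Real.pi := by
    have := abs_le.2 hp
    rwa [le_div_iff₀ hε] at this
  have hp0 : 0 ≤ |p| * ε := by positivity
  have h := cos_mul_cos_le ha0 ha2 hp0 hp1
  have haπ : a / Real.pi ≤ 1 / 2 := by rw [div_le_iff₀ hπ]; linarith
  have haπ0 : 0 ≤ a / Real.pi := by positivity
  have h1 : (1 - a / Real.pi) * (|p| * ε) ≤ Real.pi := by nlinarith
  have h2 : 0 ≤ (1 - a / Real.pi) * (|p| * ε) := mul_nonneg (by linarith) hp0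
  have hc : Real.cos (|p| * ε) = Real.cos (p * ε) := by
    rw [← abs_of_pos hε, ← abs_mul, Real.cos_abs, abs_of_pos hε]
  have h3 := Real.arccos_le_arccos h
  rw [Real.arccos_cos h2 h1, hcos, hc, one_div_mul_eq_div, ← dispersion_mul hε] at h3
  rw [← mul_assoc] at h3
  exact le_of_mul_le_mul_right h3 hε

section multiplication

variable {X : Type} [TopologicalSpace X] [CompactSpace X] [MeasureSpace X]
  [OpensMeasurableSpace X]

/-- Multiplication by √r is self-adjoint and its square is multiplication by r. -/
theorem isPositive_mulOp (r : C(X, ℝ)) (hr : ∀ x, 0 ≤ r x) (F : C(X, ℂ)) (hF : ∀ x, F x = r x) :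
    (mulOp F).IsPositive := by
  set G : C(X, ℂ) := ⟨fun x => (Real.sqrt (r x) : ℂ), by fun_prop⟩ with hG
  have hFG : F = star G * G := by
    ext x
    simp only [hG, hF, ContinuousMap.mul_apply, ContinuousMap.star_apply, ContinuousMap.coe_mk,
      RCLike.star_def, Complex.conj_ofReal]
    rw [← Complex.ofReal_mul, Real.mul_self_sqrt (hr x)]
  have : mulOp F = (adjoint (mulOp G)).comp (mulOp G) := by
    ext1 u
    rw [adjoint_mulOp, ContinuousLinearMap.comp_apply, mulOp_mulOp, hFG]
  rw [this]
  exact ContinuousLinearMap.isPositive_adjoint_comp_self _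

end multiplication

theorem isPositive_of_coe_eq_mulOp {n : ℕ} {T : ExteriorPower ε n →L[ℂ] ExteriorPower ε n}
    (r : C(Fin n → Zone ε, ℝ)) (hr : ∀ p, 0 ≤ r p) (F : C(Fin n → Zone ε, ℂ))
    (hF : ∀ p, F p = r p) (hT : ∀ u, (T u : TensorPower ε n) = mulOp F (u : TensorPower ε n)) :
    T.IsPositive := by
  have h := isPositive_mulOp r hr F hF
  refine ContinuousLinearMap.isPositive_def.2 ⟨fun u v => ?_, fun u => ?_⟩
  · change inner ℂ ((T u : TensorPower ε n)) (v : TensorPower ε n)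
      = inner ℂ (u : TensorPower ε n) (T v : TensorPower ε n)
    rw [hT, hT]
    exact h.isSymmetric _ _
  · change 0 ≤ (inner ℂ ((T u : TensorPower ε n)) (u : TensorPower ε n)).re
    rw [hT]
    exact h.re_inner_nonneg_left _

theorem isPositive_of_diagonal {T : Fock ε →L[ℂ] Fock ε}
    {S : ∀ n, ExteriorPower ε n →L[ℂ] ExteriorPower ε n} (h : ∀ v n, T v n = S n (v n))
    (hS : ∀ n, (S n).IsPositive) : T.IsPositive := by
  refine ContinuousLinearMap.isPositive_def.2 ⟨fun u v => ?_, fun u => ?_⟩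
  · have h1 := lp.hasSum_inner (𝕜 := ℂ) (T u) v
    have h2 := lp.hasSum_inner (𝕜 := ℂ) u (T v)
    simp only [h] at h1 h2
    refine h1.unique ?_
    have h3 : ∀ n, inner ℂ (S n (u n)) (v n) = inner ℂ (u n) (S n (v n)) := fun n =>
      (hS n).isSymmetric _ _
    simp only [h3]
    exact h2
  · have h1 := (lp.hasSum_inner (𝕜 := ℂ) (T u) u).mapL Complex.reCLM
    simp only [h] at h1
    exact h1.nonneg fun n => (hS n).re_inner_nonneg_left _

/-- The function `h(p₁) + ⋯ + h(pₙ)` as a real function. -/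
def realSumFun (n : ℕ) (h : C(Zone ε, ℝ)) : C(Fin n → Zone ε, ℝ) :=
  ⟨fun p => ∑ i, h (p i), by fun_prop⟩

theorem realSumFun_nonneg {h : C(Zone ε, ℝ)} (hh : ∀ p, 0 ≤ h p) (n : ℕ) (p : Fin n → Zone ε) :
    0 ≤ realSumFun n h p := by
  change 0 ≤ ∑ i, h (p i)
  exact Finset.sum_nonneg fun i _ => hh (p i)

theorem coe_extDeriv (n : ℕ) (h : C(Zone ε, ℝ)) (u : ExteriorPower ε n) :
    (extDeriv n h u : TensorPower ε n) = mulOp (sumFun n h) (u : TensorPower ε n) := rfl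

theorem isPositive_ite {n : ℕ} (P : Prop) [Decidable P]
    {T : ExteriorPower ε n →L[ℂ] ExteriorPower ε n} (hT : T.IsPositive) :
    (if P then T else 0).IsPositive := by
  split_ifs
  · exact hT
  · exact ContinuousLinearMap.isPositive_zero

theorem isPositive_fockCut (N : ℕ) : (fockCut ε N).IsPositive :=
  isPositive_of_diagonal (S := fun n => if n ≤ N then ContinuousLinearMap.id ℂ _ else 0)
    (fun _ _ => rfl) fun _ => isPositive_ite _ ContinuousLinearMap.isPositive_id

theorem isPositive_fockDeriv (N : ℕ) {h : C(Zone ε, ℝ)} (hh : ∀ p, 0 ≤ h p) :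
    (fockDeriv N h).IsPositive :=
  isPositive_of_diagonal (S := fun n => if n ≤ N then extDeriv n h else 0) (fun _ _ => rfl)
    fun n => isPositive_ite _ (isPositive_of_coe_eq_mulOp (realSumFun n h)
      (realSumFun_nonneg hh n) (sumFun n h) (fun _ => rfl) (coe_extDeriv n h))

theorem fockDeriv_mul_fockDeriv_apply (N : ℕ) (h k : C(Zone ε, ℝ)) (v : Fock ε) (n : ℕ) :
    (fockDeriv N h * fockDeriv N k) v n
      = if n ≤ N then extDeriv n h (extDeriv n k (v n)) else 0 := by
  rw [mul_apply_eq_comp, fockDeriv_apply, fockDeriv_apply]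
  split_ifs <;> rfl

/-- Products of positive operators need not be positive, but here both factors are multiplications
on each exterior power, so the product multiplies by a nonnegative function or is zero. -/
theorem isPositive_fockDeriv_mul (N : ℕ) {h k : C(Zone ε, ℝ)} (hh : ∀ p, 0 ≤ h p)
    (hk : ∀ p, 0 ≤ k p) : (fockDeriv N h * fockDeriv N k).IsPositive := by
  refine isPositive_of_diagonal
    (S := fun n => if n ≤ N then (extDeriv n h).comp (extDeriv n k) else 0) (fun v n => ?_)
    fun n => isPositive_ite _ (isPositive_of_coe_eq_mulOp (realSumFun n h * realSumFun n k)
      (fun p => mul_nonneg (realSumFun_nonneg hh n p) (realSumFun_nonneg hk n p))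
      (sumFun n h * sumFun n k) (fun p => ?_) fun u => ?_)
  · rw [fockDeriv_mul_fockDeriv_apply]
    split_ifs <;> rfl
  · rw [ContinuousMap.mul_apply, ContinuousMap.mul_apply, Complex.ofReal_mul]
    rfl
  · rw [ContinuousLinearMap.comp_apply, coe_extDeriv, coe_extDeriv, mulOp_mulOp]

theorem extDeriv_extDeriv (n : ℕ) (h k : C(Zone ε, ℝ)) (u : ExteriorPower ε n) :
    extDeriv n h (extDeriv n k u) = extDeriv n k (extDeriv n h u) := by
  refine Subtype.ext ?_
  rw [coe_extDeriv, coe_extDeriv, coe_extDeriv, coe_extDeriv, mulOp_mulOp, mulOp_mulOp, mul_comm]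

theorem fockDeriv_mul_comm (N : ℕ) (h k : C(Zone ε, ℝ)) :
    fockDeriv N h * fockDeriv N k = fockDeriv N k * fockDeriv N h := by
  ext1 v
  refine lp.ext (funext fun n => ?_)
  rw [fockDeriv_mul_fockDeriv_apply, fockDeriv_mul_fockDeriv_apply, extDeriv_extDeriv]

theorem extDeriv_add_smul (n : ℕ) (h k : C(Zone ε, ℝ)) (c : ℝ) (u : ExteriorPower ε n) :
    extDeriv n (h + c • k) u = extDeriv n h u + (c : ℂ) • extDeriv n k u := by
  refine Subtype.ext ?_
  rw [Submodule.coe_add, Submodule.coe_smul, coe_extDeriv, coe_extDeriv, coe_extDeriv]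
  ext1
  filter_upwards [coeFn_mulOp (sumFun n (h + c • k)) (u : TensorPower ε n),
    coeFn_mulOp (sumFun n h) (u : TensorPower ε n), coeFn_mulOp (sumFun n k) (u : TensorPower ε n),
    Lp.coeFn_add (mulOp (sumFun n h) (u : TensorPower ε n))
      ((c : ℂ) • mulOp (sumFun n k) (u : TensorPower ε n)),
    Lp.coeFn_smul (c : ℂ) (mulOp (sumFun n k) (u : TensorPower ε n))] with p h1 h2 h3 h4 h5
  rw [h1, h4, Pi.add_apply, h2, h5, Pi.smul_apply, h3]
  simp only [sumFun, ContinuousMap.coe_mk, ContinuousMap.add_apply, ContinuousMap.smul_apply,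
    smul_eq_mul, Finset.sum_add_distrib, ← Finset.mul_sum]
  push_cast
  ring

theorem fockDeriv_add_smul (N : ℕ) (h k : C(Zone ε, ℝ)) (c : ℝ) :
    fockDeriv N (h + c • k) = fockDeriv N h + (c : ℂ) • fockDeriv N k := by
  ext1 v
  refine lp.ext (funext fun n => ?_)
  rw [add_apply, smul_apply, lp.coeFn_add, lp.coeFn_smul, Pi.add_apply, Pi.smul_apply,
    fockDeriv_apply, fockDeriv_apply, fockDeriv_apply]
  split_ifs
  · exact extDeriv_add_smul n h k c (v n)
  · simp

theorem secondQuantSumAux_add_smul (N : ℕ) (h k : C(Zone ε, ℝ)) (c : ℝ) :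
    secondQuantSumAux (h + c • k) N
      = secondQuantSumAux h N + (c : ℂ) • secondQuantSumAux k N := by
  simp only [secondQuantSumAux, fockDeriv_add_smul, map_add_left, map_add_right, map_smul_left,
    map_smul_right, smul_add]
  abel

theorem isPositive_secondQuantSumAux (N : ℕ) {h : C(Zone ε, ℝ)} (hh : ∀ p, 0 ≤ h p) :
    (secondQuantSumAux h N).IsPositive :=
  (map_isPositive (isPositive_fockDeriv N hh) (isPositive_fockCut N)).add
    (map_isPositive (isPositive_fockCut N) (isPositive_fockDeriv N hh))

/-- The cut is idempotent and is absorbed by the operators it meets. The expansion exhibits the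
product as a sum of tensor products whose factors are separately positive for h, k ≥ 0. -/
theorem secondQuantSumAux_mul (N : ℕ) (h k : C(Zone ε, ℝ)) :
    secondQuantSumAux h N * secondQuantSumAux k N
      = map (fockDeriv N h * fockDeriv N k) (fockCut ε N) + map (fockDeriv N h) (fockDeriv N k)
        + map (fockDeriv N k) (fockDeriv N h)
        + map (fockCut ε N) (fockDeriv N h * fockDeriv N k) := by
  have h1 : fockCut ε N * fockCut ε N = fockCut ε N := fockCut_comp le_rfl
  have h2 : ∀ h : C(Zone ε, ℝ), fockCut ε N * fockDeriv N h = fockDeriv N h :=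
    fockCut_comp_fockDeriv le_rfl
  have h3 : ∀ h : C(Zone ε, ℝ), fockDeriv N h * fockCut ε N = fockDeriv N h :=
    fockDeriv_comp_fockCut le_rfl
  rw [secondQuantSumAux, secondQuantSumAux, mul_add, add_mul, add_mul, map_mul_map, map_mul_map,
    map_mul_map, map_mul_map, h1, h2, h3]
  abel

theorem isPositive_secondQuantSumAux_mul (N : ℕ) {h k : C(Zone ε, ℝ)} (hh : ∀ p, 0 ≤ h p)
    (hk : ∀ p, 0 ≤ k p) : (secondQuantSumAux h N * secondQuantSumAux k N).IsPositive := by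
  rw [secondQuantSumAux_mul]
  exact (((map_isPositive (isPositive_fockDeriv_mul N hh hk) (isPositive_fockCut N)).add
    (map_isPositive (isPositive_fockDeriv N hh) (isPositive_fockDeriv N hk))).add
    (map_isPositive (isPositive_fockDeriv N hk) (isPositive_fockDeriv N hh))).add
    (map_isPositive (isPositive_fockCut N) (isPositive_fockDeriv_mul N hh hk))

theorem secondQuantSumAux_mul_comm (N : ℕ) (h k : C(Zone ε, ℝ)) :
    secondQuantSumAux h N * secondQuantSumAux k N
      = secondQuantSumAux k N * secondQuantSumAux h N := by
  rw [secondQuantSumAux_mul, secondQuantSumAux_mul, fockDeriv_mul_comm N h k]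
  abel

theorem particleCut_secondQuantSumAux (h : C(Zone ε, ℝ)) (N : ℕ) (Ψ : StateSpace ε) :
    particleCut ε N (secondQuantSumAux h N Ψ) = secondQuantSumAux h N Ψ := by
  rw [secondQuantSumAux, add_apply, map_add, particleCut, map_map, map_map,
    fockCut_comp_fockDeriv le_rfl, fockCut_comp le_rfl]

theorem secondQuantSum_sq_apply (h : C(Zone ε, ℝ)) (N : ℕ) (Ψ : FiniteParticle ε)
    (hN : particleCut ε N (Ψ : StateSpace ε) = Ψ) :
    ((secondQuantSum h ^ 2) Ψ : StateSpace ε)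
      = (secondQuantSumAux h N * secondQuantSumAux h N) (Ψ : StateSpace ε) := by
  have h1 := secondQuantSum_apply h N Ψ hN
  rw [pow_two, Module.End.mul_apply, secondQuantSum_apply h N _
    (by rw [h1, particleCut_secondQuantSumAux]), h1, mul_apply_eq_comp]

theorem isPositive_of_forall_cut {T : FiniteParticle ε →ₗ[ℂ] FiniteParticle ε}
    {S : ℕ → StateSpace ε →L[ℂ] StateSpace ε}
    (h : ∀ N (Ψ : FiniteParticle ε), particleCut ε N (Ψ : StateSpace ε) = Ψ →
      (T Ψ : StateSpace ε) = S N (Ψ : StateSpace ε))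
    (hS : ∀ N, (S N).IsPositive) : T.IsPositive := by
  refine ⟨fun Ψ Φ => ?_, fun Ψ => ?_⟩
  · obtain ⟨N, hN⟩ := exists_cut Ψ
    obtain ⟨M, hM⟩ := exists_cut Φ
    change inner ℂ (T Ψ : StateSpace ε) (Φ : StateSpace ε)
      = inner ℂ (Ψ : StateSpace ε) (T Φ : StateSpace ε)
    rw [h (max N M) Ψ (cut_mono (le_max_left N M) hN), h (max N M) Φ (cut_mono (le_max_right N M) hM)]
    exact (hS _).isSymmetric _ _
  · obtain ⟨N, hN⟩ := exists_cut Ψ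
    change 0 ≤ (inner ℂ (T Ψ : StateSpace ε) (Ψ : StateSpace ε)).re
    rw [h N Ψ hN]
    exact (hS N).re_inner_nonneg_left _

theorem isPositive_hamiltonian (hε : 0 < ε) (m : ℝ) : (hamiltonian ε m).IsPositive := by
  refine isPositive_of_forall_cut (S := secondQuantSumAux (energy ε m))
    (secondQuantSum_apply (energy ε m)) fun N => isPositive_secondQuantSumAux N fun p => ?_
  exact mul_nonneg (by positivity) (Real.arccos_nonneg _)

/-- Difference of squares: H - cP and H + cP are second quantizations of ω_p ∓ cp, and both
functions are nonnegative because c|p| ≤ ω_p. -/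
theorem isPositive_hamiltonian_sq_sub (hε : 0 < ε) (m : ℝ) :
    (hamiltonian ε m ^ 2
      - (((1 - dispersion ε m 0 * ε / Real.pi) ^ 2 : ℝ) : ℂ) • momentum ε ^ 2).IsPositive := by
  set c := 1 - dispersion ε m 0 * ε / Real.pi with hc
  have hpos : ∀ p : Zone ε, 0 ≤ (energy ε m + (-c) • coordinate ε) p := by
    intro p
    have h := mul_abs_le_dispersion hε m p.2
    -- This says c ≥ 0: the product ω₀ε is a value of arccos, hence at most π.
    have h0 : dispersion ε m 0 * ε / Real.pi ≤ 1 := by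
      rw [dispersion_mul hε, div_le_one Real.pi_pos]
      exact Real.arccos_le_pi _
    have h1 : c * (p : ℝ) ≤ c * |(p : ℝ)| :=
      mul_le_mul_of_nonneg_left (le_abs_self _) (by linarith)
    change 0 ≤ dispersion ε m p + -c * (p : ℝ)
    linarith
  have hpos' : ∀ p : Zone ε, 0 ≤ (energy ε m + c • coordinate ε) p := by
    intro p
    have h := mul_abs_le_dispersion hε m p.2
    have h0 : dispersion ε m 0 * ε / Real.pi ≤ 1 := by
      rw [dispersion_mul hε, div_le_one Real.pi_pos]
      exact Real.arccos_le_pi _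
    have h1 : c * -(p : ℝ) ≤ c * |(p : ℝ)| :=
      mul_le_mul_of_nonneg_left (neg_le_abs _) (by linarith)
    change 0 ≤ dispersion ε m p + c * (p : ℝ)
    linarith
  refine isPositive_of_forall_cut (S := fun N =>
    secondQuantSumAux (energy ε m + (-c) • coordinate ε) N
      * secondQuantSumAux (energy ε m + c • coordinate ε) N) (fun N Ψ hN => ?_)
    fun N => isPositive_secondQuantSumAux_mul N hpos hpos'
  rw [LinearMap.sub_apply, LinearMap.smul_apply, Submodule.coe_sub, Submodule.coe_smul,
    hamiltonian, momentum, secondQuantSum_sq_apply _ N Ψ hN, secondQuantSum_sq_apply _ N Ψ hN,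
    secondQuantSumAux_add_smul, secondQuantSumAux_add_smul]
  rw [← smul_apply, ← sub_apply]
  congr 1
  -- Commutativity cancels the cross terms ±cHP in the product of the two factors.
  have hcomm := secondQuantSumAux_mul_comm N (energy ε m) (coordinate ε)
  simp only [add_mul, mul_add, smul_mul_assoc, mul_smul_comm, hcomm, Complex.ofReal_neg,
    Complex.ofReal_pow]
  module

end Positivity

end FeynmanAnticheckers
end

/-! ### Assembly of the axioms -/

open FeynmanAnticheckers
theorem mainTheorem12 (ε m : ℝ) (hε : 0 < ε) (hm : 0 < m) :
    (∀ (k : Fin 2) (x t : AddSubgroup.zmultiples ε),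
      ∃ C : ℝ, ∀ Ψ : StateSpace ε, ‖fieldOp ε m k x t Ψ‖ ≤ C * ‖Ψ‖) ∧
    (vacuum ε ≠ 0 ∧ ∀ Ψ : StateSpace ε,
      (expH ε m (-ε) Ψ = Ψ ∧ expP ε (-ε) Ψ = Ψ) ↔ ∃ c : ℂ, Ψ = c • vacuum ε) ∧
    Dense (Submodule.span ℂ
      {Ψ : StateSpace ε | ∃ A B : List (Fin 2 × AddSubgroup.zmultiples ε × AddSubgroup.zmultiples ε),
        Ψ = (A.map fun s => fieldOp ε m s.1 s.2.1 s.2.2).prod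
          ((B.map fun s => ContinuousLinearMap.adjoint (fieldOp ε m s.1 s.2.1 s.2.2)).prod
            (vacuum ε))} : Set (StateSpace ε)) ∧
    (∀ (k : Fin 2) (x t a b : AddSubgroup.zmultiples ε),
      (expH ε m (-b) * expP ε a) * fieldOp ε m k x t * (expP ε (-a) * expH ε m b)
        = fieldOp ε m k (x + a) (t + b)) ∧
    ((hamiltonian ε m).IsPositive ∧
      (hamiltonian ε m ^ 2
        - (((1 - dispersion ε m 0 * ε / Real.pi) ^ 2 : ℝ) : ℂ) • momentum ε ^ 2).IsPositive) ∧
    (∀ (k k' : Fin 2) (x t x' t' : AddSubgroup.zmultiples ε), |(t : ℝ) - t'| < |(x : ℝ) - x'| →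
      fieldOp ε m k x t * fieldOp ε m k' x' t' + fieldOp ε m k' x' t' * fieldOp ε m k x t = 0 ∧
      fieldOp ε m k x t * ContinuousLinearMap.adjoint (fieldOp ε m k' x' t')
        + ContinuousLinearMap.adjoint (fieldOp ε m k' x' t') * fieldOp ε m k x t = 0 ∧
      ContinuousLinearMap.adjoint (fieldOp ε m k x t)
          * ContinuousLinearMap.adjoint (fieldOp ε m k' x' t')
        + ContinuousLinearMap.adjoint (fieldOp ε m k' x' t')
          * ContinuousLinearMap.adjoint (fieldOp ε m k x t) = 0) := by
  refine ⟨fun k x t => ⟨_, (fieldOp ε m k x t).le_opNorm⟩, ⟨?_, fun Ψ => ⟨fun h => ?_, ?_⟩⟩, ?_,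
    fun k x t a b => fieldOp_translate m k x t a b,
    ⟨isPositive_hamiltonian hε m, isPositive_hamiltonian_sq_sub hε m⟩,
    fun k k' x t x' t' h => ?_⟩
  · rw [← norm_pos_iff, norm_vacuum]
    exact one_pos
  -- The operator e^{iPε} is the second quantization of e^{iεp}, whose powers vanish weakly;
  -- translation invariance thus singles out the vacuum.
  · exact eq_smul_vacuum_of_fixed (tendsto_phase_pow hε) h.2
  · rintro ⟨c, rfl⟩
    simp only [expH, expP, map_smul, secondQuantProd_vacuum, and_self]
  · have h := dense_span_field (dense_span_fieldMode hε m)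
    simp only [← fieldOp_eq] at h
    exact h
  · have h0 := inner_fieldMode_add_eq_zero hε hm k k' x t x' t' h
    simp only [fieldOp_eq]
    refine ⟨field_mul_field _ _, ?_, adjoint_field_mul_adjoint_field _ _⟩
    rw [field_mul_adjoint_field, h0, zero_smul]
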